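/- Let $r\ge 1$ be a fixed integer. An instance of {\sc Max-$r$-CSP} consists of a set $V$ of $n$ Boolean variables and a finite collection of constraints; each constraint is an arbitrary Boolean function of at most $r$ distinct variables of $V$ and has a positive integral weight. Let $A$ be the average, over all $2^n$ truth assignments, of the total weight of satisfied constraints. The parameterized problem {\sc Max-$r$-CSP-AA} is: given an instance $I$ and the parameter $k\in\mathbb{Z}_{\ge 0}$, decide whether there is a truth assignment for which the total weight of satisfied constraints is at least $A+k$. The size $|I|$ is the length of a standard encoding of $I$ (one symbol per variable; for each constraint the indices of its variables in binary, its truth table, and its weight in binary); in the input $(I,k)$ the parameter $k$ is written in binary. \textbf{Theorem.} For every fixed $r\ge 1$, {\sc Max-$r$-CSP-AA} admits a kernel of polynomial size. That is, there are a map $(I,k)\mapsto(I',k')$ from pairs to pairs, computable by a deterministic Turing machine in time polynomial in the length of the encoding of $(I,k)$, a function $f:\mathbb{N}\to\mathbb{N}$ and a polynomial $g$ such that, for all $I$ and $k$: (i) $(I,k)$ is a Yes-instance of {\sc Max-$r$-CSP-AA} if and only if $(I',k')$ is; (ii) $k'\le f(k)$; (iii) $|I'|\le g(k)$. -/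

import Mathlib

/-! ### Parameterized problems and kernelizations -/

/-- A parameterized problem: a type of instances, an injective encoding of the instances as words
over a finite alphabet, and the set of the pairs `(I, k)` that are answered with "yes". -/
structure ParamProblem where
  Inst : Type
  Sym : Type
  symFintype : Fintype Sym
  encode : Inst → List Sym
  encode_injective : Function.Injective encode
  yes : Set (Inst × ℕ)

namespace ParamProblem

/-- The size `|I|` of an instance: the length of the word that encodes it. -/
def size (P : ParamProblem) (I : P.Inst) : ℕ := (P.encode I).length

/-- The word that encodes the pair `(I, k)`: the word of `I`, followed by `k` in binary. -/
def encodePair (P : ParamProblem) (p : P.Inst × ℕ) : List (P.Sym ⊕ Bool) :=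
  (P.encode p.1).map Sum.inl ++ (Computability.encodeNat p.2).map Sum.inr

/-- `F` is a bikernelization from `P` to `Q`, with the bounds `f` and `g`: it is computed by a
(multi-stack) Turing machine in time polynomial in the length of the input word, it preserves the
answer, the new parameter is at most `f k`, and the new instance has size at most `g k`. -/
def IsBikernelization (P Q : ParamProblem) (F : P.Inst × ℕ → Q.Inst × ℕ) (f g : ℕ → ℕ) : Prop :=
  Nonempty (Turing.TM2ComputableInPolyTime P.encodePair Q.encodePair F) ∧
  (∀ I k, (I, k) ∈ P.yes ↔ F (I, k) ∈ Q.yes) ∧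
  (∀ I k, (F (I, k)).2 ≤ f k) ∧
  (∀ I k, Q.size (F (I, k)).1 ≤ g k)

/-- A kernelization is a bikernelization from a problem to itself. -/
def IsKernelization (P : ParamProblem) (F : P.Inst × ℕ → P.Inst × ℕ) (f g : ℕ → ℕ) : Prop :=
  IsBikernelization P P F f g

/-- `P` has a kernel of polynomial size: the size bound `g` is a polynomial. -/
def HasPolynomialSizeKernel (P : ParamProblem) : Prop :=
  ∃ (F : P.Inst × ℕ → P.Inst × ℕ) (f : ℕ → ℕ) (g : Polynomial ℕ),
    P.IsKernelization F f (fun k => g.eval k)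

end ParamProblem

/-! ### Weighted Boolean constraint satisfaction -/

namespace MaxCSP

/-- A Boolean function of at most `r` distinct variables among `n` variables, with a positive
integral weight. -/
structure Constraint (r n : ℕ) where
  arity : ℕ
  arity_le : arity ≤ r
  scope : Fin arity ↪ Fin n
  func : (Fin arity → Bool) → Bool
  weight : ℕ
  weight_pos : 0 < weight

/-- The constraint is satisfied by the truth assignment `x`. -/
def Constraint.sat {r n : ℕ} (c : Constraint r n) (x : Fin n → Bool) : Bool :=
  c.func (fun i => x (c.scope i))

/-- An instance: a number `n` of variables and a finite collection of constraints on them. -/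
structure Instance (r : ℕ) where
  n : ℕ
  constraints : List (Constraint r n)

/-- Total weight of the constraints that are satisfied by `x`. -/
def Instance.satWeight {r : ℕ} (I : Instance r) (x : Fin I.n → Bool) : ℕ :=
  ((I.constraints.filter (fun c => c.sat x)).map (fun c => c.weight)).sum

/-- Average, over all truth assignments, of the weight of the satisfied constraints. -/
def Instance.average {r : ℕ} (I : Instance r) : ℚ :=
  (∑ x : Fin I.n → Bool, (I.satWeight x : ℚ)) / 2 ^ I.n

/-! ### Encoding of instances -/

/-- The alphabet for instances. -/
inductive Sym
  | bit (b : Bool)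
  | var
  | arg
  | table
  | endMark
  deriving DecidableEq, Fintype

/-- A bit string with an end marker. -/
def encodeBits (l : List Bool) : List Sym := l.map Sym.bit ++ [Sym.endMark]

/-- A natural number in binary with an end marker. -/
def encodeNum (m : ℕ) : List Sym := encodeBits (Computability.encodeNat m)

/-- The numbers of the variables a constraint acts on, in order. -/
def Constraint.vars {r n : ℕ} (c : Constraint r n) : List ℕ :=
  List.ofFn (fun i => (c.scope i : ℕ))

/-- The truth table of a constraint: entry `i` is the value at the arguments given by the binary
digits of `i`. -/
def Constraint.truthTable {r n : ℕ} (c : Constraint r n) : List Bool :=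
  (List.range (2 ^ c.arity)).map (fun i => c.func (fun j => i.testBit j))

/-- The variables of a constraint (in binary), its truth table, and its weight (in binary). -/
def Constraint.encode {r n : ℕ} (c : Constraint r n) : List Sym :=
  c.vars.flatMap (fun v => Sym.arg :: encodeNum v) ++
    Sym.table :: (encodeBits c.truthTable ++ encodeNum c.weight)

/-- One symbol for each variable, followed by the constraints. -/
def Instance.encode {r : ℕ} (I : Instance r) : List Sym :=
  List.replicate I.n Sym.var ++ I.constraints.flatMap Constraint.encode

theorem encodeBits_append_inj {l l' : List Bool} {s t : List Sym}
    (h : encodeBits l ++ s = encodeBits l' ++ t) : l = l' ∧ s = t := by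
  induction l generalizing l' with
  | nil => cases l' <;> simp_all [encodeBits]
  | cons a l ih =>
    cases l' with
    | nil => simp [encodeBits] at h
    | cons b l' =>
      simp only [encodeBits, List.map_cons, List.cons_append, List.cons.injEq, Sym.bit.injEq] at h
      obtain ⟨h1, h2⟩ := ih h.2
      exact ⟨by rw [h.1, h1], h2⟩

theorem encodeNum_append_inj {l l' : ℕ} {s t : List Sym}
    (h : encodeNum l ++ s = encodeNum l' ++ t) : l = l' ∧ s = t := by
  obtain ⟨h1, h2⟩ := encodeBits_append_inj h
  exact ⟨Computability.encodingNatBool.encode_injective h1, h2⟩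

theorem encodeVars_append_inj {l l' : List ℕ} {s t : List Sym}
    (h : l.flatMap (fun v => Sym.arg :: encodeNum v) ++ Sym.table :: s =
      l'.flatMap (fun v => Sym.arg :: encodeNum v) ++ Sym.table :: t) : l = l' ∧ s = t := by
  induction l generalizing l' with
  | nil => cases l' <;> simp_all
  | cons a l ih =>
    cases l' with
    | nil => simp at h
    | cons b l' =>
      simp only [List.flatMap_cons, List.cons_append, List.append_assoc, List.cons.injEq,
        true_and] at h
      obtain ⟨h1, h2⟩ := encodeNum_append_inj h
      obtain ⟨h3, h4⟩ := ih h2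
      exact ⟨by rw [h1, h3], h4⟩

theorem Constraint.ext_of_lists {r n : ℕ} {c d : Constraint r n} (hv : c.vars = d.vars)
    (ht : c.truthTable = d.truthTable) (hw : c.weight = d.weight) : c = d := by
  obtain ⟨a, ha, e, f, w, hwpos⟩ := c
  obtain ⟨a', ha', e', f', w', hwpos'⟩ := d
  have hl : a = a' := by simpa [Constraint.vars] using congrArg List.length hv
  subst hl
  simp only at hw
  subst hw
  have he : e = e' := by
    ext i
    have := congrFun (List.ofFn_injective hv) i
    simpa using this
  have hf : f = f' := by
    funext y
    simp only [Constraint.truthTable, List.map_inj_left, List.mem_range] at ht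
    have := ht (Nat.ofBits y) (Nat.ofBits_lt_two_pow y)
    simpa [Nat.testBit_ofBits_lt] using this
  subst he hf
  rfl

theorem Constraint.encode_append_inj {r n : ℕ} {c d : Constraint r n} {s t : List Sym}
    (h : c.encode ++ s = d.encode ++ t) : c = d ∧ s = t := by
  simp only [Constraint.encode, List.append_assoc, List.cons_append] at h
  obtain ⟨h1, h2⟩ := encodeVars_append_inj h
  obtain ⟨h3, h4⟩ := encodeBits_append_inj h2
  obtain ⟨h5, h6⟩ := encodeNum_append_inj h4
  exact ⟨Constraint.ext_of_lists h1 h3 h5, h6⟩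

theorem Constraint.encode_head {r n : ℕ} (c : Constraint r n) :
    ∃ a l, c.encode = a :: l := by
  unfold Constraint.encode
  cases c.vars <;> simp

theorem encodeConstraints_injective {r n : ℕ} :
    Function.Injective (fun l : List (Constraint r n) => l.flatMap Constraint.encode) := by
  intro l l' h
  induction l generalizing l' with
  | nil =>
    cases l' with
    | nil => rfl
    | cons b l' =>
      obtain ⟨a, s, hs⟩ := b.encode_head
      simp [hs] at h
  | cons c l ih =>
    cases l' with
    | nil =>
      obtain ⟨a, s, hs⟩ := c.encode_head
      simp [hs] at h
    | cons b l' =>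
      simp only [List.flatMap_cons] at h
      obtain ⟨h1, h2⟩ := Constraint.encode_append_inj h
      rw [h1, ih h2]

theorem count_var_encode {r : ℕ} (I : Instance r) : I.encode.count Sym.var = I.n := by
  have hb : ∀ l : List Bool, Sym.var ∉ encodeBits l := by simp [encodeBits]
  have hc : ∀ c : Constraint r I.n, Sym.var ∉ c.encode := by
    intro c
    simp [Constraint.encode, encodeNum, hb]
  have : Sym.var ∉ I.constraints.flatMap Constraint.encode := by
    simp only [List.mem_flatMap, not_exists, not_and]
    exact fun c _ => hc c
  simp [Instance.encode, List.count_eq_zero_of_not_mem this]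

theorem Instance.encode_injective {r : ℕ} :
    Function.Injective (Instance.encode : Instance r → List Sym) := by
  intro I J h
  have hn : I.n = J.n := by rw [← count_var_encode I, ← count_var_encode J, h]
  obtain ⟨n, l⟩ := I
  obtain ⟨n', l'⟩ := J
  simp only at hn
  subst hn
  simp only [Instance.encode, List.append_cancel_left_eq] at h
  rw [encodeConstraints_injective h]

end MaxCSP

/-- Max-`r`-CSP-AA: given an instance and `k`, is there a truth assignment such that the total
weight of the satisfied constraints is at least `A + k`, where `A` is the average? -/
def MaxCSPAA (r : ℕ) : ParamProblem where
  Inst := MaxCSP.Instance r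
  Sym := MaxCSP.Sym
  symFintype := inferInstance
  encode := MaxCSP.Instance.encode
  encode_injective := MaxCSP.Instance.encode_injective
  yes := {p | ∃ x : Fin p.1.n → Bool, p.1.average + (p.2 : ℚ) ≤ (p.1.satWeight x : ℚ)}

/-! Write truth values as signs ±1. A constraint on at most `r` variables is a multilinear
polynomial of degree at most `r` with coefficients in `2⁻ʳ ℤ` (times its weight). Hence `2 ^ r`
times the excess of the satisfied weight over the average `A` is a polynomial `X` with integer
coefficients, degree at most `r` and no constant term, and the answer is yes iff `X` takes a value
of at least `2 ^ r * k`.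

Such a polynomial satisfies `E X⁴ ≤ 9 ^ r (E X²)²` (`DegLE.mean_pow_four_le`) and `E X = 0`, so it
cannot have a large variance while staying below a small bound: if all values are less than `K`,
then `E X²`, the sum of the squared coefficients, is less than `4 * 9 ^ r * K ^ 2`
(`sum_sq_lt_of_forall_lt`). For `K = 2 ^ r * k` this is `M = 4 * 36 ^ r * k ^ 2`. Coefficients are
integers, so a no-instance has at most `M` nonzero coefficients, each at most `M` in absolute value.
If this fails, a trivial yes-instance is returned. Otherwise each monomial `c χ_S` is turned back
into a parity constraint on `S` of weight `2 |c|`, whose excess over its mean is `c χ_S`. With the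
parameter `2 ^ r * k` the new instance is equivalent to the old one, and it has at most `M`
constraints on at most `r M` variables (`exists_kernel`).

As `k` is written in binary, `M` may be exponential in the length of the input. But if `k` exceeds
that length, the input is already smaller than `k` and is returned unchanged.

For the running time, structured stack programs are compiled to the Turing machines of the
statement. Data are binary trees in prefix notation, and the class `PT` of polynomial-time functions
on them is closed under composition, pairing, case distinction and folds of controlled growth. The
algorithm is written with these operations; what depends only on `r` is a finite table. `kernelWord`
is its action on words. -/

/-! ### A structured programming language for stack machines -/

/-- Structured programs over a family of stacks. -/
inductive StackProg {K : Type} (Γ : K → Type) : Type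
  | skip : StackProg Γ
  | push (k : K) (a : Γ k) : StackProg Γ
  | seq (p q : StackProg Γ) : StackProg Γ
  /-- Pop a symbol from stack `k` and continue with the program it selects. -/
  | case (k : K) (f : Option (Γ k) → StackProg Γ) : StackProg Γ
  /-- Pop a symbol from stack `k`; if it satisfies `go`, run the program it selects and repeat. -/
  | loop (k : K) (go : Option (Γ k) → Bool) (f : Option (Γ k) → StackProg Γ) : StackProg Γ

namespace StackProg

variable {K : Type} [DecidableEq K] {Γ : K → Type}

/-- `Run p s t s'`: started with the stacks `s`, the program `p` halts after `t` steps with the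
stacks `s'`. -/
inductive Run : StackProg Γ → (∀ k, List (Γ k)) → ℕ → (∀ k, List (Γ k)) → Prop
  | skip (s) : Run skip s 1 s
  | push (k a s) : Run (push k a) s 1 (Function.update s k (a :: s k))
  | seq {p q s t s' t' s''} : Run p s t s' → Run q s' t' s'' → Run (seq p q) s (t + t') s''
  | case {k f s t s'} : Run (f (s k).head?) (Function.update s k (s k).tail) t s' →
      Run (case k f) s (1 + t) s'
  | loop_exit {k go f s} : go (s k).head? = false →
      Run (loop k go f) s 1 (Function.update s k (s k).tail)
  | loop_step {k go f s t s' t' s''} : go (s k).head? = true →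
      Run (f (s k).head?) (Function.update s k (s k).tail) t s' →
      Run (loop k go f) s' t' s'' → Run (loop k go f) s (1 + t + t') s''

/-! ### Compilation of structured programs to machines -/

/-- The labels of the compiled program. -/
def Lab : StackProg Γ → Type
  | skip => Unit
  | push _ _ => Unit
  | seq p q => Lab p ⊕ Lab q
  | case _ f => Option (Σ o, Lab (f o))
  | loop _ _ f => Option (Σ o, Lab (f o))

/-- There are finitely many labels. -/
@[reducible] def labFintype [∀ k, Fintype (Γ k)] : (p : StackProg Γ) → Fintype (Lab p)
  | skip => inferInstanceAs (Fintype Unit)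
  | push _ _ => inferInstanceAs (Fintype Unit)
  | seq p q =>
    letI := labFintype p
    letI := labFintype q
    inferInstanceAs (Fintype (Lab p ⊕ Lab q))
  | case _ f =>
    letI := fun o => labFintype (f o)
    inferInstanceAs (Fintype (Option (Σ o, Lab (f o))))
  | loop _ _ f =>
    letI := fun o => labFintype (f o)
    inferInstanceAs (Fintype (Option (Σ o, Lab (f o))))

/-- The label at which the compiled program starts. -/
def entry : (p : StackProg Γ) → Lab p
  | skip => ()
  | push _ _ => ()
  | seq p _ => Sum.inl (entry p)
  | case _ _ => none
  | loop _ _ _ => none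

/-- The statements of the compiled program, in a machine in which its labels are embedded by `emb`
and which continues at `ex`. The internal state holds the symbols popped last. -/
def code {L : Type} : (p : StackProg Γ) → (Lab p → L) → L → Lab p →
    Turing.TM2.Stmt Γ L (∀ k, Option (Γ k))
  | skip, _, ex, _ => .goto fun _ => ex
  | push k a, _, ex, _ => .push k (fun _ => a) (.goto fun _ => ex)
  | seq p q, emb, ex, l =>
    match l with
    | Sum.inl l => code p (fun l => emb (Sum.inl l)) (emb (Sum.inr (entry q))) l
    | Sum.inr l => code q (fun l => emb (Sum.inr l)) ex l
  | case k f, emb, ex, l =>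
    match l with
    | none => .pop k (fun v o => Function.update v k o)
        (.goto fun v => emb (some ⟨v k, entry (f (v k))⟩))
    | some ⟨o, l⟩ => code (f o) (fun l => emb (some ⟨o, l⟩)) ex l
  | loop k go f, emb, ex, l =>
    match l with
    | none => .pop k (fun v o => Function.update v k o)
        (.goto fun v => if go (v k) then emb (some ⟨v k, entry (f (v k))⟩) else ex)
    | some ⟨o, l⟩ => code (f o) (fun l => emb (some ⟨o, l⟩)) (emb none) l

/-- Correctness of the compilation, by induction on the run. The exit label and the embedding of the
labels are arbitrary because, inside a composite program, the exit of one piece is the entry of the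
next. Each block of `code` ends in a single `goto`, so one unit of time in `Run` is exactly one
machine step. -/
theorem Run.iterate_step {p : StackProg Γ} {s s' : ∀ k, List (Γ k)} {t : ℕ} (h : Run p s t s')
    {L : Type} (M : L → Turing.TM2.Stmt Γ L (∀ k, Option (Γ k))) (emb : Lab p → L) (ex : L)
    (hM : ∀ l, M (emb l) = code p emb ex l) (v : ∀ k, Option (Γ k)) :
    ∃ v', (flip bind (Turing.TM2.step M))^[t] (some ⟨some (emb (entry p)), v, s⟩) =
      some ⟨some ex, v', s'⟩ := by
  induction h generalizing ex v with
  | skip s => exact ⟨v, by simp [flip, Turing.TM2.step, hM, code, Turing.TM2.stepAux]⟩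
  | push k a s => exact ⟨v, by simp [flip, Turing.TM2.step, hM, code, Turing.TM2.stepAux]⟩
  | @seq p q s t s' t' s'' _ _ ihp ihq =>
    obtain ⟨v1, h1⟩ := ihp (fun l => emb (Sum.inl l)) (emb (Sum.inr (entry q)))
      (fun l => hM (Sum.inl l)) v
    obtain ⟨v2, h2⟩ := ihq (fun l => emb (Sum.inr l)) ex (fun l => hM (Sum.inr l)) v1
    refine ⟨v2, ?_⟩
    rw [add_comm, Function.iterate_add_apply]
    exact (congrArg _ h1).trans h2
  | @case k f s t s' _ ih =>
    have h0 : M (emb (entry (StackProg.case k f))) = code (StackProg.case k f) emb ex none := hM none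
    obtain ⟨v1, h1⟩ := ih (fun l => emb (some ⟨(s k).head?, l⟩)) ex
      (fun l => hM (some ⟨(s k).head?, l⟩)) (Function.update v k (s k).head?)
    refine ⟨v1, ?_⟩
    rw [add_comm, Function.iterate_succ_apply, ← h1]
    congr 1
    simp only [flip, Option.bind_eq_bind, Option.bind_some, Turing.TM2.step, h0, code,
      Turing.TM2.stepAux]
    rw [Function.update_self]
  | @loop_exit k go f s hgo =>
    have h0 : M (emb (entry (loop k go f))) = code (loop k go f) emb ex none := hM none
    refine ⟨Function.update v k (s k).head?, ?_⟩
    simp [flip, Turing.TM2.step, h0, code, Turing.TM2.stepAux, hgo]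
  | @loop_step k go f s t s' t' s'' hgo _ _ ih ih' =>
    have h0 : M (emb (entry (loop k go f))) = code (loop k go f) emb ex none := hM none
    obtain ⟨v1, h1⟩ := ih (fun l => emb (some ⟨(s k).head?, l⟩)) (emb none)
      (fun l => hM (some ⟨(s k).head?, l⟩)) (Function.update v k (s k).head?)
    obtain ⟨v2, h2⟩ := ih' emb ex hM v1
    refine ⟨v2, ?_⟩
    rw [show 1 + t + t' = t' + (t + 1) by ring, Function.iterate_add_apply,
      Function.iterate_succ_apply, ← h2]
    congr 1
    refine Eq.trans ?_ h1
    congr 1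
    simp only [flip, Option.bind_eq_bind, Option.bind_some, Turing.TM2.step, h0, code,
      Turing.TM2.stepAux]
    rw [Function.update_self, if_pos hgo]

/-- The machine that runs a program and then halts. -/
def machine [Fintype K] [∀ k, Fintype (Γ k)] (p : StackProg Γ) (k₀ k₁ : K) : Turing.FinTM2 :=
  letI := labFintype p
  { K := K
    k₀ := k₀
    k₁ := k₁
    Γ := Γ
    Λ := Option (Lab p)
    main := some (entry p)
    σ := ∀ k, Option (Γ k)
    initialState := fun _ => none
    m := fun l =>
      match l with
      -- A halting configuration must carry the initial internal state, hence this reset; it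
      -- accounts for the extra step in `computableInPolyTime`.
      | none => .load (fun _ _ => none) .halt
      | some l => code p some none l }

/-- The stacks on which everything but stack `k` is empty. -/
def single (k : K) (w : List (Γ k)) : ∀ j, List (Γ j) :=
  Function.update (fun _ => []) k w

theorem initList_machine [Fintype K] [∀ k, Fintype (Γ k)] (p : StackProg Γ) (k₀ k₁ : K)
    (w : List (Γ k₀)) : Turing.initList (machine p k₀ k₁) w =
      ⟨some (some (entry p)), fun _ => none, single k₀ w⟩ := by
  unfold Turing.initList
  congr 1
  refine funext fun (k : K) => ?_
  by_cases h : k = k₀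
  · subst h
    refine (dif_pos rfl).trans ?_
    exact (Function.update_self k w (fun _ => [])).symm
  · refine (dif_neg h).trans ?_
    exact (Function.update_of_ne h w (fun _ => [])).symm

theorem haltList_machine [Fintype K] [∀ k, Fintype (Γ k)] (p : StackProg Γ) (k₀ k₁ : K)
    (w : List (Γ k₁)) : Turing.haltList (machine p k₀ k₁) w =
      ⟨none, fun _ => none, single k₁ w⟩ := by
  unfold Turing.haltList
  congr 1
  refine funext fun (k : K) => ?_
  by_cases h : k = k₁
  · subst h
    refine (dif_pos rfl).trans ?_
    exact (Function.update_self k w (fun _ => [])).symm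
  · refine (dif_neg h).trans ?_
    exact (Function.update_of_ne h w (fun _ => [])).symm

/-- A program that computes a function of words in polynomial time yields a Turing machine. -/
theorem computableInPolyTime [Fintype K] [∀ k, Fintype (Γ k)] {α β : Type} {k₀ k₁ : K}
    (ea : α → List (Γ k₀)) (eb : β → List (Γ k₁)) (f : α → β) (p : StackProg Γ)
    (q : Polynomial ℕ)
    (h : ∀ a, ∃ t ≤ q.eval (ea a).length, Run p (single k₀ (ea a)) t (single k₁ (eb (f a)))) :
    Nonempty (Turing.TM2ComputableInPolyTime ea eb f) := by
  refine ⟨{ tm := machine p k₀ k₁, inputAlphabet := Equiv.refl _, outputAlphabet := Equiv.refl _,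
            time := q + 1, outputsFun := fun a => ?_ }⟩
  refine Classical.choice ?_
  obtain ⟨t, ht, hrun⟩ := h a
  obtain ⟨v, hv⟩ := hrun.iterate_step (machine p k₀ k₁).m some none (fun _ => rfl) (fun _ => none)
  refine ⟨⟨⟨t + 1, ?_⟩, by simpa using ht⟩⟩
  have e1 : (Equiv.refl (Γ k₀)).invFun = id := rfl
  have e2 : (Equiv.refl (Γ k₁)).invFun = id := rfl
  rw [Function.iterate_succ_apply']
  change flip bind (Turing.TM2.step (machine p k₀ k₁).m) ((flip bind (Turing.TM2.step
    (machine p k₀ k₁).m))^[t] (some (Turing.initList (machine p k₀ k₁)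
      (List.map (Equiv.refl (Γ k₀)).invFun (ea a))))) = some (Turing.haltList (machine p k₀ k₁)
      (List.map (Equiv.refl (Γ k₁)).invFun (eb (f a))))
  rw [e1, e2]
  erw [List.map_id, List.map_id, initList_machine, haltList_machine, hv]
  rfl

end StackProg


/-! ### Binary trees as a data type for stack programs -/

namespace TreeMachine

open StackProg

/-- The symbols of the input and output words. -/
abbrev Ch := MaxCSP.Sym ⊕ Bool

/-- Binary trees with labelled leaves. -/
inductive BTree
  | leaf (a : Option Ch)
  | node (l r : BTree)

/-- The symbols on the working stacks. -/
inductive Tok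
  | node
  | leaf (a : Option Ch)
  | mark
  deriving DecidableEq, Fintype

/-- The stacks: input, output, main stack, two auxiliary stacks, and a counter. -/
inductive Reg
  | inp
  | out
  | M
  | B
  | E
  | C
  deriving DecidableEq

instance : Fintype Reg := ⟨{.inp, .out, .M, .B, .E, .C}, by intro k; cases k <;> simp⟩

/-- The alphabets of the stacks. -/
@[reducible] def Alph : Reg → Type
  | .inp => Ch
  | .out => Ch
  | .M => Tok
  | .B => Tok
  | .E => Tok
  | .C => Tok

instance : ∀ k, Fintype (Alph k)
  | .inp => inferInstanceAs (Fintype Ch)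
  | .out => inferInstanceAs (Fintype Ch)
  | .M => inferInstanceAs (Fintype Tok)
  | .B => inferInstanceAs (Fintype Tok)
  | .E => inferInstanceAs (Fintype Tok)
  | .C => inferInstanceAs (Fintype Tok)

abbrev Prog := StackProg Alph

/-- The stacks with the given contents. -/
def st (i o : List Ch) (m b e c : List Tok) : ∀ k, List (Alph k)
  | .inp => i
  | .out => o
  | .M => m
  | .B => b
  | .E => e
  | .C => c

section Update
variable (i o i' o' : List Ch) (m b e c l : List Tok)

theorem update_inp : Function.update (st i o m b e c) .inp i' = st i' o m b e c := by
  funext k; cases k <;> rfl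
theorem update_out : Function.update (st i o m b e c) .out o' = st i o' m b e c := by
  funext k; cases k <;> rfl
theorem update_M : Function.update (st i o m b e c) .M l = st i o l b e c := by
  funext k; cases k <;> rfl
theorem update_B : Function.update (st i o m b e c) .B l = st i o m l e c := by
  funext k; cases k <;> rfl
theorem update_E : Function.update (st i o m b e c) .E l = st i o m b l c := by
  funext k; cases k <;> rfl
theorem update_C : Function.update (st i o m b e c) .C l = st i o m b e l := by
  funext k; cases k <;> rfl
end Update

/-- The program `p` takes the stacks `s` to `s'` in at most `t` steps. -/
def RunLE (p : Prog) (s : ∀ k, List (Alph k)) (t : ℕ) (s' : ∀ k, List (Alph k)) : Prop :=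
  ∃ t' ≤ t, Run p s t' s'

namespace RunLE

theorem mono {p s t t' s'} (h : RunLE p s t s') (ht : t ≤ t') : RunLE p s t' s' :=
  let ⟨u, hu, hr⟩ := h
  ⟨u, hu.trans ht, hr⟩

theorem skip {s} : RunLE .skip s 1 s := ⟨1, le_rfl, .skip s⟩

theorem push {k : Reg} {a : Alph k} {s s'} (hs : Function.update s k (a :: s k) = s') :
    RunLE (.push k a) s 1 s' := ⟨1, le_rfl, hs ▸ .push k a s⟩

theorem seq {p q s t s' t' s''} (h : RunLE p s t s') (h' : RunLE q s' t' s'') :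
    RunLE (.seq p q) s (t + t') s'' :=
  let ⟨u, hu, hr⟩ := h
  let ⟨u', hu', hr'⟩ := h'
  ⟨u + u', add_le_add hu hu', .seq hr hr'⟩

theorem case {k f s o s₁ t s'} (ho : (s k).head? = o) (hs : Function.update s k (s k).tail = s₁)
    (h : RunLE (f o) s₁ t s') : RunLE (.case k f) s (1 + t) s' := by
  subst ho hs
  obtain ⟨u, hu, hr⟩ := h
  exact ⟨1 + u, by omega, .case hr⟩

theorem loop_exit {k go f s o s'} (ho : (s k).head? = o) (hgo : go o = false)
    (hs : Function.update s k (s k).tail = s') : RunLE (.loop k go f) s 1 s' := by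
  subst ho hs
  exact ⟨1, le_rfl, .loop_exit hgo⟩

theorem loop_step {k go f s o s₁ t s' t' s''} (ho : (s k).head? = o) (hgo : go o = true)
    (hs : Function.update s k (s k).tail = s₁)
    (h : RunLE (f o) s₁ t s') (h' : RunLE (.loop k go f) s' t' s'') :
    RunLE (.loop k go f) s (1 + t + t') s'' := by
  subst ho hs
  obtain ⟨u, hu, hr⟩ := h
  obtain ⟨u', hu', hr'⟩ := h'
  exact ⟨1 + u + u', by omega, .loop_step hgo hr hr'⟩

section Stacks
variable {i o : List Ch} {m b e c : List Tok} {a : Tok}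

theorem push_M : RunLE (.push .M a) (st i o m b e c) 1 (st i o (a :: m) b e c) :=
  .push (update_M ..)
theorem push_B : RunLE (.push .B a) (st i o m b e c) 1 (st i o m (a :: b) e c) :=
  .push (update_B ..)
theorem push_E : RunLE (.push .E a) (st i o m b e c) 1 (st i o m b (a :: e) c) :=
  .push (update_E ..)
theorem push_C : RunLE (.push .C a) (st i o m b e c) 1 (st i o m b e (a :: c)) :=
  .push (update_C ..)

theorem case_M {f : Option Tok → Prog} {t s'} (h : RunLE (f (some a)) (st i o m b e c) t s') :
    RunLE (.case .M f) (st i o (a :: m) b e c) (1 + t) s' :=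
  .case (k := .M) (o := some a) rfl (update_M ..) h

theorem loop_exit_M {go : Option Tok → Bool} {f : Option Tok → Prog} (h : go (some a) = false) :
    RunLE (.loop .M go f) (st i o (a :: m) b e c) 1 (st i o m b e c) :=
  .loop_exit (k := .M) (o := some a) rfl h (update_M ..)
theorem loop_exit_B {go : Option Tok → Bool} {f : Option Tok → Prog} (h : go (some a) = false) :
    RunLE (.loop .B go f) (st i o m (a :: b) e c) 1 (st i o m b e c) :=
  .loop_exit (k := .B) (o := some a) rfl h (update_B ..)
theorem loop_exit_E {go : Option Tok → Bool} {f : Option Tok → Prog} (h : go (some a) = false) :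
    RunLE (.loop .E go f) (st i o m b (a :: e) c) 1 (st i o m b e c) :=
  .loop_exit (k := .E) (o := some a) rfl h (update_E ..)
theorem loop_exit_C {go : Option Tok → Bool} {f : Option Tok → Prog} (h : go (some a) = false) :
    RunLE (.loop .C go f) (st i o m b e (a :: c)) 1 (st i o m b e c) :=
  .loop_exit (k := .C) (o := some a) rfl h (update_C ..)

theorem loop_step_M {go : Option Tok → Bool} {f : Option Tok → Prog} {t s' t' s''}
    (hgo : go (some a) = true) (h : RunLE (f (some a)) (st i o m b e c) t s')
    (h' : RunLE (.loop .M go f) s' t' s'') :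
    RunLE (.loop .M go f) (st i o (a :: m) b e c) (1 + t + t') s'' :=
  .loop_step (k := .M) (o := some a) rfl hgo (update_M ..) h h'
theorem loop_step_B {go : Option Tok → Bool} {f : Option Tok → Prog} {t s' t' s''}
    (hgo : go (some a) = true) (h : RunLE (f (some a)) (st i o m b e c) t s')
    (h' : RunLE (.loop .B go f) s' t' s'') :
    RunLE (.loop .B go f) (st i o m (a :: b) e c) (1 + t + t') s'' :=
  .loop_step (k := .B) (o := some a) rfl hgo (update_B ..) h h'
theorem loop_step_E {go : Option Tok → Bool} {f : Option Tok → Prog} {t s' t' s''}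
    (hgo : go (some a) = true) (h : RunLE (f (some a)) (st i o m b e c) t s')
    (h' : RunLE (.loop .E go f) s' t' s'') :
    RunLE (.loop .E go f) (st i o m b (a :: e) c) (1 + t + t') s'' :=
  .loop_step (k := .E) (o := some a) rfl hgo (update_E ..) h h'
theorem loop_step_C {go : Option Tok → Bool} {f : Option Tok → Prog} {t s' t' s''}
    (hgo : go (some a) = true) (h : RunLE (f (some a)) (st i o m b e c) t s')
    (h' : RunLE (.loop .C go f) s' t' s'') :
    RunLE (.loop .C go f) (st i o m b e (a :: c)) (1 + t + t') s'' :=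
  .loop_step (k := .C) (o := some a) rfl hgo (update_C ..) h h'
end Stacks

end RunLE

/-! ### Binary trees and their prefix notation -/

namespace BTree

/-- The number of nodes and leaves. -/
def size : BTree → ℕ
  | leaf _ => 1
  | node l r => size l + size r + 1

/-- Prefix notation. -/
def ser : BTree → List Tok
  | leaf a => [Tok.leaf a]
  | node l r => Tok.node :: (ser l ++ ser r)

theorem length_ser (x : BTree) : x.ser.length = x.size := by
  induction x with
  | leaf a => rfl
  | node l r hl hr => simp [ser, size, hl, hr]

theorem mark_notMem_ser (x : BTree) : Tok.mark ∉ x.ser := by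
  induction x with
  | leaf a => simp [ser]
  | node l r hl hr => simp [ser, hl, hr]

theorem size_pos (x : BTree) : 0 < x.size := by
  cases x <;> simp [size]

/-- The left subtree; a leaf is its own left subtree. -/
def left : BTree → BTree
  | leaf a => leaf a
  | node l _ => l

/-- The right subtree; a leaf is its own right subtree. -/
def right : BTree → BTree
  | leaf a => leaf a
  | node _ r => r

/-- Does the tree consist of a leaf with a label in `p`? -/
def leafTest (p : Option Ch → Bool) : BTree → Bool
  | leaf a => p a
  | node _ _ => false

end BTree

open BTree

/-! ### Programs that move trees -/

/-- The body of the loop of `traverse`. -/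
def traverseBody (act : Tok → Prog) : Option Tok → Prog
  | some .node => .seq (act .node) (.seq (.push .C .node) (.push .C .node))
  | some (.leaf a) => act (.leaf a)
  | _ => .skip

/-- The loop of `traverse`: the symbols `node` on the counter are the trees still to be read. -/
def traverseLoop (act : Tok → Prog) : Prog :=
  .loop .C (fun o => decide (o = some Tok.node)) (fun _ => .case .M (traverseBody act))

/-- Read a tree from the main stack, applying `act` to each of its symbols. -/
def traverse (act : Tok → Prog) : Prog :=
  .seq (.push .C .mark) (.seq (.push .C .node) (traverseLoop act))

/-- Prefix notation is self-delimiting: on the counter, a leaf uses up one pending tree and an inner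
node replaces one by two. The rest of the run is an arbitrary continuation, so that the two subtrees
can be chained. The factor 6 counts two pops, two steps for `act` and two pushes. -/
theorem traverseLoop_run {act : Tok → Prog} {fb fe : Tok → List Tok → List Tok}
    (hact : ∀ a i o m b e c, RunLE (act a) (st i o m b e c) 2 (st i o m (fb a b) (fe a e) c))
    (x : BTree) : ∀ {i o m b e c t s'},
    RunLE (traverseLoop act) (st i o m (x.ser.foldl (fun b a => fb a b) b)
      (x.ser.foldl (fun e a => fe a e) e) c) t s' →
    RunLE (traverseLoop act) (st i o (x.ser ++ m) b e (.node :: c)) (6 * x.size + t) s' := by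
  induction x with
  | leaf a =>
    intro i o m b e c t s' h
    exact (RunLE.loop_step_C (by simp) (RunLE.case_M (hact ..)) h).mono (by simp [size])
  | node l r hl hr =>
    intro i o m b e c t s' h
    simp only [ser, List.foldl_cons, List.foldl_append] at h
    have h1 := hl (c := .node :: c) (hr h)
    rw [ser, List.cons_append, List.append_assoc]
    exact (RunLE.loop_step_C (by simp) (RunLE.case_M (.seq (hact ..)
      (.seq .push_C .push_C))) h1).mono (by simp only [size]; omega)

/-- The mark below the pending tree ends the loop before the older contents of the counter are
touched. -/
theorem traverse_run {act : Tok → Prog} {fb fe : Tok → List Tok → List Tok}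
    (hact : ∀ a i o m b e c, RunLE (act a) (st i o m b e c) 2 (st i o m (fb a b) (fe a e) c))
    (x : BTree) (i o m b e c) :
    RunLE (traverse act) (st i o (x.ser ++ m) b e c) (6 * x.size + 3)
      (st i o m (x.ser.foldl (fun b a => fb a b) b) (x.ser.foldl (fun e a => fe a e) e) c) := by
  have h : RunLE (traverseLoop act) (st i o m (x.ser.foldl (fun b a => fb a b) b)
      (x.ser.foldl (fun e a => fe a e) e) (.mark :: c)) 1 _ := .loop_exit_C (by simp)
  exact (RunLE.seq .push_C (.seq .push_C (traverseLoop_run hact x h))).mono (by omega)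

/-- Remove a tree from the main stack. -/
def drop : Prog := traverse fun _ => .skip

theorem drop_run (x : BTree) (i o m b e c) :
    RunLE drop (st i o (x.ser ++ m) b e c) (6 * x.size + 3) (st i o m b e c) := by
  have := traverse_run (act := fun _ => .skip) (fb := fun _ b => b) (fe := fun _ e => e)
    (fun a i o m b e c => RunLE.skip.mono (by omega)) x i o m b e c
  simpa [drop] using this

theorem foldl_cons_eq (l b : List Tok) : l.foldl (fun b a => a :: b) b = l.reverse ++ b := by
  induction l generalizing b with
  | nil => rfl
  | cons a l ih => simp [ih]

/-- Move a tree from the main stack to stack `B`, above a mark. -/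
def stash : Prog := .seq (.push .B .mark) (traverse fun a => .push .B a)

theorem stash_run (x : BTree) (i o m b e c) :
    RunLE stash (st i o (x.ser ++ m) b e c) (6 * x.size + 4)
      (st i o m (x.ser.reverse ++ .mark :: b) e c) := by
  have := traverse_run (act := fun a => .push .B a) (fb := fun a b => a :: b) (fe := fun _ e => e)
    (fun a i o m b e c => RunLE.push_B.mono (by omega)) x i o m (.mark :: b) e c
  simp only [foldl_cons_eq, List.foldl_fixed] at this
  exact (RunLE.seq RunLE.push_B this).mono (by omega)

/-- Push a symbol, if there is one. -/
def pushM : Option Tok → Prog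
  | some a => .push .M a
  | none => .skip

/-- Is there a symbol other than the mark? -/
def goTok : Option Tok → Bool
  | some .mark => false
  | none => false
  | _ => true

/-- Move the symbols above the mark on stack `B` to the main stack. -/
def unstash : Prog := .loop .B goTok pushM

/-- Move the symbols above the mark on stack `E` to the main stack. -/
def unstashE : Prog := .loop .E goTok pushM

theorem goTok_eq_true {a : Tok} (h : a ≠ .mark) : goTok (some a) = true := by
  cases a <;> simp_all [goTok]

theorem unstash_run_list (l : List Tok) (hl : Tok.mark ∉ l) (i o m b e c) :
    RunLE unstash (st i o m (l ++ .mark :: b) e c) (2 * l.length + 1)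
      (st i o (l.reverse ++ m) b e c) := by
  induction l generalizing m with
  | nil => exact .loop_exit_B rfl
  | cons a l ih =>
    simp only [List.mem_cons, not_or] at hl
    have h1 := ih hl.2 (a :: m)
    rw [List.reverse_cons, List.append_assoc]
    exact (RunLE.loop_step_B (goTok_eq_true (Ne.symm hl.1)) .push_M h1).mono
      (by simp only [List.length_cons]; omega)

theorem unstashE_run_list (l : List Tok) (hl : Tok.mark ∉ l) (i o m b e c) :
    RunLE unstashE (st i o m b (l ++ .mark :: e) c) (2 * l.length + 1)
      (st i o (l.reverse ++ m) b e c) := by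
  induction l generalizing m with
  | nil => exact .loop_exit_E rfl
  | cons a l ih =>
    simp only [List.mem_cons, not_or] at hl
    have h1 := ih hl.2 (a :: m)
    rw [List.reverse_cons, List.append_assoc]
    exact (RunLE.loop_step_E (goTok_eq_true (Ne.symm hl.1)) .push_M h1).mono
      (by simp only [List.length_cons]; omega)

/-- A serialized tree contains no mark, so the loop stops at the mark laid down by `stash`, and the
second reversal restores the prefix order. -/
theorem unstash_run (x : BTree) (i o m b e c) :
    RunLE unstash (st i o m (x.ser.reverse ++ .mark :: b) e c) (2 * x.size + 1)
      (st i o (x.ser ++ m) b e c) := by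
  simpa [length_ser] using unstash_run_list x.ser.reverse (by simpa using x.mark_notMem_ser)
    i o m b e c

theorem unstashE_run (x : BTree) (i o m b e c) :
    RunLE unstashE (st i o m b (x.ser.reverse ++ .mark :: e) c) (2 * x.size + 1)
      (st i o (x.ser ++ m) b e c) := by
  simpa [length_ser] using unstashE_run_list x.ser.reverse (by simpa using x.mark_notMem_ser)
    i o m b e c

/-- Duplicate the tree on top of the main stack. -/
def dup : Prog :=
  .seq (.push .B .mark) (.seq (.push .E .mark)
    (.seq (traverse fun a => .seq (.push .B a) (.push .E a)) (.seq unstash unstashE)))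

theorem dup_run (x : BTree) (i o m b e c) :
    RunLE dup (st i o (x.ser ++ m) b e c) (10 * x.size + 7)
      (st i o (x.ser ++ (x.ser ++ m)) b e c) := by
  have := traverse_run (act := fun a => .seq (.push .B a) (.push .E a)) (fb := fun a b => a :: b)
    (fe := fun a e => a :: e)
    (fun a i o m b e c => (RunLE.seq RunLE.push_B .push_E)) x i o m
    (.mark :: b) (.mark :: e) c
  simp only [foldl_cons_eq] at this
  exact (RunLE.seq RunLE.push_B (.seq .push_E (.seq this
    (.seq (unstash_run ..) (unstashE_run ..))))).mono (by omega)

/-- Push a word onto the main stack. -/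
def pushList : List Tok → Prog
  | [] => .skip
  | a :: l => .seq (pushList l) (.push .M a)

theorem pushList_run (l : List Tok) (i o m b e c) :
    RunLE (pushList l) (st i o m b e c) (l.length + 1) (st i o (l ++ m) b e c) := by
  induction l with
  | nil => exact .skip
  | cons a l ih => exact (RunLE.seq ih .push_M).mono (by simp)

end TreeMachine


/-! ### Functions computable in polynomial time -/

namespace TreeMachine

open StackProg BTree

/-- Types whose elements are represented by binary trees. -/
class Enc (α : Type) where
  enc : α → BTree
  inj : Function.Injective enc

open Enc (enc)

/-- The size of the representation. -/
def sz {α : Type} [Enc α] (a : α) : ℕ := (enc a).size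

instance : Enc BTree := ⟨id, Function.injective_id⟩

instance {α β : Type} [Enc α] [Enc β] : Enc (α × β) where
  enc p := .node (enc p.1) (enc p.2)
  inj p q h := by
    injection h with h1 h2
    exact Prod.ext (Enc.inj h1) (Enc.inj h2)

/-- The representation of a list. -/
def encList {α : Type} [Enc α] : List α → BTree
  | [] => .leaf none
  | a :: l => .node (enc a) (encList l)

instance {α : Type} [Enc α] : Enc (List α) where
  enc := encList
  inj l l' h := by
    induction l generalizing l' with
    | nil => cases l' with
      | nil => rfl
      | cons b l' => cases h
    | cons a l ih => cases l' with
      | nil => cases h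
      | cons b l' =>
        injection h with h1 h2
        rw [Enc.inj h1, ih _ h2]

instance : Enc Ch := ⟨fun a => .leaf (some a), fun a b h => by cases h; rfl⟩

instance : Enc Bool := ⟨fun a => .leaf (some (Sum.inr a)), fun a b h => by cases h; rfl⟩

instance : Enc Unit := ⟨fun _ => .leaf none, fun _ _ _ => rfl⟩

theorem eval_mono (q : Polynomial ℕ) {m n : ℕ} (h : m ≤ n) : q.eval m ≤ q.eval n := by
  induction q using Polynomial.induction_on' with
  | add p q hp hq => simpa using add_le_add hp hq
  | monomial k a => simpa using Nat.mul_le_mul_left a (Nat.pow_le_pow_left h k)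

variable {α β γ δ : Type} [Enc α] [Enc β] [Enc γ] [Enc δ]

/-- `f` is computed in polynomial time by a program that works on the top of the main stack and
leaves the rest of the stacks as it is. -/
def PT (f : α → β) : Prop :=
  ∃ (p : Prog) (q : Polynomial ℕ), ∀ a, sz (f a) ≤ q.eval (sz a) ∧
    ∀ i o m b e c, RunLE p (st i o ((enc a).ser ++ m) b e c) (q.eval (sz a))
      (st i o ((enc (f a)).ser ++ m) b e c)

/-- `f` is bounded by a polynomial in the size of its argument. -/
def PolyBdd (f : α → ℕ) : Prop := ∃ q : Polynomial ℕ, ∀ a, f a ≤ q.eval (sz a)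

namespace PolyBdd

theorem mono {f g : α → ℕ} (hg : PolyBdd g) (h : ∀ a, f a ≤ g a) : PolyBdd f :=
  let ⟨q, hq⟩ := hg
  ⟨q, fun a => (h a).trans (hq a)⟩

theorem const (n : ℕ) : PolyBdd (fun _ : α => n) := ⟨Polynomial.C n, fun a => by simp⟩

theorem sz : PolyBdd (fun a : α => sz a) := ⟨Polynomial.X, fun a => by simp⟩

theorem add {f g : α → ℕ} (hf : PolyBdd f) (hg : PolyBdd g) : PolyBdd fun a => f a + g a := by
  obtain ⟨p, hp⟩ := hf
  obtain ⟨q, hq⟩ := hg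
  exact ⟨p + q, fun a => by simpa using add_le_add (hp a) (hq a)⟩

theorem mul {f g : α → ℕ} (hf : PolyBdd f) (hg : PolyBdd g) : PolyBdd fun a => f a * g a := by
  obtain ⟨p, hp⟩ := hf
  obtain ⟨q, hq⟩ := hg
  exact ⟨p * q, fun a => by simpa using Nat.mul_le_mul (hp a) (hq a)⟩

theorem eval {f : α → ℕ} (hf : PolyBdd f) (q : Polynomial ℕ) : PolyBdd fun a => q.eval (f a) := by
  obtain ⟨p, hp⟩ := hf
  exact ⟨q.comp p, fun a => by simpa [Polynomial.eval_comp] using eval_mono q (hp a)⟩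

end PolyBdd

namespace PT

theorem polyBdd {f : α → β} (hf : PT f) : PolyBdd fun a => sz (f a) :=
  let ⟨_, q, h⟩ := hf
  ⟨q, fun a => (h a).1⟩

/-- To show that a function is computable, it suffices to bound the running time of a program and
the size of the values separately. -/
theorem intro {f : α → β} (p : Prog) {t : α → ℕ} (hs : PolyBdd fun a => TreeMachine.sz (f a))
    (ht : PolyBdd t)
    (h : ∀ a i o m b e c, RunLE p (st i o ((enc a).ser ++ m) b e c) (t a)
      (st i o ((enc (f a)).ser ++ m) b e c)) : PT f := by
  obtain ⟨q, hq⟩ := hs.add ht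
  refine ⟨p, q, fun a => ⟨le_trans le_self_add (hq a), fun i o m b e c =>
    (h a i o m b e c).mono (le_trans le_add_self (hq a))⟩⟩

theorem elim {f : α → β} (hf : PT f) : ∃ (p : Prog) (q : Polynomial ℕ), ∀ a i o m b e c,
    RunLE p (st i o ((enc a).ser ++ m) b e c) (q.eval (sz a))
      (st i o ((enc (f a)).ser ++ m) b e c) :=
  let ⟨p, q, h⟩ := hf
  ⟨p, q, fun a => (h a).2⟩

/-- Changing the type without changing the encoding costs nothing. -/
theorem of_enc_eq {f : α → β} (h : ∀ a, enc (f a) = enc a) : PT f :=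
  intro .skip (PolyBdd.sz.mono fun a => by simp [sz, h]) (PolyBdd.const 1)
    fun a i o m b e c => by rw [h]; exact .skip

theorem id : PT (fun a : α => a) := of_enc_eq fun _ => rfl

theorem encode : PT (fun a : α => enc a) := of_enc_eq fun _ => rfl

theorem comp {g : β → γ} {f : α → β} (hg : PT g) (hf : PT f) : PT fun a => g (f a) := by
  obtain ⟨p, q, h⟩ := hf.elim
  obtain ⟨p', q', h'⟩ := hg.elim
  obtain ⟨u, hu⟩ := hg.polyBdd
  refine intro (.seq p p') ((hf.polyBdd.eval u).mono fun a => hu (f a))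
    ((PolyBdd.sz.eval q).add (hf.polyBdd.eval q')) ?_
  exact fun a i o m b e c => .seq (h ..) (h' ..)

/-- A function on trees that represents `f` computes `f`. -/
theorem of_tree {f : α → β} {g : BTree → BTree} (hg : PT g) (h : ∀ a, g (enc a) = enc (f a)) :
    PT f := by
  obtain ⟨p, q, hp⟩ := hg
  refine ⟨p, q, fun a => ?_⟩
  have := hp (enc a)
  simp only [h] at this
  exact this

theorem const (d : β) : PT (fun _ : α => d) :=
  intro (.seq drop (pushList (enc d).ser)) (PolyBdd.const (sz d))
    ((((PolyBdd.const 6).mul PolyBdd.sz).add (.const 3)).add (.const ((enc d).ser.length + 1)))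
    fun _ _ _ _ _ _ _ => .seq (drop_run ..) (pushList_run ..)

/-- The argument is duplicated. The value of `f` waits on stack `B` while `g` is computed from the
other copy; this is sound because programs leave the deeper contents of all stacks alone. A final
`node` joins the two values. -/
theorem pair {f : α → β} {g : α → γ} (hf : PT f) (hg : PT g) : PT fun a => (f a, g a) := by
  obtain ⟨p, q, h⟩ := hf.elim
  obtain ⟨p', q', h'⟩ := hg.elim
  refine intro (.seq dup (.seq p (.seq stash (.seq p' (.seq unstash (.push .M .node))))))
    ((hf.polyBdd.add hg.polyBdd).add (.const 1))
    (t := fun a => (10 * sz a + 7) + (q.eval (sz a) + ((6 * sz (f a) + 4) + (q'.eval (sz a) +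
      ((2 * sz (f a) + 1) + 1))))) ?_ ?_
  · have hs : PolyBdd (fun a : α => sz a) := .sz
    exact ((((PolyBdd.const 10).mul hs).add (.const 7))).add ((hs.eval q).add
      ((((PolyBdd.const 6).mul hf.polyBdd).add (.const 4)).add ((hs.eval q').add
      ((((PolyBdd.const 2).mul hf.polyBdd).add (.const 1)).add (.const 1)))))
  · intro a i o m b e c
    have := RunLE.seq (dup_run (enc a) i o m b e c) (.seq (h ..) (.seq (stash_run ..)
      (.seq (h' ..) (.seq (unstash_run ..) (.push_M (a := .node))))))
    rw [← List.append_assoc] at this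
    exact this

theorem left : PT BTree.left := by
  refine intro (.case .M fun o => match o with
    | some .node => .seq stash (.seq drop unstash)
    | some a => .push .M a
    | none => .skip) (t := fun x => 20 * sz x) (PolyBdd.sz.mono fun a => ?_)
    ((PolyBdd.const 20).mul .sz) fun x i o m b e c => ?_
  · cases a <;> simp [BTree.left, sz, enc, size]; omega
  · cases x with
    | leaf a => exact (RunLE.case_M .push_M).mono (by simp [sz, enc, size])
    | node l r =>
      simp only [enc, id_eq, ser, List.cons_append, List.append_assoc, BTree.left, sz, size]
      exact (RunLE.case_M (.seq (stash_run ..) (.seq (drop_run ..) (unstash_run ..)))).mono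
        (by have := l.size_pos; have := r.size_pos; omega)

theorem right : PT BTree.right := by
  refine intro (.case .M fun o => match o with
    | some .node => drop
    | some a => .push .M a
    | none => .skip) (t := fun x => 20 * sz x) (PolyBdd.sz.mono fun a => ?_)
    ((PolyBdd.const 20).mul .sz) fun x i o m b e c => ?_
  · cases a <;> simp [BTree.right, sz, enc, size]; omega
  · cases x with
    | leaf a => exact (RunLE.case_M .push_M).mono (by simp [sz, enc, size])
    | node l r =>
      simp only [enc, id_eq, ser, List.cons_append, List.append_assoc, BTree.right, sz, size]
      exact (RunLE.case_M (drop_run ..)).mono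
        (by have := l.size_pos; have := r.size_pos; omega)

theorem leafTest (p : Option Ch → Bool) : PT (BTree.leafTest p) := by
  refine intro (.case .M fun o => match o with
    | some .node => .seq drop (.seq drop (.push .M (.leaf (some (Sum.inr false)))))
    | some (.leaf a) => .push .M (.leaf (some (Sum.inr (p a))))
    | _ => .skip) (t := fun x => 20 * sz x) ((PolyBdd.const 1).mono fun a => by simp [sz, enc, size])
    ((PolyBdd.const 20).mul .sz) fun x i o m b e c => ?_
  cases x with
  | leaf a => exact (RunLE.case_M .push_M).mono (by simp [sz, enc, size])
  | node l r =>
    simp only [enc, id_eq, ser, List.cons_append, List.append_assoc, BTree.leafTest, sz, size]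
    exact (RunLE.case_M (.seq (drop_run ..) (.seq (drop_run ..) .push_M))).mono
      (by have := l.size_pos; have := r.size_pos; omega)

theorem cond {c : α → Bool} {f g : α → β} (hc : PT c) (hf : PT f) (hg : PT g) :
    PT fun a => bif c a then f a else g a := by
  obtain ⟨p₀, q₀, h₀⟩ := hc.elim
  obtain ⟨p, q, h⟩ := hf.elim
  obtain ⟨p', q', h'⟩ := hg.elim
  refine intro (.seq dup (.seq p₀ (.case .M fun o => match o with
    | some (.leaf (some (Sum.inr true))) => p
    | _ => p'))) ((hf.polyBdd.add hg.polyBdd).mono fun a => ?_)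
    (t := fun a => (10 * sz a + 7) + (q₀.eval (sz a) + (1 + (q.eval (sz a) + q'.eval (sz a)))))
    ?_ ?_
  · cases c a <;> simp
  · have hs : PolyBdd (fun a : α => sz a) := .sz
    exact (((PolyBdd.const 10).mul hs).add (.const 7)).add ((hs.eval q₀).add
      ((PolyBdd.const 1).add ((hs.eval q).add (hs.eval q'))))
  · intro a i o m b e d
    refine RunLE.seq (dup_run (enc a) i o m b e d) (.seq (h₀ ..) ?_)
    cases hca : c a with
    | true => exact .case_M ((h a ..).mono (by omega))
    | false => exact .case_M ((h' a ..).mono (by omega))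

theorem length_le_sz (l : List α) : l.length ≤ sz l := by
  induction l with
  | nil => simp
  | cons a l ih =>
    simp only [sz, enc, encList, size, List.length_cons] at ih ⊢
    omega

/-- Iteration, controlled by the length of a list, of a function whose iterates stay small. -/
theorem iterate {h : α → List β × γ} {step : γ → γ} (hh : PT h) (hs : PT step)
    (hb : ∃ q : Polynomial ℕ, ∀ a, ∀ i ≤ (h a).1.length, sz (step^[i] (h a).2) ≤ q.eval (sz a)) :
    PT fun a => step^[(h a).1.length] (h a).2 := by
  obtain ⟨u, hu⟩ := hb
  obtain ⟨p₀, q₀, h₀⟩ := hh.elim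
  obtain ⟨p, q, hp⟩ := hs.elim
  -- The control list is consumed and leaves its length in unary on stack `E`.
  have key₁ : ∀ (l : List β) (i o m b e c), RunLE (.loop .M (fun o => decide (o = some Tok.node))
      (fun _ => .seq drop (.push .E .node))) (st i o ((enc l).ser ++ m) b e c) (7 * sz l)
      (st i o m b (List.replicate l.length Tok.node ++ e) c) := by
    intro l i o m b e c
    induction l generalizing e with
    | nil => exact (RunLE.loop_exit_M (by simp)).mono (by simp [sz, enc, encList, size])
    | cons x l ih =>
      have h1 := ih (Tok.node :: e)
      simp only [enc, encList, ser, List.cons_append, List.append_assoc, sz, size,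
        List.length_cons] at h1 ⊢
      rw [List.replicate_succ', List.append_assoc]
      exact (RunLE.loop_step_M (by simp) (.seq (drop_run ..) .push_E) h1).mono
        (by have := size_pos (enc x); omega)
  -- A common bound `T` for all rounds is needed: composing the polynomial of `step` with itself `n`
  -- times would not give a polynomial.
  have key₂ : ∀ (n T : ℕ) (g : γ) (i o m b e c), (∀ j < n, q.eval (sz (step^[j] g)) ≤ T) →
      RunLE (.loop .E (fun o => decide (o = some Tok.node)) (fun _ => p))
      (st i o ((enc g).ser ++ m) b (List.replicate n Tok.node ++ .mark :: e) c) ((1 + T) * n + 1)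
      (st i o ((enc (step^[n] g)).ser ++ m) b e c) := by
    intro n T
    induction n with
    | zero => exact fun g i o m b e c _ => (RunLE.loop_exit_E (by simp)).mono (by simp)
    | succ n ih =>
      intro g i o m b e c hT
      have h1 := ih (step g) i o m b e c fun j hj => by
        simpa using hT (j + 1) (by omega)
      rw [List.replicate_succ, List.cons_append, Function.iterate_succ_apply]
      have h2 : q.eval (sz g) ≤ T := hT 0 (by omega)
      exact (RunLE.loop_step_E (by simp) (hp g ..) h1).mono (by rw [Nat.mul_add]; omega)
  refine intro (.seq p₀ (.case .M fun _ => .seq (.push .E .mark) (.seq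
    (.loop .M (fun o => decide (o = some Tok.node)) (fun _ => .seq drop (.push .E .node)))
    (.loop .E (fun o => decide (o = some Tok.node)) (fun _ => p)))))
    (t := fun a => q₀.eval (sz a) + (1 + (1 + (7 * sz (h a) +
      ((1 + q.eval (u.eval (sz a))) * sz (h a) + 1)))))
    ⟨u, fun a => hu a _ le_rfl⟩ ?_ ?_
  · have hsz : PolyBdd (fun a : α => sz a) := .sz
    exact (hsz.eval q₀).add ((PolyBdd.const 1).add ((PolyBdd.const 1).add
      (((PolyBdd.const 7).mul hh.polyBdd).add (((((PolyBdd.const 1).add ((hsz.eval u).eval q)).mul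
      hh.polyBdd)).add (.const 1)))))
  · intro a i o m b e c
    have e1 : (enc (h a)).ser = Tok.node :: ((enc (h a).1).ser ++ (enc (h a).2).ser) := rfl
    have e2 : sz (h a) = sz (h a).1 + sz (h a).2 + 1 := rfl
    have h1 := h₀ a i o m b e c
    rw [e1, List.cons_append, List.append_assoc] at h1
    refine (RunLE.seq h1 (.case_M (.seq .push_E (.seq (key₁ ..) (key₂ _ (q.eval (u.eval (sz a)))
      (h a).2 _ _ _ _ _ _ fun j hj => eval_mono q (hu a j hj.le)))))).mono ?_
    have h2 := length_le_sz (h a).1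
    have h3 : (1 + q.eval (u.eval (sz a))) * (h a).1.length ≤
      (1 + q.eval (u.eval (sz a))) * sz (h a) := Nat.mul_le_mul_left _ (by omega)
    have h4 : 7 * sz (h a).1 ≤ 7 * sz (h a) := by omega
    omega

end PT

/-! ### Input and output of words -/

/-- The program that reads the input word, leaving the reversed word on the main stack. -/
def readInput : Prog :=
  .seq (.push .M (.leaf none)) (.loop .inp (fun o => o.isSome)
    (fun o => match o with
      | some a => .seq (.push .M (.leaf (some a))) (.push .M .node)
      | none => .skip))

theorem readInput_run (w : List Ch) :
    RunLE readInput (st w [] [] [] [] []) (3 * w.length + 2)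
      (st [] [] (enc w.reverse).ser [] [] []) := by
  have key : ∀ (w v : List Ch), RunLE (.loop .inp (fun o => o.isSome)
      (fun o => match o with
      | some a => .seq (.push .M (.leaf (some a))) (.push .M .node)
      | none => .skip)) (st w [] (enc v).ser [] [] []) (3 * w.length + 1)
      (st [] [] (enc (w.reverse ++ v)).ser [] [] []) := by
    intro w
    induction w with
    | nil =>
      intro v
      exact .loop_exit (k := .inp) (o := none) rfl rfl (update_inp ..)
    | cons a w ih =>
      intro v
      have h1 := ih (a :: v)
      rw [List.reverse_cons, List.append_assoc]
      exact (RunLE.loop_step (k := .inp) (o := some a) rfl rfl (update_inp ..)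
        (.seq .push_M .push_M) h1).mono (by simp only [List.length_cons]; omega)
  have h := key w []
  rw [List.append_nil] at h
  exact (RunLE.seq .push_M h).mono (by omega)

/-- The program that writes the word on the main stack to the output, reversing it. -/
def writeOutput : Prog :=
  .loop .M (fun o => decide (o = some Tok.node)) (fun _ => .case .M fun o => match o with
    | some (.leaf (some a)) => .push .out a
    | _ => .skip)

theorem writeOutput_run (w v : List Ch) :
    RunLE writeOutput (st [] v (enc w).ser [] [] []) (3 * w.length + 1)
      (st [] (w.reverse ++ v) [] [] [] []) := by
  induction w generalizing v with
  | nil => exact .loop_exit_M (by simp)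
  | cons a w ih =>
    have h1 := ih (a :: v)
    rw [List.reverse_cons, List.append_assoc]
    exact (RunLE.loop_step_M (by simp) (.case_M (RunLE.push (update_out ..))) h1).mono
      (by simp only [List.length_cons]; omega)

theorem sz_word (w : List Ch) : sz w = 2 * w.length + 1 := by
  induction w with
  | nil => rfl
  | cons a w ih =>
    simp only [sz, enc, encList, size, List.length_cons] at ih ⊢
    omega

theorem single_inp (w : List Ch) : single (Γ := Alph) Reg.inp w = st w [] [] [] [] [] := by
  funext k; cases k <;> rfl

theorem single_out (w : List Ch) : single (Γ := Alph) Reg.out w = st [] w [] [] [] [] := by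
  funext k; cases k <;> rfl

/-- A function of words that is computable in the sense of `PT`, up to the reversal of words, is
computed by a Turing machine. -/
theorem computableInPolyTime_of_PT {X Y : Type} (ea : X → List Ch) (eb : Y → List Ch) (f : X → Y)
    {g : List Ch → List Ch} (hg : PT g) (h : ∀ x, g (ea x).reverse = (eb (f x)).reverse) :
    Nonempty (Turing.TM2ComputableInPolyTime ea eb f) := by
  obtain ⟨p, q, hp⟩ := hg
  refine StackProg.computableInPolyTime (K := Reg) (Γ := Alph) (k₀ := .inp) (k₁ := .out) ea eb f
    (.seq readInput (.seq p writeOutput))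
    -- The encoding of a word of length `n` as a list has size `2 * n + 1` (`sz_word`).
    (3 * Polynomial.X + 2 + (q.comp (2 * Polynomial.X + 1) +
      (3 * q.comp (2 * Polynomial.X + 1) + 1))) fun x => ?_
  rw [single_inp, single_out]
  obtain ⟨h1, h2⟩ := hp (ea x).reverse
  have h2 := h2 [] [] [] [] [] []
  rw [h] at h1 h2
  rw [sz_word, sz_word, List.length_reverse, List.length_reverse] at h1
  rw [sz_word, List.length_reverse] at h2
  simp only [List.append_nil] at h2
  have h3 := writeOutput_run (eb (f x)).reverse []
  rw [List.reverse_reverse, List.append_nil] at h3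
  refine (RunLE.seq (readInput_run (ea x)) (.seq h2 h3)).mono ?_
  simp only [Polynomial.eval_add, Polynomial.eval_mul, Polynomial.eval_comp, Polynomial.eval_X,
    Polynomial.eval_ofNat, Polynomial.eval_one]
  rw [List.length_reverse]
  omega

end TreeMachine


/-! ### Closure properties of the functions computable in polynomial time -/

namespace TreeMachine

open StackProg BTree Enc

variable {α β γ δ : Type} [Enc α] [Enc β] [Enc γ] [Enc δ]

theorem sz_pair (p : α × β) : sz p = sz p.1 + sz p.2 + 1 := rfl

theorem sz_nil : sz ([] : List α) = 1 := rfl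

theorem sz_cons (a : α) (l : List α) : sz (a :: l) = sz a + sz l + 1 := rfl

theorem sz_bool (b : Bool) : sz b = 1 := rfl

theorem sz_ch (b : Ch) : sz b = 1 := rfl

theorem sz_pos (a : α) : 0 < sz a := size_pos _

theorem sz_append (l l' : List α) : sz (l ++ l') + 1 = sz l + sz l' := by
  induction l with
  | nil => rw [sz_nil, List.nil_append, add_comm]
  | cons a l ih =>
    rw [List.cons_append, sz_cons, sz_cons]
    omega

theorem sz_le_of_mem {a : α} {l : List α} (h : a ∈ l) : sz a ≤ sz l := by
  induction l with
  | nil => simp at h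
  | cons b l ih =>
    rw [sz_cons]
    rcases List.mem_cons.1 h with rfl | h
    · omega
    · have := ih h
      omega

theorem sz_tail_le (l : List α) : sz l.tail ≤ sz l := by
  cases l with
  | nil => exact le_rfl
  | cons a l => rw [List.tail_cons, sz_cons]; omega

/-- Serves to bound additively the growth caused by steps that take off the head of a list and put
back a modified one. -/
theorem sz_headD_add_tail_le (l : List α) (d : α) : sz (l.headD d) + sz l.tail ≤ sz l + sz d := by
  cases l with
  | nil => rw [List.tail_nil, List.headD_nil]; omega
  | cons a l => rw [List.tail_cons, List.headD_cons, sz_cons]; omega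

namespace PolyBdd

/-- A polynomial bound that holds uniformly for the members of a list. -/
theorem exists_mem_bound {f : α → List β} {u : α × β → ℕ} (hf : PT f) (hu : PolyBdd u) :
    ∃ K : α → ℕ, PolyBdd K ∧ ∀ a, ∀ b ∈ f a, u (a, b) ≤ K a := by
  obtain ⟨q, hq⟩ := hu
  refine ⟨fun a => q.eval (TreeMachine.sz a + TreeMachine.sz (f a) + 1),
    ((PolyBdd.sz.add hf.polyBdd).add (.const 1)).eval q, fun a b hb => (hq _).trans (eval_mono q ?_)⟩
  have := sz_le_of_mem hb
  rw [sz_pair]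
  dsimp only
  omega

end PolyBdd

namespace PT

theorem congr_enc {f : α → β} {g : α → γ} (hf : PT f) (h : ∀ a, enc (g a) = enc (f a)) : PT g := by
  obtain ⟨p, q, hp⟩ := hf
  refine ⟨p, q, fun a => ?_⟩
  have := hp a
  simp only [sz, ← h] at this
  exact this

theorem fst {f : α → β × γ} (hf : PT f) : PT fun a => (f a).1 :=
  (of_tree left fun _ => rfl : PT (fun p : β × γ => p.1)).comp hf

theorem snd {f : α → β × γ} (hf : PT f) : PT fun a => (f a).2 :=
  (of_tree right fun _ => rfl : PT (fun p : β × γ => p.2)).comp hf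

theorem tail {f : α → List β} (hf : PT f) : PT fun a => (f a).tail :=
  (of_tree right fun l => by cases l <;> rfl : PT (fun l : List β => l.tail)).comp hf

theorem isEmpty {f : α → List β} (hf : PT f) : PT fun a => (f a).isEmpty := by
  have h : PT (fun l : List β => l.isEmpty) :=
    congr_enc ((leafTest fun _ => true).comp encode) fun l => by cases l <;> rfl
  exact h.comp hf

theorem headD {f : α → List β} (hf : PT f) (d : β) : PT fun a => (f a).headD d := by
  have h : PT (fun l : List β => l.headD d) := by
    refine congr_enc (cond ((leafTest fun _ => true).comp encode) (const (enc d))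
      (left.comp encode)) fun l => ?_
    cases l <;> rfl
  exact h.comp hf

theorem cons {f : α → β} {g : α → List β} (hf : PT f) (hg : PT g) : PT fun a => f a :: g a :=
  congr_enc (hf.pair hg) fun _ => rfl

theorem ite {c : α → Prop} [DecidablePred c] {f g : α → β} (hc : PT fun a => decide (c a))
    (hf : PT f) (hg : PT g) : PT fun a => if c a then f a else g a := by
  have : (fun a => if c a then f a else g a) = fun a => bif decide (c a) then f a else g a := by
    funext a
    by_cases h : c a <;> simp [h]
  rw [this]
  exact cond hc hf hg

theorem not {f : α → Bool} (hf : PT f) : PT fun a => !f a := by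
  refine congr_enc (cond hf (const false) (const true)) fun a => ?_
  cases f a <;> rfl

theorem and {f g : α → Bool} (hf : PT f) (hg : PT g) : PT fun a => f a && g a := by
  refine congr_enc (cond hf hg (const false)) fun a => ?_
  cases f a <;> rfl

theorem or {f g : α → Bool} (hf : PT f) (hg : PT g) : PT fun a => f a || g a := by
  refine congr_enc (cond hf (const true) hg) fun a => ?_
  cases f a <;> rfl

theorem xor {f g : α → Bool} (hf : PT f) (hg : PT g) : PT fun a => Bool.xor (f a) (g a) := by
  refine congr_enc (cond hf hg.not hg) fun a => ?_
  cases f a <;> cases g a <;> rfl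

theorem beq {f g : α → Bool} (hf : PT f) (hg : PT g) : PT fun a => f a == g a := by
  refine congr_enc (cond hf hg hg.not) fun a => ?_
  cases f a <;> cases g a <;> rfl

/-- Equality of trees with a fixed tree. -/
def treeEq : BTree → BTree → Bool
  | .leaf a, x => x.leafTest fun b => decide (b = a)
  | .node l r, x => !(x.leafTest fun _ => true) && (treeEq l x.left && treeEq r x.right)

theorem treeEq_iff (d x : BTree) : treeEq d x = true ↔ x = d := by
  induction d generalizing x with
  | leaf a => cases x <;> simp [treeEq, BTree.leafTest]
  | node l r hl hr => cases x <;> simp [treeEq, BTree.leafTest, BTree.left, BTree.right, hl, hr]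

/-- The program follows the shape of the fixed tree, so its length and running time depend on `d`,
which counts as a constant. -/
theorem treeEq_const (d : BTree) : PT (treeEq d) := by
  induction d with
  | leaf a => exact leafTest _
  | node l r hl hr => exact (leafTest _).not.and ((hl.comp left).and (hr.comp right))

theorem eqConst {f : α → β} (hf : PT f) (c : β) [∀ a, Decidable (f a = c)] :
    PT fun a => decide (f a = c) := by
  refine congr_enc ((treeEq_const (enc c)).comp (encode.comp hf)) fun a => ?_
  congr 1
  rw [Bool.eq_iff_iff, decide_eq_true_iff, treeEq_iff]
  exact Enc.inj.eq_iff.symm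

/-- A test of a symbol. -/
theorem chTest {f : α → Ch} (hf : PT f) (p : Ch → Bool) : PT fun a => p (f a) :=
  (congr_enc ((leafTest fun o => match o with
    | some a => p a
    | none => false).comp encode) fun _ => rfl : PT p).comp hf

/-- A function that is constant outside a finite set of keys. -/
theorem lookup {f : α → β} (hf : PT f) [DecidableEq β] (keys : List β) (v : β → γ) (d : γ) :
    PT fun a => if f a ∈ keys then v (f a) else d := by
  induction keys with
  | nil => simpa using const d
  | cons k keys ih =>
    refine congr_enc (ite (hf.eqConst k) (const (v k)) ih) fun a => ?_
    by_cases h : f a = k <;> simp [h]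

/-- A fold is an iteration on triples of remaining list, parameter and accumulator, controlled by a
second copy of the list. The accumulator must be bounded after every prefix, not just at the end.
The default element is never reached. -/
theorem foldl_of_bound [Inhabited β] {f : α → List β} {z : α → γ} {s : α → γ → β → γ}
    (hf : PT f) (hz : PT z) (hs : PT fun p : α × γ × β => s p.1 p.2.1 p.2.2)
    (hb : ∃ K : α → ℕ, PolyBdd K ∧ ∀ a l, l <+: f a → sz (l.foldl (s a) (z a)) ≤ K a) :
    PT fun a => (f a).foldl (s a) (z a) := by
  let step : List β × α × γ → List β × α × γ := fun x =>
    (x.1.tail, x.2.1, s x.2.1 x.2.2 (x.1.headD default))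
  have hstep : PT step :=
    id.fst.tail.pair (id.snd.fst.pair (hs.comp (id.snd.fst.pair (id.snd.snd.pair
      (id.fst.headD default)))))
  have key : ∀ (a : α) (l : List β) (g : γ) (i : ℕ), i ≤ l.length →
      step^[i] (l, a, g) = (l.drop i, a, (l.take i).foldl (s a) g) := by
    intro a l g i
    induction i generalizing l g with
    | zero => simp
    | succ i ih =>
      intro hi
      cases l with
      | nil => simp at hi
      | cons b l =>
        rw [Function.iterate_succ_apply]
        simpa [step] using ih l (s a g b) (by simpa using hi)
  obtain ⟨K, hK, hKb⟩ := hb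
  have h := iterate (h := fun a => (f a, (f a, a, z a))) (hf.pair (hf.pair (id.pair hz))) hstep (by
    refine ((hf.polyBdd.add (PolyBdd.sz.add hK)).add (.const 2)).mono (f := fun a => ?_) ?_ |>.imp
      fun q hq a i hi => ?_
    · exact sz (f a) + (sz a + K a) + 2
    · exact fun a => le_rfl
    · refine le_trans ?_ (hq a)
      dsimp only
      rw [key _ _ _ _ hi, sz_pair, sz_pair]
      have h1 := hKb a _ (List.take_prefix i (f a))
      have h2 := sz_append ((f a).take i) ((f a).drop i)
      rw [List.take_append_drop] at h2
      have := sz_pos ((f a).take i)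
      dsimp only
      omega)
  refine congr_enc h.snd.snd fun a => ?_
  dsimp only
  rw [key _ _ _ _ le_rfl, List.take_length]

/-- If a step enlarges any accumulator by at most `K a`, then all partial folds have size at most
`sz (z a) + K a * sz (f a)`. This is the growth condition checked for most of the loops below. -/
theorem foldl [Inhabited β] {f : α → List β} {z : α → γ} {s : α → γ → β → γ}
    (hf : PT f) (hz : PT z) (hs : PT fun p : α × γ × β => s p.1 p.2.1 p.2.2) {K : α → ℕ}
    (hK : PolyBdd K) (hb : ∀ a g, ∀ b ∈ f a, sz (s a g b) ≤ sz g + K a) :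
    PT fun a => (f a).foldl (s a) (z a) := by
  refine foldl_of_bound hf hz hs ⟨fun a => sz (z a) + K a * sz (f a),
    hz.polyBdd.add (hK.mul hf.polyBdd), fun a l hl => ?_⟩
  have key : ∀ l : List β, (∀ b ∈ l, b ∈ f a) → ∀ g, sz (l.foldl (s a) g) ≤ sz g + K a * l.length := by
    intro l
    induction l with
    | nil => simp
    | cons b l ih =>
      intro hl g
      have h1 := ih (fun b hb => hl b (List.mem_cons_of_mem _ hb)) (s a g b)
      have h2 := hb a g b (hl b List.mem_cons_self)
      rw [List.foldl_cons, List.length_cons, Nat.mul_add]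
      omega
  refine (key l (fun b hb => hl.subset hb) (z a)).trans ?_
  have : K a * l.length ≤ K a * sz (f a) :=
    Nat.mul_le_mul_left _ (hl.length_le.trans (length_le_sz _))
  exact Nat.add_le_add_left this _

theorem reverse [Inhabited β] {f : α → List β} (hf : PT f) : PT fun a => (f a).reverse := by
  have h := foldl (f := f) (z := fun _ => ([] : List β)) (s := fun _ g b => b :: g) hf (const [])
    (id.snd.snd.cons id.snd.fst) (hf.polyBdd.add (.const 1)) (fun a g b hb => by
      rw [sz_cons]
      have := sz_le_of_mem hb
      omega)
  refine congr_enc h fun a => ?_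
  have : ∀ l m : List β, l.foldl (fun g b => b :: g) m = l.reverse ++ m := by
    intro l
    induction l with
    | nil => simp
    | cons b l ih => intro m; simp [ih]
  rw [this, List.append_nil]

theorem foldr [Inhabited β] {f : α → List β} {z : α → γ} {s : α → β → γ → γ}
    (hf : PT f) (hz : PT z) (hs : PT fun p : α × β × γ => s p.1 p.2.1 p.2.2) {K : α → ℕ}
    (hK : PolyBdd K) (hb : ∀ a g, ∀ b ∈ f a, sz (s a b g) ≤ sz g + K a) :
    PT fun a => (f a).foldr (s a) (z a) := by
  have h := foldl (s := fun a g b => s a b g) hf.reverse hz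
    (hs.comp (id.fst.pair (id.snd.snd.pair id.snd.fst))) hK
    (fun a g b hb' => hb a g b (by simpa using hb'))
  simpa [List.foldl_reverse] using h

theorem map [Inhabited β] {f : α → List β} {g : α → β → γ} (hf : PT f)
    (hg : PT fun p : α × β => g p.1 p.2) : PT fun a => (f a).map (g a) := by
  obtain ⟨K, hK, hKb⟩ := PolyBdd.exists_mem_bound hf hg.polyBdd
  have h := foldr (z := fun _ => ([] : List γ)) (s := fun a b l => g a b :: l) hf (const [])
    ((hg.comp (id.fst.pair id.snd.fst)).cons id.snd.snd) (hK.add (.const 1)) (fun a l b hb => by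
      have := hKb a b hb
      rw [sz_cons]
      dsimp only at this
      omega)
  refine congr_enc h fun a => ?_
  rw [List.map_eq_foldr]

theorem append [Inhabited β] {f g : α → List β} (hf : PT f) (hg : PT g) :
    PT fun a => f a ++ g a := by
  have h := foldr (s := fun _ b l => b :: l) hf hg (id.snd.fst.cons id.snd.snd)
    (hf.polyBdd.add (.const 1)) (fun a l b hb => by
      have := sz_le_of_mem hb
      rw [sz_cons]
      omega)
  simpa using h

theorem flatMap [Inhabited β] [Inhabited γ] {f : α → List β} {g : α → β → List γ} (hf : PT f)
    (hg : PT fun p : α × β => g p.1 p.2) : PT fun a => (f a).flatMap (g a) := by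
  obtain ⟨K, hK, hKb⟩ := PolyBdd.exists_mem_bound hf hg.polyBdd
  have h := foldr (z := fun _ => ([] : List γ)) (s := fun a b l => g a b ++ l) hf (const [])
    ((hg.comp (id.fst.pair id.snd.fst)).append id.snd.snd) hK (fun a l b hb => by
      have := hKb a b hb
      have := sz_append (g a b) l
      dsimp only at *
      omega)
  refine congr_enc h fun a => ?_
  congr 1
  induction f a with
  | nil => rfl
  | cons b l ih => simp [ih]

theorem filter [Inhabited β] {f : α → List β} {g : α → β → Bool} (hf : PT f)
    (hg : PT fun p : α × β => g p.1 p.2) : PT fun a => (f a).filter (g a) := by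
  have h := foldr (z := fun _ => ([] : List β)) (s := fun a b l => bif g a b then b :: l else l) hf
    (const []) ((hg.comp (id.fst.pair id.snd.fst)).cond (id.snd.fst.cons id.snd.snd) id.snd.snd)
    (hf.polyBdd.add (.const 1)) (fun a l b hb => by
      have := sz_le_of_mem hb
      cases g a b
      · simp
      · simp only [cond_true, sz_cons]
        omega)
  refine congr_enc h fun a => ?_
  congr 1
  induction f a with
  | nil => rfl
  | cons b l ih => cases hb : g a b <;> simp [hb, ih]

theorem any [Inhabited β] {f : α → List β} {g : α → β → Bool} (hf : PT f)
    (hg : PT fun p : α × β => g p.1 p.2) : PT fun a => (f a).any (g a) := by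
  refine congr_enc (hf.filter hg).isEmpty.not fun a => ?_
  congr 1
  induction f a with
  | nil => rfl
  | cons b l ih => cases hb : g a b <;> simp [hb, ih]

theorem all [Inhabited β] {f : α → List β} {g : α → β → Bool} (hf : PT f)
    (hg : PT fun p : α × β => g p.1 p.2) : PT fun a => (f a).all (g a) := by
  refine congr_enc (hf.any (g := fun a b => !g a b) hg.not).not fun a => ?_
  congr 1
  induction f a with
  | nil => rfl
  | cons b l ih => simp [ih]

end PT

/-! ### Natural numbers in binary -/

/-- Numbers are kept in binary, least significant digit first: weights may be exponential in the
length of the input. -/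
instance : Enc ℕ where
  enc n := enc n.bits
  inj m n h := by
    have h1 : m.bits = n.bits := Enc.inj h
    have h2 : ∀ n : ℕ, n.bits.foldr Nat.bit 0 = n := by
      intro n
      induction n using Nat.binaryRec' with
      | zero => simp
      | bit b n hn ih => rw [Nat.bits_append_bit n b hn, List.foldr_cons, ih]
    rw [← h2 m, ← h2 n, h1]

/-- The number with the given binary digits, least significant first. -/
def ofBits (l : List Bool) : ℕ := l.foldr Nat.bit 0

theorem ofBits_bits (n : ℕ) : ofBits n.bits = n := by
  induction n using Nat.binaryRec' with
  | zero => simp [ofBits]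
  | bit b n hn ih => rw [Nat.bits_append_bit n b hn, ofBits, List.foldr_cons]; congr 1

theorem ofBits_cons (b : Bool) (l : List Bool) : ofBits (b :: l) = b.toNat + 2 * ofBits l := by
  simp only [ofBits, List.foldr_cons, Nat.bit_val]
  ring

theorem ofBits_append (l m : List Bool) :
    ofBits (l ++ m) = ofBits l + 2 ^ l.length * ofBits m := by
  induction l with
  | nil => simp [ofBits]
  | cons b l ih =>
    rw [List.cons_append, ofBits_cons, ih, ofBits_cons, List.length_cons, pow_succ]
    ring

/-- Remove the leading zeros. -/
def trim (l : List Bool) : List Bool :=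
  l.foldr (fun b m => bif !b && m.isEmpty then [] else b :: m) []

/-- The encoding of a number is canonical, so a computed digit string has to lose its leading zeros
before it encodes its value. -/
theorem bits_ofBits (l : List Bool) : (ofBits l).bits = trim l := by
  induction l with
  | nil => simp [ofBits, trim]
  | cons b l ih =>
    have h1 : ofBits (b :: l) = Nat.bit b (ofBits l) := rfl
    have h2 : trim (b :: l) = bif !b && (trim l).isEmpty then [] else b :: trim l := rfl
    rw [h1, h2, ← ih]
    by_cases h : ofBits l = 0
    · rw [h]
      cases b <;> simp [Nat.bit]
    · rw [Nat.bits_append_bit _ _ (fun h' => absurd h' h)]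
      have : (ofBits l).bits ≠ [] := by
        intro h'
        apply h
        rw [← ofBits_bits (ofBits l), h']
        rfl
      have h3 : (ofBits l).bits.isEmpty = false := by simpa using this
      simp [h3]

theorem sz_bits (l : List Bool) : sz l = 2 * l.length + 1 := by
  induction l with
  | nil => rfl
  | cons a l ih =>
    rw [sz_cons, ih, sz_bool, List.length_cons]
    omega

theorem sz_nat (n : ℕ) : sz n = 2 * n.size + 1 := by
  rw [← Nat.size_eq_bits_len]
  exact sz_bits n.bits

/-- Crude, but additive in the summands, as the growth condition for the fold in `PT.sum` requires.
-/
theorem sz_nat_add_le (m n : ℕ) : sz (m + n) ≤ sz m + sz n + 1 := by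
  have h : (m + n).size ≤ m.size + n.size + 1 := by
    rw [Nat.size_le, pow_succ, pow_add]
    have h1 := Nat.lt_size_self m
    have h2 := Nat.lt_size_self n
    have h3 : 1 ≤ 2 ^ m.size := Nat.one_le_two_pow
    have h4 : 1 ≤ 2 ^ n.size := Nat.one_le_two_pow
    nlinarith
  rw [sz_nat, sz_nat, sz_nat]
  omega

namespace PT

theorem bits {f : α → ℕ} (hf : PT f) : PT fun a => (f a).bits := congr_enc hf fun _ => rfl

theorem ofBits {f : α → List Bool} (hf : PT f) : PT fun a => TreeMachine.ofBits (f a) := by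
  have h := foldr (z := fun _ => ([] : List Bool))
    (s := fun _ b (m : List Bool) => bif !b && m.isEmpty then [] else b :: m) hf (const [])
    ((id.snd.fst.not.and id.snd.snd.isEmpty).cond (const []) (id.snd.fst.cons id.snd.snd))
    (PolyBdd.const 2) (fun a l b hb => by
      cases (!b && l.isEmpty)
      · simp only [cond_false, sz_cons, sz_bool]
        omega
      · simp only [cond_true, sz_nil]
        omega)
  exact congr_enc h fun a => congrArg enc (bits_ofBits (f a))

/-- One step of the addition of binary numbers; the state consists of the carry, the remaining
digits of the summands, and the digits of the sum in reverse order. -/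
def addStep (x : Bool × (List Bool × List Bool) × List Bool) :
    Bool × (List Bool × List Bool) × List Bool :=
  let a := x.2.1.1.headD false
  let b := x.2.1.2.headD false
  ((a && b) || (x.1 && Bool.xor a b), (x.2.1.1.tail, x.2.1.2.tail),
    Bool.xor x.1 (Bool.xor a b) :: x.2.2)

/-- The digits of the sum of two binary numbers. -/
def addBits (l m : List Bool) : List Bool :=
  let x := (l ++ m).foldl (fun x _ => addStep x) (false, (l, m), [])
  x.2.2.reverse ++ [x.1]

theorem ofBits_eq_headD_add (l : List Bool) :
    TreeMachine.ofBits l = (l.headD false).toNat + 2 * TreeMachine.ofBits l.tail := by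
  cases l with
  | nil => simp [TreeMachine.ofBits]
  | cons b l => rw [ofBits_cons, List.headD_cons, List.tail_cons]

theorem ofBits_addBits (l m : List Bool) :
    TreeMachine.ofBits (addBits l m) = TreeMachine.ofBits l + TreeMachine.ofBits m := by
  -- Invariant of carry addition: the value of the digits already written plus `2 ^ out.length`
  -- times the sum of the carry and the unread summands.
  have key : ∀ (w : List Bool) (l m out : List Bool) (c : Bool),
      let x := w.foldl (fun x _ => addStep x) (c, (l, m), out)
      TreeMachine.ofBits out.reverse + 2 ^ out.length *
        (c.toNat + TreeMachine.ofBits l + TreeMachine.ofBits m) =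
      TreeMachine.ofBits x.2.2.reverse + 2 ^ x.2.2.length *
        (x.1.toNat + TreeMachine.ofBits x.2.1.1 + TreeMachine.ofBits x.2.1.2) ∧
      x.2.1.1 = l.drop w.length ∧ x.2.1.2 = m.drop w.length := by
    intro w
    induction w with
    | nil => simp
    | cons _ w ih =>
      intro l m out c
      have h := ih l.tail m.tail (Bool.xor c (Bool.xor (l.headD false) (m.headD false)) :: out)
        ((l.headD false && m.headD false) || (c && Bool.xor (l.headD false) (m.headD false)))
      refine ⟨Eq.trans ?_ h.1, ?_, ?_⟩
      · rw [List.reverse_cons, ofBits_append, List.length_reverse, ofBits_cons,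
          ofBits_eq_headD_add l, ofBits_eq_headD_add m, List.length_cons, pow_succ]
        have e0 : TreeMachine.ofBits [] = 0 := rfl
        rw [e0]
        cases c <;> cases l.headD false <;> cases m.headD false <;> simp <;> ring
      · rw [List.length_cons, ← List.drop_tail]
        exact h.2.1
      · rw [List.length_cons, ← List.drop_tail]
        exact h.2.2
  obtain ⟨h1, h2, h3⟩ := key (l ++ m) l m [] false
  -- The word `l ++ m` only serves as a clock; it is long enough to exhaust both summands.
  rw [List.drop_of_length_le (by simp)] at h2 h3
  rw [addBits, ofBits_append, List.length_reverse, ofBits_cons]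
  rw [h2, h3] at h1
  simpa [TreeMachine.ofBits] using h1.symm

theorem add {f g : α → ℕ} (hf : PT f) (hg : PT g) : PT fun a => f a + g a := by
  have hstep : PT addStep := by
    have h1 : PT fun x : Bool × (List Bool × List Bool) × List Bool => x.2.1.1.headD false :=
      id.snd.fst.fst.headD false
    have h2 : PT fun x : Bool × (List Bool × List Bool) × List Bool => x.2.1.2.headD false :=
      id.snd.fst.snd.headD false
    exact ((h1.and h2).or (id.fst.and (h1.xor h2))).pair
      ((id.snd.fst.fst.tail.pair id.snd.fst.snd.tail).pair ((id.fst.xor (h1.xor h2)).cons id.snd.snd))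
  have h := foldl (f := fun a => (f a).bits ++ (g a).bits)
    (z := fun a => (false, ((f a).bits, (g a).bits), ([] : List Bool)))
    (s := fun _ x _ => addStep x) (hf.bits.append hg.bits)
    ((const false).pair ((hf.bits.pair hg.bits).pair (const []))) (hstep.comp id.snd.fst)
    (PolyBdd.const 2) (fun a x b _ => by
      have h1 := sz_tail_le x.2.1.1
      have h2 := sz_tail_le x.2.1.2
      simp only [addStep, sz_pair, sz_cons, sz_bool]
      omega)
  refine congr_enc (h.snd.snd.reverse.append (h.fst.cons (const []))).ofBits fun a => ?_
  congr 1
  have := ofBits_addBits (f a).bits (g a).bits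
  rw [ofBits_bits, ofBits_bits] at this
  exact this.symm

/-- Equality of binary words. -/
def bitsEq (l m : List Bool) : Bool :=
  let x := l.foldl (fun (x : List Bool × Bool) b =>
    (x.1.tail, x.2 && (!x.1.isEmpty && (x.1.headD false == b)))) (m, true)
  x.1.isEmpty && x.2

theorem bitsEq_iff (l m : List Bool) : bitsEq l m = true ↔ l = m := by
  have key : ∀ (l m : List Bool) (c : Bool),
      (let x := l.foldl (fun (x : List Bool × Bool) b =>
        (x.1.tail, x.2 && (!x.1.isEmpty && (x.1.headD false == b)))) (m, c)
      x.1.isEmpty && x.2) = true ↔ l = m ∧ c = true := by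
    intro l
    induction l with
    | nil =>
      intro m c
      cases m <;> simp
    | cons b l ih =>
      intro m c
      rw [List.foldl_cons]
      refine (ih _ _).trans ?_
      cases m with
      | nil => simp
      | cons d m =>
        simp only [List.tail_cons, List.isEmpty_cons, Bool.not_false, List.headD_cons,
          Bool.true_and, Bool.and_eq_true, beq_iff_eq, List.cons.injEq]
        constructor
        · rintro ⟨h1, h2, h3⟩
          exact ⟨⟨h3.symm, h1⟩, h2⟩
        · rintro ⟨⟨h3, h1⟩, h2⟩
          exact ⟨h1, h2, h3.symm⟩
  exact (key l m true).trans (by simp)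

theorem natEq {f g : α → ℕ} (hf : PT f) (hg : PT g) : PT fun a => decide (f a = g a) := by
  have h := foldl (f := fun a => (f a).bits) (z := fun a => ((g a).bits, true))
    (s := fun _ x b => (x.1.tail, x.2 && (!x.1.isEmpty && (x.1.headD false == b)))) hf.bits
    (hg.bits.pair (const true)) (id.snd.fst.fst.tail.pair (id.snd.fst.snd.and
      (id.snd.fst.fst.isEmpty.not.and ((id.snd.fst.fst.headD false).beq id.snd.snd))))
    (PolyBdd.const 0) (fun a x b _ => by
      have h1 := sz_tail_le x.1
      simp only [sz_pair, sz_bool]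
      omega)
  refine congr_enc (h.fst.isEmpty.and h.snd) fun a => ?_
  congr 1
  rw [Bool.eq_iff_iff, decide_eq_true_iff]
  refine Iff.trans ?_ (bitsEq_iff (f a).bits (g a).bits).symm
  exact ⟨fun h => by rw [h], fun h => by rw [← ofBits_bits (f a), h, ofBits_bits]⟩

theorem sum {f : α → List ℕ} (hf : PT f) : PT fun a => (f a).sum := by
  have h := foldr (z := fun _ => 0) (s := fun _ b n => b + n) hf (const 0)
    (id.snd.fst.add id.snd.snd) (hf.polyBdd.add (.const 1)) (fun a n b hb => by
      have h1 := sz_nat_add_le b n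
      have h2 := sz_le_of_mem hb
      omega)
  exact h

theorem length [Inhabited β] {f : α → List β} (hf : PT f) : PT fun a => (f a).length := by
  refine congr_enc (hf.map (g := fun _ _ => 1) (const 1)).sum fun a => ?_
  simp

/-- The numbers from `n` down to `0`. -/
def downFrom (n : ℕ) : List ℕ := (List.range (n + 1)).reverse

theorem downFrom_succ (n : ℕ) : downFrom (n + 1) = (n + 1) :: downFrom n := by
  rw [downFrom, List.range_succ, List.reverse_append, downFrom]
  rfl

theorem mem_downFrom {m n : ℕ} : m ∈ downFrom n ↔ m ≤ n := by
  simp [downFrom]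

/-- One step can double the size of an arbitrary accumulator, so the additive criterion does not
apply; the accumulators that occur are lists `downFrom n`, and these are bounded directly. -/
theorem downFrom_length [Inhabited β] {f : α → List β} (hf : PT f) :
    PT fun a => downFrom (f a).length := by
  have key : ∀ l : List β, l.foldl (fun (g : List ℕ) _ => (g.headD 0 + 1) :: g) [0] =
      downFrom l.length := by
    intro l
    induction l using List.reverseRecOn with
    | nil => rfl
    | append_singleton l b ih =>
      rw [List.foldl_append, ih, List.length_append, List.length_singleton, downFrom_succ]
      cases hl : l.length with
      | zero => rfl
      | succ n =>
        rw [downFrom_succ]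
        rfl
  have hsz : ∀ n, sz (downFrom n) ≤ (n + 1) * (2 * n + 2) + 1 := by
    intro n
    induction n with
    | zero => simp [downFrom, sz_cons, sz_nil, sz_nat]
    | succ n ih =>
      have h1 : (n + 1).size ≤ n + 1 := Nat.size_le.2 Nat.lt_two_pow_self
      rw [downFrom_succ, sz_cons, sz_nat]
      nlinarith
  have h := foldl_of_bound (z := fun _ => [0]) (s := fun _ (g : List ℕ) _ => (g.headD 0 + 1) :: g)
    hf (const [0]) (((id.snd.fst.headD 0).add (const 1)).cons id.snd.fst)
    ⟨fun a => (sz (f a) + 1) * (2 * sz (f a) + 2) + 1,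
      ((hf.polyBdd.add (.const 1)).mul (((PolyBdd.const 2).mul hf.polyBdd).add (.const 2))).add
        (.const 1), fun a l hl => by
      have h1 := hl.length_le.trans (length_le_sz _)
      rw [key]
      refine (hsz _).trans ?_
      dsimp only
      gcongr⟩
  simpa only [key] using h

end PT

end TreeMachine


/-! ### The kernelization algorithm -/

namespace MaxCSPKernel

open TreeMachine Enc MaxCSP

/-- A constraint as read from the input: variables, truth table, weight. -/
abbrev Con := List ℕ × List Bool × ℕ

/-- A multiple of the product of some of the variables: the variables, the sign (`true` for a
negative coefficient) and the absolute value of the coefficient. -/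
abbrev Term := List ℕ × Bool × ℕ

def isParam : Ch → Bool
  | .inr _ => true
  | .inl _ => false

def isEnd : Ch → Bool
  | .inl .endMark => true
  | _ => false

def isBit : Ch → Bool
  | .inl (.bit _) => true
  | _ => false

def isVar : Ch → Bool
  | .inl .var => true
  | _ => false

def isTable : Ch → Bool
  | .inl .table => true
  | _ => false

/-- The bit that a symbol carries. -/
def bitOf : Ch → Bool
  | .inl (.bit b) => b
  | .inr b => b
  | _ => false

/-- The field that precedes any input. -/
def noField : Ch × List Bool := (.inl .endMark, [])

/-- Processing a symbol, when a word is read from right to left: the state holds the bit strings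
read so far, each with the symbol that introduces it, and the bits of the parameter. -/
def fieldStep (s : Ch) (x : List (Ch × List Bool) × List Bool) :
    List (Ch × List Bool) × List Bool :=
  bif isParam s then (x.1, bitOf s :: x.2)
  else bif isEnd s then ((s, []) :: x.1, x.2)
  else bif isBit s then (((x.1.headD noField).1, bitOf s :: (x.1.headD noField).2) :: x.1.tail, x.2)
  -- The number of variables is not recorded: a variable that occurs in no constraint does not
  -- affect the excess over the average.
  else bif isVar s then x
  -- Here `s` is `arg` or `table` and replaces the end marker as the label of its field. A weight
  -- has no symbol in front of it and keeps the end marker.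
  else ((s, (x.1.headD noField).2) :: x.1.tail, x.2)

/-- The constraint without variables. -/
def noCon : Con := ([], [], 0)

/-- Processing a bit string, when the list of fields is read from right to left. -/
def conStep (f : Ch × List Bool) (cs : List Con) : List Con :=
  -- The weight is the last field of a constraint, so from right to left it opens a new one.
  bif isEnd f.1 then ([], [], ofBits f.2) :: cs
  else bif isTable f.1 then ((cs.headD noCon).1, f.2, (cs.headD noCon).2.2) :: cs.tail
  else (ofBits f.2 :: (cs.headD noCon).1, (cs.headD noCon).2) :: cs.tail

/-- The fields of a word. -/
def fields (w : List Ch) : List (Ch × List Bool) × List Bool := w.foldr fieldStep ([], [])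

/-- The constraints of a word. -/
def parseCons (w : List Ch) : List Con := (fields w).1.foldr conStep []

/-- The parameter of a word. -/
def parseParam (w : List Ch) : ℕ := ofBits (fields w).2

/-- The Fourier expansion of a Boolean function of `a` variables, multiplied by `2 ^ a`: a list of
products of variables with their signs. -/
def walsh : ℕ → (List Bool → Bool) → List (List Bool × Bool)
  | 0, F => bif F [] then [([], false)] else []
  | a + 1, F =>
    -- With `χ` the sign of the first variable, twice `F` is `(1 + χ)` times its restriction to
    -- `false` plus `(1 - χ)` times its restriction to `true`. Equal products are not merged, so all
    -- coefficients are ±1.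
    (walsh a fun xs => F (false :: xs)).map (fun p => (false :: p.1, p.2)) ++
    (walsh a fun xs => F (false :: xs)).map (fun p => (true :: p.1, p.2)) ++
    (walsh a fun xs => F (true :: xs)).map (fun p => (false :: p.1, p.2)) ++
    (walsh a fun xs => F (true :: xs)).map (fun p => (true :: p.1, !p.2))

/-- All bit strings of length `n`. -/
def allBits : ℕ → List (List Bool)
  | 0 => [[]]
  | n + 1 => (allBits n).flatMap fun l => [false :: l, true :: l]

theorem mem_allBits (l : List Bool) : l ∈ allBits l.length := by
  induction l with
  | nil => simp [allBits]
  | cons b l ih =>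
    simp only [List.length_cons, allBits, List.mem_flatMap]
    exact ⟨l, ih, by cases b <;> simp⟩

/-- The possible shapes and truth tables of constraints on at most `r` variables. -/
def tableKeys (r : ℕ) : List (List Unit × List Bool) :=
  (List.range (r + 1)).flatMap fun a =>
    (allBits (2 ^ a)).map fun t => (List.replicate a (), t)

/-- The nonconstant part of `2 ^ r` times a constraint. -/
def nonconstantPart (r : ℕ) (x : List Unit × List Bool) : List (List Bool × Bool) :=
  -- The repetition raises the factor `2 ^ a` of `walsh` to `2 ^ r`, common to all arities.
  (List.replicate (2 ^ (r - x.1.length)) ()).flatMap fun _ =>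
    (walsh x.1.length fun xs => x.2.getD (ofBits xs) false).filter fun p => p.1.any id

/-- `nonconstantPart` for constraints on at most `r` variables. -/
def expansion (r : ℕ) (x : List Unit × List Bool) : List (List Bool × Bool) :=
  -- For fixed `r` there are finitely many keys, so this is a table lookup and runs in polynomial
  -- time by `PT.lookup`.
  if x ∈ tableKeys r then nonconstantPart r x else []

/-- The possible shapes and signs of terms of degree at most `r`. -/
def parityKeys (r : ℕ) : List (List Unit × Bool) :=
  (List.range (r + 1)).flatMap fun a => [(List.replicate a (), false), (List.replicate a (), true)]

/-- The truth table of the constraint that `a` variables have an even sum (an odd sum, if `s`). -/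
def parityTable (a : ℕ) (s : Bool) : List Bool :=
  (List.range (2 ^ a)).map fun i =>
    Bool.xor (decide (Even (∑ j : Fin a, (i.testBit j).toNat))) s

/-- `parityTable` for at most `r` variables. -/
def parityOf (r : ℕ) (x : List Unit × Bool) : List Bool :=
  if x ∈ parityKeys r then parityTable x.1.length x.2 else []

/-- The members of a list that are selected by a mask, in reverse order. -/
def select (mask : List Bool) (vs : List ℕ) : List ℕ :=
  (mask.foldl (fun (x : List ℕ × List ℕ) b =>
    (x.1.tail, bif b then x.1.headD 0 :: x.2 else x.2)) (vs, [])).2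

/-- The terms of a list of constraints. -/
def terms (r : ℕ) (cs : List Con) : List Term :=
  cs.flatMap fun c => (expansion r (c.1.map fun _ => (), c.2.1)).map fun p =>
    (select p.1 c.1, p.2, c.2.2)

def subsetB (S T : List ℕ) : Bool := S.all fun v => T.any fun u => decide (u = v)

/-- Do two lists have the same members? -/
def sameSet (S T : List ℕ) : Bool := subsetB S T && subsetB T S

/-- Representatives of the sets of variables that occur in terms. -/
def supports (ts : List Term) : List (List ℕ) :=
  ts.foldr (fun t acc => bif acc.any (fun S => sameSet S t.1) then acc else t.1 :: acc) []

/-- The total weight of the terms with a given set of variables and a given sign. -/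
def weightOf (ts : List Term) (S : List ℕ) (s : Bool) : ℕ :=
  ((ts.filter fun t => sameSet t.1 S && (t.2.1 == s)).map fun t => t.2.2).sum

/-- The collected term for a set of variables, if its coefficient is nonzero and belongs to `U`. -/
def collect (U : List ℕ) (ts : List Term) (S : List ℕ) : List Term :=
  -- Instead of being obtained by subtraction, the absolute value of the coefficient is searched for
  -- in `U` as the solution of an addition.
  ((U.filter fun c => !decide (c = 0) && decide (weightOf ts S true + c = weightOf ts S false)).map
    fun c => (S, false, c)) ++
  ((U.filter fun c => !decide (c = 0) && decide (weightOf ts S false + c = weightOf ts S true)).map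
    fun c => (S, true, c))

/-- Does the absolute value of the coefficient belong to `U`? -/
def isSmall (U : List ℕ) (ts : List Term) (S : List ℕ) : Bool :=
  U.any fun c => decide (weightOf ts S true + c = weightOf ts S false) ||
    decide (weightOf ts S false + c = weightOf ts S true)

/-- The variables that occur in a list of terms, without repetition. -/
def variablesOf (L : List Term) : List ℕ :=
  (L.flatMap fun t => t.1).foldr
    (fun v acc => bif acc.any (fun u => decide (u = v)) then acc else v :: acc) []

/-- The number of members of the list after `v`. -/
def indexOf (W : List ℕ) (v : ℕ) : ℕ :=
  (W.foldl (fun (x : Bool × ℕ) w => (x.1 || decide (w = v), bif x.1 then x.2 + 1 else x.2))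
    (false, 0)).2

/-- A number with an end marker. -/
def numWord (n : ℕ) : List Ch := n.bits.map (fun b => .inl (.bit b)) ++ [.inl .endMark]

/-- The word of the parity constraint for a term. -/
def conWord (r : ℕ) (W : List ℕ) (t : Term) : List Ch :=
  (t.1.flatMap fun v => (.inl .arg : Ch) :: numWord (indexOf W v)) ++
    .inl .table :: (((parityOf r (t.1.map fun _ => (), t.2.1)).map fun b => .inl (.bit b)) ++
      .inl .endMark :: numWord (t.2.2 + t.2.2))

/-- The word of the instance whose constraints are the parity constraints for some terms. -/
def instWord (r : ℕ) (L : List Term) (k : ℕ) : List Ch :=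
  ((variablesOf L).map fun _ => (.inl .var : Ch)) ++
    ((L.flatMap fun t => conWord r (variablesOf L) t) ++ (2 ^ r * k).bits.map fun b => .inr b)

/-- Look for `k` among the numbers in `D`; if it is found, the second component has `k` members. -/
def unary (D : List ℕ) (k : ℕ) : Bool × List ℕ :=
  -- Applied to a descending list, the fold counts upwards from 0 and collects the numbers below
  -- `k`. This converts the binary `k` to unary.
  D.foldr (fun j (x : Bool × List ℕ) => bif x.1 then x else
    bif decide (j = k) then (true, x.2) else (false, j :: x.2)) (false, [])

/-- The constant in the bound for the number of terms. -/
def bigC (r : ℕ) : ℕ := 4 * 36 ^ r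

/-- A list of length `bigC r * K.length ^ 2`. -/
def budget (r : ℕ) (K : List ℕ) : List Unit :=
  K.flatMap fun _ => K.flatMap fun _ => List.replicate (bigC r) ()

/-- The collected terms. -/
def collected (U : List ℕ) (ts : List Term) : List Term :=
  (supports ts).flatMap fun S => collect U ts S

/-- The kernelization for a parameter `k` that is smaller than the length of the input. The word
for an evident yes-instance is empty. -/
def reduceWith (r : ℕ) (ts : List Term) (k : ℕ) (U : List ℕ) : List Ch :=
  bif ((supports ts).all fun S => isSmall U ts S) &&
      U.any fun c => decide (c = (collected U ts).length) then
    instWord r (collected U ts) k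
  else []

/-- The kernelization, as a map of words. -/
def kernelWord (r : ℕ) (w : List Ch) : List Ch :=
  -- The range `0, …, M` is listed explicitly, which is affordable only if `k` is at most the length
  -- of the input.
  bif (unary (PT.downFrom w.length) (parseParam w)).1 then
    reduceWith r (terms r (parseCons w)) (parseParam w)
      (PT.downFrom (budget r (unary (PT.downFrom w.length) (parseParam w)).2).length)
  else w

/-! ### The algorithm runs in polynomial time -/

section PolyTime

variable {α : Type} [Enc α]

instance : Inhabited Ch := ⟨.inr false⟩

theorem PT_fields {f : α → List Ch} (hf : PT f) : PT fun a => fields (f a) := by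
  have hh : PT fun p : α × Ch × (List (Ch × List Bool) × List Bool) => p.2.2.1.headD noField :=
    PT.id.snd.snd.fst.headD noField
  refine PT.foldr (z := fun _ => (([], []) : List (Ch × List Bool) × List Bool))
    (s := fun _ s x => fieldStep s x) hf (.const _) ?_ (PolyBdd.const 10) ?_
  · refine (PT.id.snd.fst.chTest isParam).cond
      (PT.id.snd.snd.fst.pair ((PT.id.snd.fst.chTest bitOf).cons PT.id.snd.snd.snd)) ?_
    refine (PT.id.snd.fst.chTest isEnd).cond
      (((PT.id.snd.fst.pair (.const [])).cons PT.id.snd.snd.fst).pair PT.id.snd.snd.snd) ?_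
    refine (PT.id.snd.fst.chTest isBit).cond
      (((hh.fst.pair ((PT.id.snd.fst.chTest bitOf).cons hh.snd)).cons PT.id.snd.snd.fst.tail).pair
        PT.id.snd.snd.snd) ?_
    exact (PT.id.snd.fst.chTest isVar).cond PT.id.snd.snd
      (((PT.id.snd.fst.pair hh.snd).cons PT.id.snd.snd.fst.tail).pair PT.id.snd.snd.snd)
  · intro a x s _
    have h1 := sz_headD_add_tail_le x.1 noField
    have h2 : sz noField = 3 := rfl
    rw [sz_pair (x.1.headD noField), h2, sz_ch] at h1
    have hx := sz_pair x
    unfold fieldStep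
    cases isParam s
    · cases isEnd s
      · cases isBit s
        · cases isVar s
          · simp only [cond_false, sz_pair, sz_cons, sz_ch]
            omega
          · simp
        · simp only [cond_false, cond_true, sz_pair, sz_cons, sz_ch, sz_bool]
          omega
      · simp only [cond_false, cond_true, sz_pair, sz_cons, sz_ch, sz_nil]
        omega
    · simp only [cond_true, sz_pair, sz_cons, sz_bool]
      omega

theorem sz_ofBits_le (l : List Bool) : sz (ofBits l) ≤ sz l := by
  have h : ∀ l : List Bool, (trim l).length ≤ l.length := by
    intro l
    induction l with
    | nil => simp [trim]
    | cons b l ih =>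
      have h2 : trim (b :: l) = bif !b && (trim l).isEmpty then [] else b :: trim l := rfl
      rw [h2]
      cases (!b && (trim l).isEmpty) <;> simp [ih]
  rw [sz_nat, ← Nat.size_eq_bits_len, bits_ofBits, sz_bits]
  have := h l
  omega

theorem PT_parseCons {f : α → List Ch} (hf : PT f) : PT fun a => parseCons (f a) := by
  have hh : PT fun p : α × (Ch × List Bool) × List Con => p.2.2.headD noCon :=
    PT.id.snd.snd.headD noCon
  refine PT.foldr (f := fun a => (fields (f a)).1) (z := fun _ => ([] : List Con))
    (s := fun _ s x => conStep s x) (PT_fields hf).fst (.const _) ?_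
    ((PT_fields hf).fst.polyBdd.add (.const 20)) ?_
  · refine (PT.id.snd.fst.fst.chTest isEnd).cond
      (((PT.const []).pair ((PT.const []).pair PT.id.snd.fst.snd.ofBits)).cons PT.id.snd.snd) ?_
    exact (PT.id.snd.fst.fst.chTest isTable).cond
      ((hh.fst.pair (PT.id.snd.fst.snd.pair hh.snd.snd)).cons PT.id.snd.snd.tail)
      (((PT.id.snd.fst.snd.ofBits.cons hh.fst).pair hh.snd).cons PT.id.snd.snd.tail)
  · intro a x s hs
    have h1 := sz_headD_add_tail_le x noCon
    have h2 : sz noCon = 5 := rfl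
    rw [sz_pair (x.headD noCon), sz_pair (x.headD noCon).2, h2] at h1
    have h3 := sz_ofBits_le s.2
    have h4 := sz_le_of_mem hs
    rw [sz_pair s] at h4
    unfold conStep
    cases isEnd s.1
    · cases isTable s.1
      · simp only [cond_false, sz_pair, sz_cons]
        omega
      · simp only [cond_false, cond_true, sz_pair, sz_cons]
        omega
    · simp only [cond_true, sz_pair, sz_cons, sz_nil]
      omega

theorem PT_parseParam {f : α → List Ch} (hf : PT f) : PT fun a => parseParam (f a) :=
  (PT_fields hf).snd.ofBits

theorem PT_select {f : α → List Bool} {g : α → List ℕ} (hf : PT f) (hg : PT g) :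
    PT fun a => select (f a) (g a) := by
  have h := PT.foldl (f := f) (z := fun a => (g a, ([] : List ℕ)))
    (s := fun _ x b => (x.1.tail, bif b then x.1.headD 0 :: x.2 else x.2)) hf (hg.pair (.const []))
    (PT.id.snd.fst.fst.tail.pair (PT.id.snd.snd.cond
      ((PT.id.snd.fst.fst.headD 0).cons PT.id.snd.fst.snd) PT.id.snd.fst.snd)) (PolyBdd.const 2)
    (fun a x b _ => by
      have h1 := sz_headD_add_tail_le x.1 0
      have h2 : sz (0 : ℕ) = 1 := rfl
      rw [sz_pair x]
      cases b
      · have h3 := sz_tail_le x.1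
        simp only [cond_false, sz_pair]
        omega
      · simp only [cond_true, sz_pair, sz_cons]
        omega)
  exact h.snd

theorem PT_terms (r : ℕ) {f : α → List Con} (hf : PT f) : PT fun a => terms r (f a) := by
  refine hf.flatMap (g := fun _ c => (expansion r (c.1.map fun _ => (), c.2.1)).map fun p =>
    (select p.1 c.1, p.2, c.2.2)) ?_
  have h : PT fun p : α × Con => expansion r (p.2.1.map (fun _ => ()), p.2.2.1) :=
    PT.congr_enc (PT.lookup
      ((PT.id.snd.fst.map (g := fun _ _ => ()) (.const ())).pair PT.id.snd.snd.fst)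
      (tableKeys r) (nonconstantPart r) []) fun a => by unfold expansion; congr
  exact h.map (g := fun (x : α × Con) (p : List Bool × Bool) => (select p.1 x.2.1, p.2, x.2.2.2))
    ((PT_select PT.id.snd.fst PT.id.fst.snd.fst).pair
    (PT.id.snd.snd.pair PT.id.fst.snd.snd.snd))

theorem PT_subsetB {f g : α → List ℕ} (hf : PT f) (hg : PT g) : PT fun a => subsetB (f a) (g a) :=
  hf.all (g := fun a v => (g a).any fun u => decide (u = v))
    ((hg.comp PT.id.fst).any (g := fun (p : α × ℕ) u => decide (u = p.2))
      (PT.id.snd.natEq PT.id.fst.snd))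

theorem PT_sameSet {f g : α → List ℕ} (hf : PT f) (hg : PT g) : PT fun a => sameSet (f a) (g a) :=
  (PT_subsetB hf hg).and (PT_subsetB hg hf)

theorem PT_supports {f : α → List Term} (hf : PT f) : PT fun a => supports (f a) := by
  refine PT.foldr (z := fun _ => ([] : List (List ℕ))) (s := fun _ (t : Term) acc =>
    bif acc.any (fun S => sameSet S t.1) then acc else t.1 :: acc) hf (.const _)
    ((PT.id.snd.snd.any (g := fun (p : α × Term × List (List ℕ)) S => sameSet S p.2.1.1)
      (PT_sameSet PT.id.snd PT.id.fst.snd.fst.fst)).cond PT.id.snd.snd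
      (PT.id.snd.fst.fst.cons PT.id.snd.snd)) hf.polyBdd ?_
  intro a acc t ht
  have h1 := sz_le_of_mem ht
  have h2 := sz_pos t.2
  rw [sz_pair t] at h1
  cases acc.any (fun S => sameSet S t.1)
  · simp only [cond_false, sz_cons]
    omega
  · simp only [cond_true]
    omega

theorem PT_weightOf {f : α → List Term} {g : α → List ℕ} (hf : PT f) (hg : PT g) (s : Bool) :
    PT fun a => weightOf (f a) (g a) s :=
  ((hf.filter (g := fun a (t : Term) => sameSet t.1 (g a) && (t.2.1 == s))
    ((PT_sameSet PT.id.snd.fst (hg.comp PT.id.fst)).and (PT.id.snd.snd.fst.beq (.const s)))).map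
    (g := fun _ (t : Term) => t.2.2) PT.id.snd.snd.snd).sum

theorem PT_collect {u : α → List ℕ} {f : α → List Term} {g : α → List ℕ} (hu : PT u) (hf : PT f)
    (hg : PT g) : PT fun a => collect (u a) (f a) (g a) := by
  have h : ∀ s, PT fun p : α × ℕ => weightOf (f p.1) (g p.1) s := fun s =>
    (PT_weightOf hf hg s).comp PT.id.fst
  refine PT.append (PT.map (f := fun a => (u a).filter fun c => !decide (c = 0) &&
      decide (weightOf (f a) (g a) true + c = weightOf (f a) (g a) false))
      (g := fun a (c : ℕ) => (g a, false, c)) ?_ ?_)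
    (PT.map (f := fun a => (u a).filter fun c => !decide (c = 0) &&
      decide (weightOf (f a) (g a) false + c = weightOf (f a) (g a) true))
      (g := fun a (c : ℕ) => (g a, true, c)) ?_ ?_)
  · exact hu.filter (g := fun a c => !decide (c = 0) &&
      decide (weightOf (f a) (g a) true + c = weightOf (f a) (g a) false))
      ((PT.id.snd.natEq (.const 0)).not.and (((h true).add PT.id.snd).natEq (h false)))
  · exact (hg.comp PT.id.fst).pair ((PT.const false).pair PT.id.snd)
  · exact hu.filter (g := fun a c => !decide (c = 0) &&
      decide (weightOf (f a) (g a) false + c = weightOf (f a) (g a) true))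
      ((PT.id.snd.natEq (.const 0)).not.and (((h false).add PT.id.snd).natEq (h true)))
  · exact (hg.comp PT.id.fst).pair ((PT.const true).pair PT.id.snd)

theorem PT_isSmall {u : α → List ℕ} {f : α → List Term} {g : α → List ℕ} (hu : PT u) (hf : PT f)
    (hg : PT g) : PT fun a => isSmall (u a) (f a) (g a) := by
  have h : ∀ s, PT fun p : α × ℕ => weightOf (f p.1) (g p.1) s := fun s =>
    (PT_weightOf hf hg s).comp PT.id.fst
  exact hu.any (g := fun a c => decide (weightOf (f a) (g a) true + c = weightOf (f a) (g a) false)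
    || decide (weightOf (f a) (g a) false + c = weightOf (f a) (g a) true))
    ((((h true).add PT.id.snd).natEq (h false)).or (((h false).add PT.id.snd).natEq (h true)))

theorem PT_variablesOf {f : α → List Term} (hf : PT f) : PT fun a => variablesOf (f a) := by
  have h : PT fun a => (f a).flatMap fun t => t.1 :=
    hf.flatMap (g := fun _ (t : Term) => t.1) PT.id.snd.fst
  refine PT.foldr (z := fun _ => ([] : List ℕ)) (s := fun _ v acc =>
    bif acc.any (fun u => decide (u = v)) then acc else v :: acc) h (.const _)
    ((PT.id.snd.snd.any (g := fun (p : α × ℕ × List ℕ) u => decide (u = p.2.1))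
      (PT.id.snd.natEq PT.id.fst.snd.fst)).cond PT.id.snd.snd
      (PT.id.snd.fst.cons PT.id.snd.snd)) (h.polyBdd.add (.const 1)) ?_
  intro a acc v hv
  have h1 := sz_le_of_mem hv
  cases acc.any (fun u => decide (u = v))
  · simp only [cond_false, sz_cons]
    omega
  · simp only [cond_true]
    omega

theorem PT_indexOf {f : α → List ℕ} {g : α → ℕ} (hf : PT f) (hg : PT g) :
    PT fun a => indexOf (f a) (g a) := by
  have h := PT.foldl (f := f) (z := fun _ => (false, 0)) (s := fun a (x : Bool × ℕ) w =>
    (x.1 || decide (w = g a), bif x.1 then x.2 + 1 else x.2)) hf (.const _)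
    ((PT.id.snd.fst.fst.or (PT.id.snd.snd.natEq (hg.comp PT.id.fst))).pair
      (PT.id.snd.fst.fst.cond (PT.id.snd.fst.snd.add (.const 1)) PT.id.snd.fst.snd))
    (PolyBdd.const 4) (fun a x w _ => by
      have h1 := sz_nat_add_le x.2 1
      have h2 : sz (1 : ℕ) = 3 := rfl
      rw [sz_pair x]
      cases x.1
      · simp only [cond_false, sz_pair, sz_bool]
        omega
      · simp only [cond_true, sz_pair, sz_bool]
        omega)
  exact h.snd

theorem PT_bitsWord {f : α → List Bool} (hf : PT f) :
    PT fun a => (f a).map fun b => (.inl (.bit b) : Ch) := by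
  refine hf.map (g := fun _ b => (.inl (.bit b) : Ch)) ?_
  refine PT.congr_enc (PT.id.snd.cond (.const (.inl (.bit true) : Ch)) (.const (.inl (.bit false))))
    fun a => ?_
  cases a.2 <;> rfl

theorem PT_paramWord {f : α → List Bool} (hf : PT f) :
    PT fun a => (f a).map fun b => (.inr b : Ch) :=
  hf.map (g := fun _ b => (.inr b : Ch)) (PT.congr_enc PT.id.snd fun _ => rfl)

theorem PT_numWord {f : α → ℕ} (hf : PT f) : PT fun a => numWord (f a) :=
  (PT_bitsWord hf.bits).append (.const _)

theorem PT_conWord (r : ℕ) {f : α → List ℕ} {g : α → Term} (hf : PT f) (hg : PT g) :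
    PT fun a => conWord r (f a) (g a) := by
  refine PT.append ?_ ((PT.const _).cons (PT.append ?_ ((PT.const _).cons
    (PT_numWord (hg.snd.snd.add hg.snd.snd)))))
  · exact hg.fst.flatMap (g := fun a v => (.inl .arg : Ch) :: numWord (indexOf (f a) v))
      ((PT.const _).cons (PT_numWord (PT_indexOf (hf.comp PT.id.fst) PT.id.snd)))
  · exact PT_bitsWord (PT.congr_enc (PT.lookup ((hg.fst.map (g := fun _ _ => ()) (.const ())).pair hg.snd.fst)
      (parityKeys r) (fun x => parityTable x.1.length x.2) []) fun a => by unfold parityOf; congr)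

/-- Repeated doubling; `r` is a constant. -/
theorem PT_two_pow_mul (r : ℕ) {f : α → ℕ} (hf : PT f) : PT fun a => 2 ^ r * f a := by
  induction r with
  | zero => simpa using hf
  | succ r ih =>
    have : (fun a => 2 ^ (r + 1) * f a) = fun a => 2 ^ r * f a + 2 ^ r * f a := by
      funext a
      ring
    rw [this]
    exact ih.add ih

theorem PT_instWord (r : ℕ) {f : α → List Term} {g : α → ℕ} (hf : PT f) (hg : PT g) :
    PT fun a => instWord r (f a) (g a) :=
  ((PT_variablesOf hf).map (g := fun _ _ => (.inl .var : Ch)) (.const _)).append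
    ((hf.flatMap (g := fun a t => conWord r (variablesOf (f a)) t)
      (PT_conWord r ((PT_variablesOf hf).comp PT.id.fst) PT.id.snd)).append
      (PT_paramWord (PT_two_pow_mul r hg).bits))

theorem PT_unary {f : α → List ℕ} {g : α → ℕ} (hf : PT f) (hg : PT g) :
    PT fun a => unary (f a) (g a) := by
  refine PT.foldr (z := fun _ => ((false, []) : Bool × List ℕ)) (s := fun a j (x : Bool × List ℕ) =>
    bif x.1 then x else bif decide (j = g a) then (true, x.2) else (false, j :: x.2)) hf (.const _)
    (PT.id.snd.snd.fst.cond PT.id.snd.snd ((PT.id.snd.fst.natEq (hg.comp PT.id.fst)).cond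
      ((PT.const true).pair PT.id.snd.snd.snd)
      ((PT.const false).pair (PT.id.snd.fst.cons PT.id.snd.snd.snd))))
    (hf.polyBdd.add (.const 1)) ?_
  intro a x j hj
  have h1 := sz_le_of_mem hj
  have h2 := sz_pair x
  rw [sz_bool] at h2
  cases x.1
  · cases decide (j = g a)
    · simp only [cond_false, sz_pair, sz_bool, sz_cons]
      omega
    · simp only [cond_true, cond_false, sz_pair, sz_bool]
      omega
  · simp only [cond_true]
    omega

theorem PT_budget (r : ℕ) {f : α → List ℕ} (hf : PT f) : PT fun a => budget r (f a) :=
  hf.flatMap (g := fun a _ => (f a).flatMap fun _ => List.replicate (bigC r) ())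
    ((hf.comp PT.id.fst).flatMap (g := fun _ _ => List.replicate (bigC r) ()) (.const _))

theorem PT_reduceWith (r : ℕ) {f : α → List Term} {g : α → ℕ} {u : α → List ℕ} (hf : PT f)
    (hg : PT g) (hu : PT u) : PT fun a => reduceWith r (f a) (g a) (u a) := by
  have hc : PT fun a => collected (u a) (f a) :=
    (PT_supports hf).flatMap (g := fun a S => collect (u a) (f a) S)
      (PT_collect (hu.comp PT.id.fst) (hf.comp PT.id.fst) PT.id.snd)
  exact (((PT_supports hf).all (g := fun a S => isSmall (u a) (f a) S)
    (PT_isSmall (hu.comp PT.id.fst) (hf.comp PT.id.fst) PT.id.snd)).and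
    (hu.any (g := fun a c => decide (c = (collected (u a) (f a)).length))
      (PT.id.snd.natEq (hc.length.comp PT.id.fst)))).cond (PT_instWord r hc hg) (.const [])

theorem PT_kernelWord (r : ℕ) : PT (kernelWord r) := by
  have hu : PT fun w : List Ch => unary (PT.downFrom w.length) (parseParam w) :=
    PT_unary (PT.downFrom_length PT.id) (PT_parseParam PT.id)
  exact hu.fst.cond (PT_reduceWith r (PT_terms r (PT_parseCons PT.id)) (PT_parseParam PT.id)
    (PT.downFrom_length (PT_budget r hu.snd))) PT.id

end PolyTime

end MaxCSPKernel


/-! ### Moments of multilinear polynomials of bounded degree on the cube -/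

namespace BooleanCube

/-- The sign of a bit. -/
def sgn (b : Bool) : ℝ := bif b then -1 else 1

/-- The mean of a function on the cube. -/
noncomputable def mean {n : ℕ} (f : (Fin n → Bool) → ℝ) : ℝ := (∑ x, f x) / 2 ^ n

theorem mean_add {n : ℕ} (f g : (Fin n → Bool) → ℝ) :
    mean (fun x => f x + g x) = mean f + mean g := by
  simp only [mean, Finset.sum_add_distrib, add_div]

theorem mean_const_mul {n : ℕ} (c : ℝ) (f : (Fin n → Bool) → ℝ) :
    mean (fun x => c * f x) = c * mean f := by
  simp only [mean, ← Finset.mul_sum, mul_div_assoc]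

theorem mean_sum {n : ℕ} {ι : Type*} (s : Finset ι) (f : ι → (Fin n → Bool) → ℝ) :
    mean (fun x => ∑ i ∈ s, f i x) = ∑ i ∈ s, mean (f i) := by
  simp only [mean]
  rw [Finset.sum_comm, Finset.sum_div]

theorem mean_mono {n : ℕ} {f g : (Fin n → Bool) → ℝ} (h : ∀ x, f x ≤ g x) : mean f ≤ mean g := by
  unfold mean
  gcongr with x
  exact h x

theorem mean_nonneg {n : ℕ} {f : (Fin n → Bool) → ℝ} (h : ∀ x, 0 ≤ f x) : 0 ≤ mean f :=
  div_nonneg (Finset.sum_nonneg fun x _ => h x) (by positivity)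

theorem mean_const {n : ℕ} (c : ℝ) : mean (fun _ : Fin n → Bool => c) = c := by
  simp [mean]

theorem mean_lt {n : ℕ} {f : (Fin n → Bool) → ℝ} {c : ℝ} (h : ∀ x, f x < c) : mean f < c := by
  have : mean f < mean (fun _ : Fin n → Bool => c) := by
    unfold mean
    gcongr with x
    · exact ⟨fun _ => false, Finset.mem_univ _⟩
    · exact h x
  rwa [mean_const] at this

/-- Averaging over the first coordinate, the induction step for moments. -/
theorem mean_succ {n : ℕ} (f : (Fin (n + 1) → Bool) → ℝ) :
    mean f = (mean (fun x => f (Fin.cons false x)) + mean (fun x => f (Fin.cons true x))) / 2 := by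
  unfold mean
  rw [← (Fin.consEquiv fun _ => Bool).sum_comp f, Fintype.sum_prod_type, Fintype.sum_bool]
  have e : ∀ b y, (Fin.consEquiv fun _ : Fin (n + 1) => Bool) (b, y) = Fin.cons b y :=
    fun _ _ => rfl
  simp only [e, pow_succ]
  field_simp
  ring

theorem mean_mul_sq_le {n : ℕ} (f g : (Fin n → Bool) → ℝ) :
    mean (fun x => f x * g x) ^ 2 ≤ mean (fun x => f x ^ 2) * mean (fun x => g x ^ 2) := by
  unfold mean
  rw [div_pow, div_mul_div_comm, ← pow_two]
  gcongr
  exact Finset.sum_mul_sq_le_sq_mul_sq _ _ _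

/-- Multilinear polynomials of degree at most `r`. -/
def DegLE : (n : ℕ) → ℕ → ((Fin n → Bool) → ℝ) → Prop
  | 0, _, _ => True
  | n + 1, r, f => ∃ P Q : (Fin n → Bool) → ℝ,
      (∀ b x, f (Fin.cons b x) = Q x + sgn b * P x) ∧ DegLE n r Q ∧
      -- The coefficient of the first variable has degree at most `r - 1`; for `r = 0` it must
      -- vanish.
      (P = 0 ∨ ∃ d, r = d + 1 ∧ DegLE n d P)

theorem degLE_zero (n r : ℕ) : DegLE n r 0 := by
  induction n with
  | zero => trivial
  | succ n ih => exact ⟨0, 0, by simp, ih, Or.inl rfl⟩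

theorem DegLE.add {n r : ℕ} {f g : (Fin n → Bool) → ℝ} (hf : DegLE n r f) (hg : DegLE n r g) :
    DegLE n r (f + g) := by
  induction n generalizing r with
  | zero => trivial
  | succ n ih =>
    obtain ⟨P, Q, h, hQ, hP⟩ := hf
    obtain ⟨P', Q', h', hQ', hP'⟩ := hg
    refine ⟨P + P', Q + Q', fun b x => ?_, ih hQ hQ', ?_⟩
    · simp only [Pi.add_apply, h, h']
      ring
    · rcases hP with rfl | ⟨d, rfl, hP⟩
      · rw [zero_add]
        exact hP'
      · rcases hP' with rfl | ⟨d', hd, hP'⟩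
        · rw [add_zero]
          exact Or.inr ⟨d, rfl, hP⟩
        · obtain rfl : d = d' := by omega
          exact Or.inr ⟨d, rfl, ih hP hP'⟩

theorem DegLE.const_mul {n r : ℕ} {f : (Fin n → Bool) → ℝ} (c : ℝ) (hf : DegLE n r f) :
    DegLE n r (fun x => c * f x) := by
  induction n generalizing r with
  | zero => trivial
  | succ n ih =>
    obtain ⟨P, Q, h, hQ, hP⟩ := hf
    refine ⟨fun x => c * P x, fun x => c * Q x, fun b x => ?_, ih hQ, ?_⟩
    · simp only [h]
      ring
    · rcases hP with rfl | ⟨d, rfl, hP⟩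
      · exact Or.inl (by funext x; simp)
      · exact Or.inr ⟨d, rfl, ih hP⟩

theorem DegLE.sum {n r : ℕ} {ι : Type*} (s : Finset ι) {f : ι → (Fin n → Bool) → ℝ}
    (hf : ∀ i ∈ s, DegLE n r (f i)) : DegLE n r (fun x => ∑ i ∈ s, f i x) := by
  classical
  induction s using Finset.induction_on with
  | empty =>
    simp only [Finset.sum_empty]
    exact degLE_zero n r
  | insert i s hi ih =>
    simp only [Finset.sum_insert hi]
    exact (hf i (Finset.mem_insert_self i s)).add
      (ih fun j hj => hf j (Finset.mem_insert_of_mem hj))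

/-- The fourth moment of a polynomial of degree at most `r` is at most `9 ^ r` times the square of
its second moment. -/
theorem DegLE.mean_pow_four_le {n r : ℕ} {f : (Fin n → Bool) → ℝ} (hf : DegLE n r f) :
    mean (fun x => f x ^ 4) ≤ 9 ^ r * mean (fun x => f x ^ 2) ^ 2 := by
  induction n generalizing r with
  | zero =>
    -- On the cube with a single point, the fourth moment equals the square of the second.
    have h1 : (1 : ℝ) ≤ 9 ^ r := one_le_pow₀ (by norm_num)
    have h2 : 0 ≤ f default ^ 4 := by positivity
    simp only [mean, Finset.univ_unique, Finset.sum_singleton, pow_zero, div_one]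
    nlinarith
  | succ n ih =>
    obtain ⟨P, Q, h, hQ, hP⟩ := hf
    -- Averaging `(Q ± P) ^ 4` over the sign removes the odd powers of `P`.
    have h4 : mean (fun x => f x ^ 4) =
        mean (fun x => Q x ^ 4) + 6 * mean (fun x => P x ^ 2 * Q x ^ 2) +
          mean (fun x => P x ^ 4) := by
      rw [mean_succ, ← mean_add, ← mean_const_mul, ← mean_add, ← mean_add, div_eq_inv_mul,
        ← mean_const_mul]
      congr 1
      funext x
      simp only [h, sgn, cond_false, cond_true]
      ring
    have h2 : mean (fun x => f x ^ 2) = mean (fun x => Q x ^ 2) + mean (fun x => P x ^ 2) := by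
      rw [mean_succ, ← mean_add, ← mean_add, div_eq_inv_mul, ← mean_const_mul]
      congr 1
      funext x
      simp only [h, sgn, cond_false, cond_true]
      ring
    have hq := ih hQ
    have hq0 : 0 ≤ mean (fun x => Q x ^ 2) := mean_nonneg fun x => by positivity
    have hp0 : 0 ≤ mean (fun x => P x ^ 2) := mean_nonneg fun x => by positivity
    rw [h4, h2]
    rcases hP with rfl | ⟨d, rfl, hP⟩
    · simpa [mean_const] using hq
    · have hp := ih hP
      have hc := mean_mul_sq_le (fun x => P x ^ 2) (fun x => Q x ^ 2)
      simp only [← pow_mul, Nat.reduceMul] at hc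
      set p := mean (fun x => P x ^ 2)
      set q := mean (fun x => Q x ^ 2)
      have h9 : (0 : ℝ) < 9 ^ d := by positivity
      -- Cauchy–Schwarz with the constants `9 ^ d` for `P` and `9 ^ (d + 1)` for `Q`. The cross term
      -- then has the coefficient `6 * 3 * 9 ^ d = 2 * 9 ^ (d + 1)`, just what the square of `p + q`
      -- allows.
      have hpq : mean (fun x => P x ^ 2 * Q x ^ 2) ≤ 3 * 9 ^ d * (p * q) := by
        refine abs_le_of_sq_le_sq' ?_ (by positivity) |>.2
        calc _ ≤ _ := hc
          _ ≤ (9 ^ d * p ^ 2) * (9 ^ (d + 1) * q ^ 2) := by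
            gcongr
            exact mean_nonneg fun x => by positivity
          _ = (3 * 9 ^ d * (p * q)) ^ 2 := by ring
      rw [pow_succ] at hq ⊢
      have : 0 ≤ 9 ^ d * p ^ 2 := by positivity
      nlinarith

/-- The product of the signs of the bits selected by `m`. -/
noncomputable def chi {n : ℕ} (m x : Fin n → Bool) : ℝ := ∏ i, bif m i then sgn (x i) else 1

theorem degLE_chi {n r : ℕ} (m : Fin n → Bool) (hm : ∑ i, (m i).toNat ≤ r) :
    DegLE n r (chi m) := by
  induction n generalizing r with
  | zero => trivial
  | succ n ih =>
    rw [Fin.sum_univ_succ] at hm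
    have hc : ∀ b x, chi m (Fin.cons b x) =
        (bif m 0 then sgn b else 1) * chi (fun i => m i.succ) x := by
      intro b x
      simp only [chi]
      rw [Fin.prod_univ_succ]
      simp
    cases h0 : m 0 with
    | false =>
      refine ⟨0, chi (fun i => m i.succ), fun b x => by simp [hc, h0], ih _ ?_, Or.inl rfl⟩
      exact le_trans le_add_self hm
    | true =>
      rw [h0, Bool.toNat_true] at hm
      obtain ⟨d, rfl⟩ : ∃ d, r = d + 1 := ⟨r - 1, by omega⟩
      exact ⟨chi (fun i => m i.succ), 0, fun b x => by simp [hc, h0], degLE_zero n _,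
        Or.inr ⟨d, rfl, ih _ (by omega)⟩⟩

/-- Independence of the coordinates. -/
theorem mean_prod {n : ℕ} (g : Fin n → Bool → ℝ) :
    mean (fun x => ∏ i, g i (x i)) = ∏ i, ((g i false + g i true) / 2) := by
  unfold mean
  have h := Finset.prod_univ_sum (fun _ : Fin n => (Finset.univ : Finset Bool)) g
  rw [Fintype.piFinset_univ] at h
  rw [← h, Finset.prod_div_distrib]
  simp [add_comm]

/-- Orthonormality of the characters: a coordinate selected by only one of the masks contributes a
factor with mean zero. -/
theorem mean_chi_mul_chi {n : ℕ} (m m' : Fin n → Bool) :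
    mean (fun x => chi m x * chi m' x) = if m = m' then 1 else 0 := by
  have h : (fun x => chi m x * chi m' x) = fun x => ∏ i,
      (bif m i then sgn (x i) else 1) * (bif m' i then sgn (x i) else 1) := by
    funext x
    rw [chi, chi, ← Finset.prod_mul_distrib]
  rw [h, mean_prod fun i b => (bif m i then sgn b else 1) * (bif m' i then sgn b else 1)]
  split_ifs with hm
  · subst hm
    refine Finset.prod_eq_one fun i _ => ?_
    cases m i <;> norm_num [sgn]
  · obtain ⟨i, hi⟩ := Function.ne_iff.1 hm
    refine Finset.prod_eq_zero (Finset.mem_univ i) ?_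
    cases h1 : m i <;> cases h2 : m' i <;> simp_all [sgn]

theorem mean_chi {n : ℕ} {m : Fin n → Bool} (hm : ∃ i, m i = true) : mean (chi m) = 0 := by
  have h := mean_chi_mul_chi m (fun _ => false)
  rw [if_neg] at h
  · rw [← h]
    congr 1
    funext x
    simp [chi]
  · rintro rfl
    simp at hm

/-- A polynomial of degree at most `r` without constant term all of whose values are less than `K`
has a small variance. -/
theorem sum_sq_lt_of_forall_lt {n r : ℕ} {ι : Type*} [Fintype ι] (a : ι → ℝ)
    (m : ι → Fin n → Bool) (hm : Function.Injective m) (hdeg : ∀ i, ∑ j, (m i j).toNat ≤ r)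
    (hne : ∀ i, ∃ j, m i j = true) {K : ℝ} (hK : ∀ x, ∑ i, a i * chi (m i) x < K) :
    ∑ i, a i ^ 2 < 4 * 9 ^ r * K ^ 2 := by
  classical
  set X : (Fin n → Bool) → ℝ := fun x => ∑ i, a i * chi (m i) x with hX
  have hX0 : mean X = 0 := by
    rw [hX, mean_sum]
    exact Finset.sum_eq_zero fun i _ => by rw [mean_const_mul, mean_chi (hne i), mul_zero]
  have hX2 : mean (fun x => X x ^ 2) = ∑ i, a i ^ 2 := by
    have h : (fun x => X x ^ 2) = fun x => ∑ i, ∑ j, (a i * a j) * (chi (m i) x * chi (m j) x) := by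
      funext x
      rw [hX, pow_two, Finset.sum_mul_sum]
      exact Finset.sum_congr rfl fun i _ => Finset.sum_congr rfl fun j _ => by ring
    rw [h, mean_sum]
    refine Finset.sum_congr rfl fun i _ => ?_
    rw [mean_sum]
    simp only [mean_const_mul, mean_chi_mul_chi, hm.eq_iff, mul_ite, mul_one, mul_zero]
    rw [Finset.sum_ite_eq, if_pos (Finset.mem_univ i), pow_two]
  have hX4 : mean (fun x => X x ^ 4) ≤ 9 ^ r * (∑ i, a i ^ 2) ^ 2 := by
    rw [← hX2]
    exact (DegLE.sum _ fun i _ => (degLE_chi (m i) (hdeg i)).const_mul (a i)).mean_pow_four_le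
  have hKpos : 0 < K := by
    rw [← hX0]
    exact mean_lt hK
  -- As `X` has mean zero, `|X|` has the same mean as `|X| + X`, which is twice the positive part
  -- and hence less than `2 * K` everywhere.
  have habs : mean (fun x => |X x|) < 2 * K := by
    have h1 : mean (fun x => |X x|) = mean (fun x => |X x| + X x) := by
      rw [mean_add, hX0, add_zero]
    rw [h1]
    refine mean_lt fun x => ?_
    have := hK x
    rcases abs_cases (X x) with ⟨h, _⟩ | ⟨h, _⟩ <;> rw [h] <;> linarith
  by_contra hv
  rw [not_lt] at hv
  set v := ∑ i, a i ^ 2 with hvdef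
  have hvpos : 0 < v := lt_of_lt_of_le (by positivity) hv
  set σ := Real.sqrt v with hσ
  have hσpos : 0 < σ := Real.sqrt_pos.2 hvpos
  have hσ2 : v = σ ^ 2 := (Real.sq_sqrt hvpos.le).symm
  have h3pos : (0 : ℝ) < 3 ^ r := by positivity
  have h9 : (9 : ℝ) ^ r = (3 ^ r) ^ 2 := by
    rw [← pow_mul, mul_comm, pow_mul]
    norm_num
  have hσK : 2 * 3 ^ r * K ≤ σ := by
    rw [hσ]
    refine Real.le_sqrt_of_sq_le ?_
    rw [h9] at hv
    linarith [hv, show (2 * 3 ^ r * K) ^ 2 = 4 * (3 ^ r) ^ 2 * K ^ 2 by ring]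
  -- This `s` maximizes `(3 s v - s³ 9 ^ r v²) / 2`, the lower bound for the mean of `|X|` derived
  -- below; the maximum is `σ / 3 ^ r`.
  set s := 1 / (3 ^ r * σ) with hs
  have hspos : 0 < s := by positivity
  -- For `u = |X x|` this is `2 u - 3 s u² + s³ u⁴ = u (s u - 1)² (s u + 2) ≥ 0`.
  have hpt : ∀ x, (3 * s * X x ^ 2 + (-s ^ 3) * X x ^ 4) / 2 ≤ |X x| := by
    intro x
    have h2 : X x ^ 2 = |X x| ^ 2 := (sq_abs _).symm
    have h4 : X x ^ 4 = |X x| ^ 4 := by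
      rw [show 4 = 2 * 2 by norm_num, pow_mul, pow_mul, sq_abs]
    rw [h2, h4]
    have hu : 0 ≤ |X x| := abs_nonneg _
    generalize |X x| = u at hu
    have key : 0 ≤ u * ((s * u - 1) ^ 2 * (s * u + 2)) := by positivity
    nlinarith [key]
  have hmean : (3 * s * v + (-s ^ 3) * mean (fun x => X x ^ 4)) / 2 ≤ mean (fun x => |X x|) := by
    refine le_trans (le_of_eq ?_) (mean_mono hpt)
    rw [← hX2, ← mean_const_mul, ← mean_const_mul, ← mean_add, div_eq_inv_mul, ← mean_const_mul]
    congr 1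
    funext x
    ring
  have h5 : s ^ 3 * mean (fun x => X x ^ 4) ≤ s ^ 3 * (9 ^ r * v ^ 2) := by gcongr
  have h6 : (3 * s * v - s ^ 3 * (9 ^ r * v ^ 2)) / 2 = σ / 3 ^ r := by
    rw [h9, hσ2, hs]
    field_simp
    ring
  have h7 : 2 * K ≤ σ / 3 ^ r := by
    rw [le_div_iff₀ h3pos]
    linarith
  linarith

end BooleanCube


/-! ### Reading the input -/

namespace MaxCSPKernel

open TreeMachine Enc MaxCSP

theorem ofBits_encodePosNum (m : PosNum) : ofBits (Computability.encodePosNum m) = (m : ℕ) := by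
  induction m with
  | one => rfl
  | bit1 m ih =>
    rw [Computability.encodePosNum, ofBits_cons, ih, PosNum.cast_bit1, Bool.toNat_true]
    omega
  | bit0 m ih =>
    rw [Computability.encodePosNum, ofBits_cons, ih, PosNum.cast_bit0, Bool.toNat_false]
    omega

theorem trim_encodePosNum (m : PosNum) :
    trim (Computability.encodePosNum m) = Computability.encodePosNum m := by
  have hne : ∀ m : PosNum, (Computability.encodePosNum m).isEmpty = false := by
    intro m
    cases m <;> rfl
  have hcons : ∀ b l, trim (b :: l) = bif !b && (trim l).isEmpty then [] else b :: trim l :=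
    fun _ _ => rfl
  induction m with
  | one => rfl
  | bit1 m ih => rw [Computability.encodePosNum, hcons, ih]; rfl
  | bit0 m ih => rw [Computability.encodePosNum, hcons, ih, hne]; rfl

/-- Both are the binary digits from the least significant one on: they have the same value, and
`trim` fixes the left side and produces the right one. -/
theorem encodeNat_eq_bits (n : ℕ) : Computability.encodeNat n = n.bits := by
  have h1 : ofBits (Computability.encodeNat n) = n := by
    rw [Computability.encodeNat]
    conv_rhs => rw [← Num.to_of_nat n]
    cases (n : Num) with
    | zero => rfl
    | pos m => exact ofBits_encodePosNum m
  have h2 : trim (Computability.encodeNat n) = Computability.encodeNat n := by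
    rw [Computability.encodeNat]
    cases (n : Num) with
    | zero => rfl
    | pos m => exact trim_encodePosNum m
  rw [← h2, ← bits_ofBits, h1]

theorem foldr_fieldStep_bits (l : List Bool) (a : Ch) (l' : List Bool) (fs kb) :
    (l.map fun b => (Sum.inl (Sym.bit b) : Ch)).foldr fieldStep ((a, l') :: fs, kb) =
      ((a, l ++ l') :: fs, kb) := by
  induction l with
  | nil => rfl
  | cons b l ih =>
    rw [List.map_cons, List.foldr_cons, ih]
    rfl

theorem foldr_fieldStep_encodeBits (l : List Bool) (x) :
    ((encodeBits l).map fun s => (Sum.inl s : Ch)).foldr fieldStep x =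
      ((.inl .endMark, l) :: x.1, x.2) := by
  have h : fieldStep (.inl .endMark) x = ((.inl .endMark, []) :: x.1, x.2) := rfl
  have := foldr_fieldStep_bits l (.inl .endMark) [] x.1 x.2
  rw [List.append_nil] at this
  rw [encodeBits, List.map_append, List.foldr_append, List.map_cons, List.map_nil, List.foldr_cons,
    List.foldr_nil, h, List.map_map]
  exact this

/-- A constraint as it is read from the input. -/
def conOf {r n : ℕ} (c : Constraint r n) : Con := (c.vars, c.truthTable, c.weight)

/-- The fields of a constraint. -/
def conFields {r n : ℕ} (c : Constraint r n) : List (Ch × List Bool) :=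
  c.vars.map (fun v => (.inl .arg, v.bits)) ++
    [(.inl .table, c.truthTable), (.inl .endMark, c.weight.bits)]

theorem foldr_fieldStep_encode {r n : ℕ} (c : Constraint r n) (x) :
    (c.encode.map fun s => (Sum.inl s : Ch)).foldr fieldStep x = (conFields c ++ x.1, x.2) := by
  have h1 : ∀ (vs : List ℕ) (y), ((vs.flatMap fun v => Sym.arg :: encodeNum v).map
      fun s => (Sum.inl s : Ch)).foldr fieldStep y =
      (vs.map (fun v => ((.inl .arg : Ch), v.bits)) ++ y.1, y.2) := by
    intro vs y
    induction vs with
    | nil => rfl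
    | cons v vs ih =>
      rw [List.flatMap_cons, List.map_append, List.foldr_append, ih, List.map_cons, List.foldr_cons,
        encodeNum, foldr_fieldStep_encodeBits, encodeNat_eq_bits]
      rfl
  rw [Constraint.encode, List.map_append, List.foldr_append, List.map_cons, List.foldr_cons,
    List.map_append, List.foldr_append, encodeNum, foldr_fieldStep_encodeBits,
    foldr_fieldStep_encodeBits, h1, encodeNat_eq_bits, conFields, List.append_assoc]
  rfl

theorem fields_encode {r : ℕ} (I : Instance r) (k : ℕ) :
    fields (I.encode.map Sum.inl ++ (Computability.encodeNat k).map Sum.inr) =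
      (I.constraints.flatMap conFields, k.bits) := by
  have h1 : ∀ l : List Bool, (l.map (Sum.inr : Bool → Ch)).foldr fieldStep ([], []) = ([], l) := by
    intro l
    induction l with
    | nil => rfl
    | cons b l ih => rw [List.map_cons, List.foldr_cons, ih]; rfl
  have h2 : ∀ (m : ℕ) (x), ((List.replicate m Sym.var).map (Sum.inl : Sym → Ch)).foldr fieldStep x =
      x := by
    intro m x
    induction m with
    | zero => rfl
    | succ m ih => rw [List.replicate_succ, List.map_cons, List.foldr_cons, ih]; rfl
  have h3 : ∀ (l : List (Constraint r I.n)) (x), ((l.flatMap Constraint.encode).map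
      (Sum.inl : Sym → Ch)).foldr fieldStep x = (l.flatMap conFields ++ x.1, x.2) := by
    intro l x
    induction l with
    | nil => rfl
    | cons c l ih =>
      rw [List.flatMap_cons, List.map_append, List.foldr_append, ih, List.flatMap_cons]
      refine (foldr_fieldStep_encode c _).trans ?_
      rw [List.append_assoc]
  rw [fields, List.foldr_append, h1, Instance.encode, List.map_append, List.foldr_append, h3, h2,
    encodeNat_eq_bits, List.append_nil]

theorem foldr_conStep {r n : ℕ} (c : Constraint r n) (cs : List Con) :
    (conFields c).foldr conStep cs = conOf c :: cs := by
  have h : ∀ (vs us : List ℕ) (t : List Bool) (w : ℕ),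
      (vs.map (fun v => ((.inl .arg : Ch), v.bits))).foldr conStep ((us, t, w) :: cs) =
        (vs ++ us, t, w) :: cs := by
    intro vs us t w
    induction vs with
    | nil => rfl
    | cons v vs ih =>
      rw [List.map_cons, List.foldr_cons, ih]
      have : conStep (.inl .arg, v.bits) ((vs ++ us, t, w) :: cs) =
        (ofBits v.bits :: (vs ++ us), t, w) :: cs := rfl
      rw [this, ofBits_bits]
      rfl
  have h2 : [((.inl .table : Ch), c.truthTable), (.inl .endMark, c.weight.bits)].foldr conStep cs =
      ([], c.truthTable, ofBits c.weight.bits) :: cs := rfl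
  rw [conFields, List.foldr_append, h2, ofBits_bits, h, List.append_nil, conOf]

theorem parseCons_encode {r : ℕ} (I : Instance r) (k : ℕ) :
    parseCons (I.encode.map Sum.inl ++ (Computability.encodeNat k).map Sum.inr) =
      I.constraints.map conOf := by
  rw [parseCons, fields_encode]
  induction I.constraints with
  | nil => rfl
  | cons c l ih => rw [List.flatMap_cons, List.foldr_append, ih, foldr_conStep, List.map_cons]

theorem parseParam_encode {r : ℕ} (I : Instance r) (k : ℕ) :
    parseParam (I.encode.map Sum.inl ++ (Computability.encodeNat k).map Sum.inr) = k := by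
  rw [parseParam, fields_encode, ofBits_bits]

/-- Past the range the search fails, and all `N + 1` numbers have been collected. -/
theorem unary_downFrom (N k : ℕ) :
    ((unary (PT.downFrom N) k).1 = true ↔ k ≤ N) ∧
      ((unary (PT.downFrom N) k).2.length = if k ≤ N then k else N + 1) := by
  have hz : ∀ k, unary (PT.downFrom 0) k = bif decide (0 = k) then (true, []) else (false, [0]) :=
    fun _ => rfl
  induction N with
  | zero =>
    rw [hz]
    by_cases h : 0 = k
    · subst h; simp
    · have : ¬ k ≤ 0 := by omega
      simp [h, Ne.symm h]
  | succ N ih =>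
    have hs : unary (PT.downFrom (N + 1)) k = bif (unary (PT.downFrom N) k).1 then
        unary (PT.downFrom N) k else bif decide (N + 1 = k) then
          (true, (unary (PT.downFrom N) k).2) else (false, (N + 1) :: (unary (PT.downFrom N) k).2) := by
      rw [PT.downFrom_succ]
      rfl
    rw [hs]
    cases hb : (unary (PT.downFrom N) k).1 with
    | true =>
      have hk := ih.1.1 hb
      have hk' : k ≤ N + 1 := by omega
      rw [if_pos hk] at ih
      simp [hb, hk', ih.2]
    | false =>
      have hk : ¬ k ≤ N := fun h => by rw [ih.1.2 h] at hb; cases hb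
      rw [if_neg hk] at ih
      by_cases h : N + 1 = k
      · subst h
        simp [ih.2]
      · have : ¬ k ≤ N + 1 := by omega
        simp [h, this, ih.2]

/-! ### Fourier expansion of constraints -/

/-- The sign of a bit. -/
def sg (b : Bool) : ℤ := bif b then -1 else 1

theorem sg_not (b : Bool) : sg (!b) = - sg b := by cases b <;> rfl

/-- The product of the signs of the bits selected by a mask. -/
def chiMask : List Bool → List Bool → ℤ
  | b :: m, x :: xs => (bif b then sg x else 1) * chiMask m xs
  | _, _ => 1

/-- The product of the signs that an assignment gives to some variables. -/
def chiSet (S : List ℕ) (z : ℕ → Bool) : ℤ := (S.map fun v => sg (z v)).prod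

/-- The value of a term. -/
def termVal (z : ℕ → Bool) (t : Term) : ℤ := sg t.2.1 * t.2.2 * chiSet t.1 z

/-- The value of a sum of terms. -/
def total (z : ℕ → Bool) (ts : List Term) : ℤ := (ts.map (termVal z)).sum

theorem length_of_mem_walsh {a : ℕ} {F : List Bool → Bool} {p : List Bool × Bool}
    (h : p ∈ walsh a F) : p.1.length = a := by
  induction a generalizing F p with
  | zero =>
    rw [walsh] at h
    cases hF : F [] <;> rw [hF] at h <;> simp_all
  | succ a ih =>
    simp only [walsh, List.mem_append, List.mem_map] at h
    rcases h with ((⟨q, hq, rfl⟩ | ⟨q, hq, rfl⟩) | ⟨q, hq, rfl⟩) | ⟨q, hq, rfl⟩ <;> simp [ih hq]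

/-- In the recursion, the factor `1 ± χ` is 2 on the branch that the first variable selects and 0 on
the other. -/
theorem sum_walsh (a : ℕ) (F : List Bool → Bool) (xs : List Bool) (hxs : xs.length = a) :
    ((walsh a F).map fun p => sg p.2 * chiMask p.1 xs).sum = 2 ^ a * (F xs).toNat := by
  induction a generalizing F xs with
  | zero =>
    obtain rfl := List.eq_nil_of_length_eq_zero hxs
    simp only [walsh]
    cases F [] <;> simp [sg, chiMask]
  | succ a ih =>
    cases xs with
    | nil => simp at hxs
    | cons x xs =>
      have hx : xs.length = a := by simpa using hxs
      have h0 := ih (fun xs => F (false :: xs)) xs hx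
      have h1 := ih (fun xs => F (true :: xs)) xs hx
      simp only [walsh, List.map_append, List.map_map, List.sum_append, Function.comp_def, chiMask,
        cond_false, cond_true, one_mul, sg_not]
      have e : ∀ (l : List (List Bool × Bool)) (c : ℤ),
          (l.map fun p => sg p.2 * (c * chiMask p.1 xs)).sum =
            c * (l.map fun p => sg p.2 * chiMask p.1 xs).sum := by
        intro l c
        rw [← List.sum_map_mul_left]
        congr 1
        refine List.map_congr_left fun p _ => by ring
      have e' : ∀ (l : List (List Bool × Bool)) (c : ℤ),
          (l.map fun p => -sg p.2 * (c * chiMask p.1 xs)).sum =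
            -c * (l.map fun p => sg p.2 * chiMask p.1 xs).sum := by
        intro l c
        rw [← List.sum_map_mul_left]
        congr 1
        refine List.map_congr_left fun p _ => by ring
      rw [e, e', h0, h1]
      cases x <;> simp [sg] <;> ring

/-- The members of a list that are selected by a mask. -/
def pick : List Bool → List ℕ → List ℕ
  | b :: m, v :: vs => bif b then v :: pick m vs else pick m vs
  | _, _ => []

theorem pick_sublist (m : List Bool) (vs : List ℕ) : (pick m vs).Sublist vs := by
  induction m generalizing vs with
  | nil => simp [pick]
  | cons b m ih =>
    cases vs with
    | nil => simp [pick]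
    | cons v vs =>
      cases b
      · exact (ih vs).cons v
      · exact (ih vs).cons_cons v

/-- The reversal is harmless because `chiSet` does not depend on the order. -/
theorem select_eq (m : List Bool) (vs : List ℕ) (h : m.length = vs.length) :
    select m vs = (pick m vs).reverse := by
  have key : ∀ (m : List Bool) (vs out : List ℕ), m.length = vs.length →
      (m.foldl (fun (x : List ℕ × List ℕ) b =>
        (x.1.tail, bif b then x.1.headD 0 :: x.2 else x.2)) (vs, out)).2 =
        (pick m vs).reverse ++ out := by
    intro m
    induction m with
    | nil => intro vs out _; simp [pick]
    | cons b m ih =>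
      intro vs out hl
      cases vs with
      | nil => simp at hl
      | cons v vs =>
        rw [List.foldl_cons]
        refine (ih _ _ (by simpa using hl)).trans ?_
        cases b <;> simp [pick]
  rw [select, key m vs [] h, List.append_nil]

theorem chiSet_pick (m : List Bool) (vs : List ℕ) (z : ℕ → Bool) (h : m.length = vs.length) :
    chiSet (pick m vs) z = chiMask m (vs.map z) := by
  induction m generalizing vs with
  | nil => simp [pick, chiSet, chiMask]
  | cons b m ih =>
    cases vs with
    | nil => simp at h
    | cons v vs =>
      have := ih vs (by simpa using h)
      cases b
      · simp [pick, chiMask, this]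
      · rw [chiSet] at this
        simp [pick, chiMask, chiSet, this]

theorem chiSet_perm {S T : List ℕ} (h : S.Perm T) (z : ℕ → Bool) : chiSet S z = chiSet T z :=
  (h.map _).prod_eq

theorem pick_ne_nil (m : List Bool) (vs : List ℕ) (h : m.length = vs.length)
    (hm : m.any id = true) : pick m vs ≠ [] := by
  induction m generalizing vs with
  | nil => simp at hm
  | cons b m ih =>
    cases vs with
    | nil => simp at h
    | cons v vs =>
      cases b
      · exact ih vs (by simpa using h) (by simpa using hm)
      · simp [pick]

theorem chiMask_eq_one (m xs : List Bool) (hm : m.any id = false) : chiMask m xs = 1 := by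
  induction m generalizing xs with
  | nil => rfl
  | cons b m ih =>
    cases xs with
    | nil => rfl
    | cons x xs =>
      cases b
      · simpa [chiMask] using ih xs (by simpa using hm)
      · simp at hm

theorem mem_tableKeys {r a : ℕ} {t : List Bool} (ha : a ≤ r) (ht : t.length = 2 ^ a) :
    (List.replicate a (), t) ∈ tableKeys r := by
  simp only [tableKeys, List.mem_flatMap, List.mem_range, List.mem_map]
  exact ⟨a, by omega, t, ht ▸ mem_allBits t, rfl⟩

theorem length_truthTable {r n : ℕ} (c : Constraint r n) : c.truthTable.length = 2 ^ c.arity := by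
  simp [Constraint.truthTable]

theorem length_vars {r n : ℕ} (c : Constraint r n) : c.vars.length = c.arity := by
  simp [Constraint.vars]

theorem ofBits_lt (l : List Bool) : ofBits l < 2 ^ l.length := by
  induction l with
  | nil => simp [ofBits]
  | cons b l ih =>
    rw [ofBits_cons, List.length_cons, pow_succ]
    cases b <;> simp <;> omega

theorem testBit_ofBits (l : List Bool) (j : ℕ) (hj : j < l.length) :
    (ofBits l).testBit j = l[j] := by
  induction l generalizing j with
  | nil => simp at hj
  | cons b l ih =>
    have h : ofBits (b :: l) = Nat.bit b (ofBits l) := rfl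
    rw [h]
    cases j with
    | zero => simp
    | succ j => simpa [Nat.testBit_bit_succ] using ih j (by simpa using hj)

/-- Extend an assignment by `false`. -/
def extend {n : ℕ} (x : Fin n → Bool) (v : ℕ) : Bool := if h : v < n then x ⟨v, h⟩ else false

theorem extend_val {n : ℕ} (x : Fin n → Bool) (i : Fin n) : extend x i = x i := by
  simp [extend]

theorem getD_truthTable {r n : ℕ} (c : Constraint r n) (x : Fin n → Bool) :
    c.truthTable.getD (ofBits (c.vars.map (extend x))) false = c.sat x := by
  set xs := c.vars.map (extend x) with hxs
  have hlen : xs.length = c.arity := by rw [hxs, List.length_map, length_vars]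
  have hlt : ofBits xs < 2 ^ c.arity := hlen ▸ ofBits_lt xs
  rw [List.getD_eq_getElem _ _ (by rw [length_truthTable]; exact hlt)]
  simp only [Constraint.truthTable, List.getElem_map, List.getElem_range, Constraint.sat]
  congr 1
  funext j
  rw [testBit_ofBits xs j (by rw [hlen]; exact j.2)]
  simp [hxs, Constraint.vars, extend_val]

/-- The terms of one constraint. -/
def conTerms (r : ℕ) (c : Con) : List Term :=
  (expansion r (c.1.map fun _ => (), c.2.1)).map fun p => (select p.1 c.1, p.2, c.2.2)

theorem expansion_conOf {r n : ℕ} (c : Constraint r n) :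
    expansion r ((conOf c).1.map fun _ => (), (conOf c).2.1) =
      (List.replicate (2 ^ (r - c.arity)) ()).flatMap fun _ =>
        (walsh c.arity fun xs => c.truthTable.getD (ofBits xs) false).filter
          fun p => p.1.any id := by
  have h : (conOf c).1.map (fun _ => ()) = List.replicate c.arity () := by
    rw [conOf, List.map_const', length_vars]
  have h' : (conOf c).2.1 = c.truthTable := rfl
  rw [h, h', expansion, if_pos (mem_tableKeys c.arity_le (length_truthTable c)), nonconstantPart]
  simp only [List.length_replicate]

/-- A term in at least one and at most `r` of `n` variables. -/
def ProperTerm (r n : ℕ) (t : Term) : Prop :=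
  t.1.Nodup ∧ t.1 ≠ [] ∧ t.1.length ≤ r ∧ ∀ v ∈ t.1, v < n

theorem nodup_vars {r n : ℕ} (c : Constraint r n) : c.vars.Nodup := by
  rw [Constraint.vars, List.nodup_ofFn]
  exact fun i j h => c.scope.injective (Fin.ext h)

theorem properTerm_of_mem_conTerms {r n : ℕ} {c : Constraint r n} {t : Term}
    (ht : t ∈ conTerms r (conOf c)) : ProperTerm r n t := by
  rw [conTerms, expansion_conOf, List.mem_map] at ht
  obtain ⟨p, hp, rfl⟩ := ht
  simp only [List.mem_flatMap, List.mem_filter] at hp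
  obtain ⟨_, _, hp, hne⟩ := hp
  have hl : p.1.length = c.vars.length := by rw [length_of_mem_walsh hp, length_vars]
  have hsub := pick_sublist p.1 c.vars
  have e : select p.1 (conOf c).1 = (pick p.1 c.vars).reverse := select_eq _ _ hl
  refine ⟨?_, ?_, ?_, ?_⟩
  · simp only [e, List.nodup_reverse]
    exact (nodup_vars c).sublist hsub
  · simp only [e, ne_eq, List.reverse_eq_nil_iff]
    exact pick_ne_nil _ _ hl hne
  · simp only [e, List.length_reverse]
    exact hsub.length_le.trans ((length_vars c).trans_le c.arity_le)
  · intro v hv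
    simp only [e, List.mem_reverse] at hv
    have := hsub.subset hv
    rw [Constraint.vars, List.mem_ofFn'] at this
    obtain ⟨i, rfl⟩ := this
    exact (c.scope i).2

theorem total_append (z : ℕ → Bool) (l l' : List Term) :
    total z (l ++ l') = total z l + total z l' := by
  simp [total]

theorem total_flatMap {β : Type} (z : ℕ → Bool) (l : List β) (f : β → List Term) :
    total z (l.flatMap f) = (l.map fun b => total z (f b)).sum := by
  induction l with
  | nil => rfl
  | cons b l ih => rw [List.flatMap_cons, total_append, ih, List.map_cons, List.sum_cons]

theorem sum_filter_add_sum_filter_not {β : Type} (l : List β) (p : β → Bool) (f : β → ℤ) :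
    ((l.filter p).map f).sum + ((l.filter fun b => !p b).map f).sum = (l.map f).sum := by
  induction l with
  | nil => rfl
  | cons b l ih =>
    cases h : p b <;> simp [h, ← ih] <;> ring

/-- The terms of a constraint represent it up to a constant. -/
theorem exists_total_conTerms {r n : ℕ} (c : Constraint r n) :
    ∃ C : ℤ, ∀ x : Fin n → Bool, 2 ^ r * (c.weight * (c.sat x).toNat : ℤ) =
      C + total (extend x) (conTerms r (conOf c)) := by
  set F : List Bool → Bool := fun xs => c.truthTable.getD (ofBits xs) false with hF
  set W := walsh c.arity F with hW
  -- The constant comes from the products over the empty mask, which reduce to their signs.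
  refine ⟨c.weight * (2 ^ (r - c.arity) *
    ((W.filter fun p => !p.1.any id).map fun p => sg p.2).sum), fun x => ?_⟩
  have h1 := sum_walsh c.arity F (c.vars.map (extend x)) (by rw [List.length_map, length_vars])
  rw [← hW, ← sum_filter_add_sum_filter_not W fun p => p.1.any id] at h1
  have h2 : ((W.filter fun p => !p.1.any id).map
      fun p => sg p.2 * chiMask p.1 (c.vars.map (extend x))).sum =
      ((W.filter fun p => !p.1.any id).map fun p => sg p.2).sum := by
    congr 1
    refine List.map_congr_left fun p hp => ?_
    rw [List.mem_filter] at hp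
    rw [chiMask_eq_one _ _ (by simpa using hp.2), mul_one]
  have h3 : total (extend x) (conTerms r (conOf c)) = c.weight * (2 ^ (r - c.arity) *
      ((W.filter fun p => p.1.any id).map
        fun p => sg p.2 * chiMask p.1 (c.vars.map (extend x))).sum) := by
    rw [conTerms, expansion_conOf, List.map_flatMap, total_flatMap, List.map_const',
      List.sum_replicate, List.length_replicate, nsmul_eq_mul, total, List.map_map]
    push_cast
    rw [mul_left_comm]
    congr 1
    rw [← List.sum_map_mul_left]
    congr 1
    refine List.map_congr_left fun p hp => ?_
    rw [List.mem_filter] at hp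
    have hl : p.1.length = c.vars.length := by rw [length_of_mem_walsh hp.1, length_vars]
    simp only [Function.comp_def, termVal, conOf]
    rw [select_eq _ _ hl, chiSet_perm (List.reverse_perm _), chiSet_pick _ _ _ hl]
    ring
  rw [h3, ← getD_truthTable, show c.truthTable.getD (ofBits (c.vars.map (extend x))) false =
    F (c.vars.map (extend x)) from rfl]
  have h4 : (2 : ℤ) ^ r = 2 ^ (r - c.arity) * 2 ^ c.arity := by
    rw [← pow_add, Nat.sub_add_cancel c.arity_le]
  rw [h2] at h1
  rw [h4]
  linear_combination (-(c.weight : ℤ) * 2 ^ (r - c.arity)) * h1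

end MaxCSPKernel


/-! ### Collecting terms -/

namespace MaxCSPKernel

open TreeMachine Enc MaxCSP

theorem satWeight_eq {r : ℕ} (I : Instance r) (x : Fin I.n → Bool) :
    (I.satWeight x : ℤ) = (I.constraints.map fun c => (c.weight * (c.sat x).toNat : ℤ)).sum := by
  rw [Instance.satWeight]
  induction I.constraints with
  | nil => rfl
  | cons c l ih =>
    cases h : c.sat x <;> simp [h, ← ih]

theorem exists_total_terms {r : ℕ} (I : Instance r) :
    ∃ C : ℤ, ∀ x : Fin I.n → Bool, 2 ^ r * (I.satWeight x : ℤ) =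
      C + total (extend x) (terms r (I.constraints.map conOf)) := by
  have h : ∀ l : List (Constraint r I.n), ∃ C : ℤ, ∀ x : Fin I.n → Bool,
      2 ^ r * (l.map fun c => (c.weight * (c.sat x).toNat : ℤ)).sum =
        C + total (extend x) (terms r (l.map conOf)) := by
    intro l
    induction l with
    | nil => exact ⟨0, fun x => by simp [terms, total]⟩
    | cons c l ih =>
      obtain ⟨C, hC⟩ := ih
      obtain ⟨D, hD⟩ := exists_total_conTerms c
      refine ⟨D + C, fun x => ?_⟩
      have e : terms r ((c :: l).map conOf) = conTerms r (conOf c) ++ terms r (l.map conOf) := rfl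
      rw [e, total_append, List.map_cons, List.sum_cons, mul_add, hC, hD]
      ring
  obtain ⟨C, hC⟩ := h I.constraints
  exact ⟨C, fun x => by rw [satWeight_eq, hC]⟩

theorem properTerm_of_mem_terms {r : ℕ} {I : Instance r} {t : Term}
    (ht : t ∈ terms r (I.constraints.map conOf)) : ProperTerm r I.n t := by
  obtain ⟨c, hc, ht⟩ := List.mem_flatMap.1 ht
  obtain ⟨c, _, rfl⟩ := List.mem_map.1 hc
  exact properTerm_of_mem_conTerms ht

/-- The indicator function of a list of variables. -/
def maskOf (n : ℕ) (S : List ℕ) (i : Fin n) : Bool := decide ((i : ℕ) ∈ S)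

theorem cast_sg (b : Bool) : (sg b : ℝ) = BooleanCube.sgn b := by cases b <;> simp [sg, BooleanCube.sgn]

/-- The bridge from the lists of variable numbers in the algorithm to the characters of the cube. -/
theorem cast_chiSet {n : ℕ} {S : List ℕ} (hS : S.Nodup) (hn : ∀ v ∈ S, v < n)
    (x : Fin n → Bool) : (chiSet S (extend x) : ℝ) = BooleanCube.chi (maskOf n S) x := by
  have h1 : BooleanCube.chi (maskOf n S) x =
      ∏ i : Fin n, (fun v : ℕ => if v ∈ S.toFinset then (sg (extend x v) : ℝ) else 1) i := by
    refine Finset.prod_congr rfl fun i _ => ?_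
    by_cases h : (i : ℕ) ∈ S <;> simp [maskOf, h, cast_sg, extend_val]
  have h2 : Finset.range n ∩ S.toFinset = S.toFinset := by
    refine Finset.inter_eq_right.2 fun v hv => ?_
    simpa using hn v (by simpa using hv)
  rw [h1, Fin.prod_univ_eq_prod_range (fun v => if v ∈ S.toFinset then (sg (extend x v) : ℝ) else 1),
    Finset.prod_ite_mem, h2, List.prod_toFinset _ hS, chiSet]
  push_cast
  rw [List.map_map]
  rfl

theorem sum_maskOf {n : ℕ} {S : List ℕ} (hS : S.Nodup) (hn : ∀ v ∈ S, v < n) :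
    ∑ i, (maskOf n S i).toNat = S.length := by
  have h1 : ∑ i, (maskOf n S i).toNat =
      ∑ i : Fin n, (fun v : ℕ => if v ∈ S.toFinset then 1 else 0) i := by
    refine Finset.sum_congr rfl fun i _ => ?_
    by_cases h : (i : ℕ) ∈ S <;> simp [maskOf, h]
  have h2 : Finset.range n ∩ S.toFinset = S.toFinset := by
    refine Finset.inter_eq_right.2 fun v hv => ?_
    simpa using hn v (by simpa using hv)
  rw [h1, Fin.sum_univ_eq_sum_range (fun v => if v ∈ S.toFinset then 1 else 0),
    Finset.sum_ite_mem, h2, Finset.sum_const, smul_eq_mul, mul_one, List.toFinset_card_of_nodup hS]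

theorem exists_maskOf {n : ℕ} {S : List ℕ} (hS : S ≠ []) (hn : ∀ v ∈ S, v < n) :
    ∃ i, maskOf n S i = true := by
  obtain ⟨v, hv⟩ := List.exists_mem_of_ne_nil S hS
  exact ⟨⟨v, hn v hv⟩, by simpa [maskOf] using hv⟩

/-- Every term contains a variable, so its character has mean zero. -/
theorem mean_total {r n : ℕ} {ts : List Term} (hts : ∀ t ∈ ts, ProperTerm r n t) :
    BooleanCube.mean (fun x : Fin n → Bool => (total (extend x) ts : ℝ)) = 0 := by
  induction ts with
  | nil => simp [total, BooleanCube.mean_const]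
  | cons t ts ih =>
    obtain ⟨h1, h2, -, h4⟩ := hts t List.mem_cons_self
    have e : (fun x : Fin n → Bool => (total (extend x) (t :: ts) : ℝ)) = fun x =>
        ((sg t.2.1 * t.2.2 : ℤ) : ℝ) * BooleanCube.chi (maskOf n t.1) x +
          (total (extend x) ts : ℝ) := by
      funext x
      rw [← cast_chiSet h1 h4]
      simp [total, termVal]
    rw [e, BooleanCube.mean_add, BooleanCube.mean_const_mul,
      BooleanCube.mean_chi (exists_maskOf h2 h4),
      ih fun t ht => hts t (List.mem_cons_of_mem _ ht), mul_zero, add_zero]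

/-- Terms that represent a multiple of the weight up to a constant represent the excess over the
average. -/
theorem mul_satWeight_sub_average {r d : ℕ} {I : Instance r} {ts : List Term}
    (hts : ∀ t ∈ ts, ProperTerm d I.n t) {q C : ℤ}
    (h : ∀ x : Fin I.n → Bool, q * (I.satWeight x : ℤ) = C + total (extend x) ts)
    (x : Fin I.n → Bool) :
    (q : ℚ) * ((I.satWeight x : ℚ) - I.average) = (total (extend x) ts : ℚ) := by
  have h0 := mean_total hts
  have h1 : ∀ x : Fin I.n → Bool,
      (q : ℝ) * (I.satWeight x : ℝ) = C + (total (extend x) ts : ℝ) := fun x => by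
    exact_mod_cast h x
  -- Taking means identifies the constant `C` as `q` times the average.
  have h2 : BooleanCube.mean (fun x : Fin I.n → Bool => (q : ℝ) * (I.satWeight x : ℝ)) = C := by
    simp only [h1]
    rw [BooleanCube.mean_add, h0, BooleanCube.mean_const, add_zero]
  have h3 : (q : ℝ) * ((I.average : ℚ) : ℝ) = C := by
    rw [← h2, BooleanCube.mean_const_mul, BooleanCube.mean, Instance.average]
    push_cast
    rfl
  have h4 : (q : ℚ) * I.average = C := by exact_mod_cast h3
  have h5 : (q : ℚ) * (I.satWeight x : ℚ) = C + (total (extend x) ts : ℚ) := by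
    exact_mod_cast h x
  rw [mul_sub, h4, h5]
  ring

theorem sameSet_iff {S T : List ℕ} : sameSet S T = true ↔ ∀ v, v ∈ S ↔ v ∈ T := by
  simp only [sameSet, subsetB, Bool.and_eq_true, List.all_eq_true, List.any_eq_true,
    decide_eq_true_eq, exists_eq_right]
  exact ⟨fun h v => ⟨h.1 v, h.2 v⟩, fun h => ⟨fun v => (h v).1, fun v => (h v).2⟩⟩

theorem chiSet_eq_of_sameSet {S T : List ℕ} (hS : S.Nodup) (hT : T.Nodup)
    (h : sameSet S T = true) (z : ℕ → Bool) : chiSet S z = chiSet T z :=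
  chiSet_perm ((List.perm_ext_iff_of_nodup hS hT).2 (sameSet_iff.1 h)) z

theorem supports_cons (t : Term) (ts : List Term) : supports (t :: ts) =
    bif (supports ts).any (fun S => sameSet S t.1) then supports ts else t.1 :: supports ts := rfl

theorem exists_of_mem_supports {ts : List Term} {S : List ℕ} (hS : S ∈ supports ts) :
    ∃ t ∈ ts, t.1 = S := by
  induction ts with
  | nil => simp [supports] at hS
  | cons t ts ih =>
    have h : S = t.1 ∨ S ∈ supports ts := by
      rw [supports_cons] at hS
      cases hb : (supports ts).any (fun S => sameSet S t.1) <;> rw [hb] at hS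
      · simpa using hS
      · exact Or.inr hS
    rcases h with rfl | h
    · exact ⟨t, by simp⟩
    · obtain ⟨u, hu, rfl⟩ := ih h
      exact ⟨u, List.mem_cons_of_mem _ hu, rfl⟩

theorem pairwise_supports (ts : List Term) :
    (supports ts).Pairwise fun S T => sameSet S T = false := by
  induction ts with
  | nil => simp [supports]
  | cons t ts ih =>
    rw [supports_cons]
    cases hb : (supports ts).any (fun S => sameSet S t.1)
    · refine List.Pairwise.cons (fun S hS => ?_) ih
      have h1 := List.any_eq_false.1 hb S hS
      rw [Bool.not_eq_true] at h1
      rw [← h1, sameSet, sameSet, Bool.and_comm]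
    · exact ih

theorem exists_mem_supports {ts : List Term} {t : Term} (ht : t ∈ ts) :
    ∃ S ∈ supports ts, sameSet S t.1 = true := by
  induction ts with
  | nil => simp at ht
  | cons u ts ih =>
    have hmem : ∀ S ∈ supports ts, S ∈ supports (u :: ts) := by
      intro S hS
      rw [supports_cons]
      cases (supports ts).any (fun S => sameSet S u.1)
      · exact List.mem_cons_of_mem _ hS
      · exact hS
    rcases List.mem_cons.1 ht with rfl | ht
    · cases hb : (supports ts).any (fun S => sameSet S t.1)
      · exact ⟨t.1, by rw [supports_cons, hb]; simp, sameSet_iff.2 fun _ => Iff.rfl⟩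
      · obtain ⟨S, hS, h⟩ := List.any_eq_true.1 hb
        exact ⟨S, hmem S hS, h⟩
    · obtain ⟨S, hS, h⟩ := ih ht
      exact ⟨S, hmem S hS, h⟩

/-- The coefficient of the product of a set of variables. -/
def coef (ts : List Term) (S : List ℕ) : ℤ := (weightOf ts S false : ℤ) - weightOf ts S true

theorem coef_mul_chiSet {ts : List Term} (hts : ∀ t ∈ ts, t.1.Nodup) {S : List ℕ} (hS : S.Nodup)
    (z : ℕ → Bool) : coef ts S * chiSet S z =
      (ts.map fun t => bif sameSet t.1 S then termVal z t else 0).sum := by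
  induction ts with
  | nil => simp [coef, weightOf]
  | cons t ts ih =>
    have hc : coef (t :: ts) S = (bif sameSet t.1 S then sg t.2.1 * t.2.2 else 0) + coef ts S := by
      simp only [coef, weightOf]
      cases h1 : sameSet t.1 S <;> cases h2 : t.2.1 <;> simp [h1, h2, sg] <;> ring
    rw [hc, add_mul, ih fun t ht => hts t (List.mem_cons_of_mem _ ht), List.map_cons, List.sum_cons]
    congr 1
    cases h1 : sameSet t.1 S
    · simp
    · simp only [cond_true, termVal]
      rw [chiSet_eq_of_sameSet (hts t List.mem_cons_self) hS h1]

theorem sum_map_sum_comm {β γ : Type} (l : List β) (m : List γ) (g : β → γ → ℤ) :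
    (l.map fun b => (m.map fun c => g b c).sum).sum =
      (m.map fun c => (l.map fun b => g b c).sum).sum := by
  induction l with
  | nil => simp
  | cons b l ih => simp [ih, List.sum_map_add]

/-- The representatives are pairwise different as sets, so exactly one of them matches `T`. -/
theorem sum_supports_eq {R : List (List ℕ)} (hR : R.Pairwise fun S T => sameSet S T = false)
    {T : List ℕ} (hT : ∃ S ∈ R, sameSet S T = true) (a : ℤ) :
    (R.map fun S => bif sameSet T S then a else 0).sum = a := by
  have hz : ∀ R : List (List ℕ), (∀ S ∈ R, sameSet T S = false) →
      (R.map fun S => bif sameSet T S then a else 0).sum = 0 := by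
    intro R h
    refine List.sum_eq_zero fun y hy => ?_
    obtain ⟨S, hS, rfl⟩ := List.mem_map.1 hy
    rw [h S hS]
    rfl
  induction R with
  | nil => simp at hT
  | cons S R ih =>
    rw [List.pairwise_cons] at hR
    rw [List.map_cons, List.sum_cons]
    cases hS : sameSet T S
    · obtain ⟨S', hS', h'⟩ := hT
      rcases List.mem_cons.1 hS' with rfl | hmem
      · rw [sameSet, Bool.and_comm] at h'
        rw [sameSet] at hS
        rw [hS] at h'
        cases h'
      · rw [ih hR.2 ⟨S', hmem, h'⟩]
        simp
    · rw [hz R fun S' hS' => ?_]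
      · simp
      · have h1 := hR.1 S' hS'
        by_contra h2
        rw [Bool.not_eq_false] at h2
        rw [sameSet_iff] at hS h2
        have : sameSet S S' = true := sameSet_iff.2 fun v => (hS v).symm.trans (h2 v)
        rw [this] at h1
        cases h1

/-- Like terms are collected by exchanging the sums over terms and over representatives. -/
theorem total_eq_sum_supports {ts : List Term} (hts : ∀ t ∈ ts, t.1.Nodup) (z : ℕ → Bool) :
    total z ts = ((supports ts).map fun S => coef ts S * chiSet S z).sum := by
  have h1 : (supports ts).map (fun S => coef ts S * chiSet S z) = (supports ts).map fun S =>
      (ts.map fun t => bif sameSet t.1 S then termVal z t else 0).sum := by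
    refine List.map_congr_left fun S hS => ?_
    obtain ⟨t, ht, rfl⟩ := exists_of_mem_supports hS
    exact coef_mul_chiSet hts (hts t ht) z
  rw [h1, sum_map_sum_comm, total]
  congr 1
  exact List.map_congr_left fun t ht =>
    (sum_supports_eq (pairwise_supports ts) (exists_mem_supports ht) _).symm

/-- If all values of a sum of terms are small, then so is the sum of the squares of the
coefficients. -/
theorem sum_coef_sq_lt {r n : ℕ} {ts : List Term} (hts : ∀ t ∈ ts, ProperTerm r n t) {K : ℤ}
    (hK : ∀ x : Fin n → Bool, total (extend x) ts < K) :
    ((supports ts).map fun S => coef ts S ^ 2).sum < 4 * 9 ^ r * K ^ 2 := by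
  set R := supports ts with hR
  have hprop : ∀ i : Fin R.length, ∃ t ∈ ts, t.1 = R[i] := fun i =>
    exists_of_mem_supports (List.getElem_mem _)
  -- All variables are below `n`, so a mask determines its set; distinct masks make the characters
  -- orthogonal.
  have hinj : Function.Injective fun i : Fin R.length => maskOf n R[i] := by
    intro i j hij
    by_contra hne
    have hsame : ∀ i j : Fin R.length, maskOf n R[i] = maskOf n R[j] → ∀ v, v ∈ R[i] → v ∈ R[j] := by
      intro i j h v hv
      obtain ⟨t, ht, e⟩ := hprop i
      have hv' := (hts t ht).2.2.2 v (e ▸ hv)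
      have : v ∈ R[i] ↔ v ∈ R[j] := by simpa [maskOf] using congrFun h ⟨v, hv'⟩
      exact this.1 hv
    have key : ∀ i j : Fin R.length, i < j → maskOf n R[i] ≠ maskOf n R[j] := by
      intro i j hlt h
      have h1 := List.pairwise_iff_getElem.1 (pairwise_supports ts) i j i.2 j.2 hlt
      have h2 : sameSet R[i] R[j] = true :=
        sameSet_iff.2 fun v => ⟨hsame i j h v, hsame j i h.symm v⟩
      exact absurd (h1.symm.trans h2) (by simp)
    rcases lt_or_gt_of_ne hne with h | h
    · exact key i j h hij
    · exact key j i h hij.symm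
  have h := BooleanCube.sum_sq_lt_of_forall_lt (r := r) (fun i : Fin R.length => (coef ts R[i] : ℝ))
    (fun i : Fin R.length => maskOf n R[i]) hinj (fun i => by
      obtain ⟨t, ht, e⟩ := hprop i
      obtain ⟨h1, -, h3, h4⟩ := hts t ht
      rw [← e, sum_maskOf h1 h4]
      exact h3) (fun i => by
      obtain ⟨t, ht, e⟩ := hprop i
      obtain ⟨h1, h2, h3, h4⟩ := hts t ht
      rw [← e]
      exact exists_maskOf h2 h4) (K := K) (fun x => by
      have h1 := hK x
      rw [total_eq_sum_supports (fun t ht => (hts t ht).1), ← hR,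
        ← Fin.sum_univ_fun_getElem] at h1
      have h2 : ∑ i : Fin R.length, (coef ts R[i] : ℝ) * BooleanCube.chi (maskOf n R[i]) x =
          ((∑ i : Fin R.length, coef ts R[i] * chiSet R[i] (extend x) : ℤ) : ℝ) := by
        push_cast
        refine Finset.sum_congr rfl fun i _ => ?_
        obtain ⟨t, ht, e⟩ := hprop i
        rw [← e, cast_chiSet (hts t ht).1 (hts t ht).2.2.2]
      rw [h2]
      exact_mod_cast h1)
  rw [← Fin.sum_univ_fun_getElem]
  exact_mod_cast h

/-- The equation has at most one solution and `U` has no repetitions. Excluding 0 keeps vanishing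
coefficients from producing a term. -/
theorem filter_add_eq {U : List ℕ} (hU : U.Nodup) (m p : ℕ) :
    U.filter (fun c => !decide (c = 0) && decide (m + c = p)) =
      if m < p ∧ p - m ∈ U then [p - m] else [] := by
  by_cases hlt : m < p
  · have e : (fun c => !decide (c = 0) && decide (m + c = p)) = fun c => c == p - m := by
      funext c
      rw [Bool.eq_iff_iff]
      simp only [Bool.and_eq_true, Bool.not_eq_true', decide_eq_false_iff_not, decide_eq_true_eq,
        beq_iff_eq]
      omega
    rw [e, List.filter_beq]
    by_cases hmem : p - m ∈ U
    · rw [if_pos ⟨hlt, hmem⟩, List.count_eq_one_of_mem hU hmem]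
      rfl
    · rw [if_neg (fun h => hmem h.2), List.count_eq_zero_of_not_mem hmem]
      rfl
  · rw [if_neg (fun h => hlt h.1), List.filter_eq_nil_iff]
    intro c _
    simp only [Bool.and_eq_true, Bool.not_eq_true', decide_eq_false_iff_not, decide_eq_true_eq]
    omega

theorem isSmall_downFrom_iff {N : ℕ} {ts : List Term} {S : List ℕ} :
    isSmall (PT.downFrom N) ts S = true ↔ (coef ts S).natAbs ≤ N := by
  simp only [isSmall, List.any_eq_true, PT.mem_downFrom, Bool.or_eq_true, decide_eq_true_eq, coef]
  constructor
  · rintro ⟨c, hc, h | h⟩ <;> omega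
  · intro h
    exact ⟨_, h, by omega⟩

theorem nodup_downFrom (N : ℕ) : (PT.downFrom N).Nodup := by
  rw [PT.downFrom, List.nodup_reverse]
  exact List.nodup_range

theorem collect_eq {N : ℕ} {ts : List Term} {S : List ℕ}
    (h : isSmall (PT.downFrom N) ts S = true) : collect (PT.downFrom N) ts S =
      if coef ts S = 0 then [] else [(S, decide (coef ts S < 0), (coef ts S).natAbs)] := by
  rw [isSmall_downFrom_iff] at h
  rw [collect, filter_add_eq (nodup_downFrom N), filter_add_eq (nodup_downFrom N)]
  simp only [PT.mem_downFrom]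
  unfold coef at h ⊢
  generalize weightOf ts S false = a at *
  generalize weightOf ts S true = b at *
  rcases lt_trichotomy a b with hab | hab | hab
  · rw [if_neg (by omega), if_pos (by omega), if_neg (by omega)]
    have h1 : (a : ℤ) - b < 0 := by omega
    have h2 : ((a : ℤ) - b).natAbs = b - a := by omega
    simp [h1, h2]
  · rw [if_neg (by omega), if_neg (by omega), if_pos (by omega)]
    rfl
  · rw [if_pos (by omega), if_neg (by omega), if_neg (by omega)]
    have h1 : ¬ (a : ℤ) - b < 0 := by omega
    have h2 : ((a : ℤ) - b).natAbs = a - b := by omega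
    simp [h1, h2]

/-- Smallness is essential: `collect` drops a coefficient that is not found in its range. -/
theorem total_collected {N : ℕ} {ts : List Term} (hts : ∀ t ∈ ts, t.1.Nodup)
    (h : ∀ S ∈ supports ts, isSmall (PT.downFrom N) ts S = true) (z : ℕ → Bool) :
    total z (collected (PT.downFrom N) ts) = total z ts := by
  rw [collected, total_flatMap, total_eq_sum_supports hts]
  congr 1
  refine List.map_congr_left fun S hS => ?_
  rw [collect_eq (h S hS)]
  split_ifs with h0
  · simp [total, h0]
  · have : sg (decide (coef ts S < 0)) * ((coef ts S).natAbs : ℤ) = coef ts S := by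
      by_cases hneg : coef ts S < 0
      · simp only [hneg, decide_true, sg, cond_true]
        omega
      · simp only [hneg, decide_false, sg, cond_false]
        omega
    simp only [total, termVal, List.map_cons, List.map_nil, List.sum_cons, List.sum_nil, add_zero]
    rw [this]

/-- Integrality enters here: the square of a nonzero coefficient is at least 1. -/
theorem length_collected_le {N : ℕ} {ts : List Term}
    (h : ∀ S ∈ supports ts, isSmall (PT.downFrom N) ts S = true) :
    ((collected (PT.downFrom N) ts).length : ℤ) ≤
      ((supports ts).map fun S => coef ts S ^ 2).sum := by
  rw [collected]
  revert h
  induction supports ts with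
  | nil => simp
  | cons S R ih =>
    intro h
    have h1 := ih fun S hS => h S (List.mem_cons_of_mem _ hS)
    rw [List.flatMap_cons, List.length_append, List.map_cons, List.sum_cons,
      collect_eq (h S List.mem_cons_self)]
    split_ifs with h0
    · simpa [h0] using h1
    · have : 1 ≤ coef ts S ^ 2 := by
        have : 0 < coef ts S ^ 2 := by positivity
        omega
      rw [List.length_singleton, Nat.cast_add, Nat.cast_one]
      linarith

theorem of_mem_collected {N : ℕ} {ts : List Term} {t : Term}
    (ht : t ∈ collected (PT.downFrom N) ts) :
    (∃ u ∈ ts, u.1 = t.1) ∧ 0 < t.2.2 ∧ t.2.2 ≤ N := by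
  obtain ⟨S, hS, ht⟩ := List.mem_flatMap.1 ht
  obtain ⟨u, hu, rfl⟩ := exists_of_mem_supports hS
  simp only [collect, List.mem_append, List.mem_map, List.mem_filter, PT.mem_downFrom,
    Bool.and_eq_true, Bool.not_eq_true', decide_eq_false_iff_not] at ht
  rcases ht with ⟨c, ⟨hc, h0, -⟩, rfl⟩ | ⟨c, ⟨hc, h0, -⟩, rfl⟩ <;>
    exact ⟨⟨u, hu, rfl⟩, Nat.pos_of_ne_zero h0, hc⟩

end MaxCSPKernel


/-! ### The instance that is written -/

namespace MaxCSPKernel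

open TreeMachine Enc MaxCSP

theorem mem_dedup_foldr (l : List ℕ) :
    (∀ v, v ∈ l.foldr (fun v acc => bif acc.any (fun u => decide (u = v)) then acc else v :: acc) []
      ↔ v ∈ l) ∧
    (l.foldr (fun v acc => bif acc.any (fun u => decide (u = v)) then acc else v :: acc) []).Nodup ∧
    (l.foldr (fun v acc => bif acc.any (fun u => decide (u = v)) then acc else v :: acc) []).length
      ≤ l.length := by
  induction l with
  | nil => simp
  | cons w l ih =>
    rw [List.foldr_cons]
    generalize l.foldr _ [] = acc at ih
    obtain ⟨h1, h2, h3⟩ := ih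
    have hany : acc.any (fun u => decide (u = w)) = decide (w ∈ acc) := by
      rw [Bool.eq_iff_iff]
      simp
    rw [hany]
    by_cases hw : w ∈ acc
    · simp only [hw, decide_true, cond_true, List.mem_cons, List.length_cons]
      refine ⟨fun v => ⟨fun h => Or.inr ((h1 v).1 h), ?_⟩, h2, by omega⟩
      rintro (rfl | h)
      · exact hw
      · exact (h1 v).2 h
    · simp only [hw, decide_false, cond_false, List.mem_cons, List.length_cons, List.nodup_cons]
      exact ⟨fun v => by rw [h1], ⟨not_false, h2⟩, by omega⟩

theorem mem_variablesOf {L : List Term} {v : ℕ} : v ∈ variablesOf L ↔ ∃ t ∈ L, v ∈ t.1 := by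
  rw [variablesOf, (mem_dedup_foldr _).1, List.mem_flatMap]

theorem length_variablesOf_le {L : List Term} {r : ℕ} (h : ∀ t ∈ L, t.1.length ≤ r) :
    (variablesOf L).length ≤ r * L.length := by
  refine (mem_dedup_foldr _).2.2.trans ?_
  induction L with
  | nil => simp
  | cons t L ih =>
    have h1 := ih fun t ht => h t (List.mem_cons_of_mem _ ht)
    have h2 := h t List.mem_cons_self
    rw [List.flatMap_cons, List.length_append, List.length_cons, Nat.mul_add]
    omega

/-- Lookup in `W.reverse` inverts the renaming of variables by `indexOf W`. -/
theorem getElem?_indexOf {W : List ℕ} {v : ℕ} (hv : v ∈ W) :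
    W.reverse[indexOf W v]? = some v := by
  have key : ∀ (W : List ℕ) (n : ℕ), W.foldl (fun (x : Bool × ℕ) w =>
      (x.1 || decide (w = v), bif x.1 then x.2 + 1 else x.2)) (true, n) =
        (true, n + W.length) := by
    intro W
    induction W with
    | nil => simp
    | cons w W ih =>
      intro n
      rw [List.foldl_cons]
      simp only [Bool.true_or, cond_true]
      rw [ih, List.length_cons]
      congr 1
      omega
  induction W with
  | nil => simp at hv
  | cons w W ih =>
    by_cases hw : w = v
    · have h1 : indexOf (w :: W) v = W.length := by
        rw [indexOf, List.foldl_cons]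
        simp only [hw, decide_true, Bool.or_true, cond_false, key]
        omega
      rw [h1, hw, List.reverse_cons, List.getElem?_append_right (by simp)]
      simp
    · have h1 : indexOf (w :: W) v = indexOf W v := by
        rw [indexOf, List.foldl_cons]
        simp only [hw, decide_false, Bool.or_false, cond_false]
        rfl
      have h2 := ih (by
        rcases List.mem_cons.1 hv with h | h
        · exact absurd h.symm hw
        · exact h)
      have h3 := (List.getElem?_eq_some_iff.1 h2).1
      rw [h1, List.reverse_cons, List.getElem?_append_left h3, h2]

theorem indexOf_lt {W : List ℕ} {v : ℕ} (hv : v ∈ W) : indexOf W v < W.length := by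
  have := (List.getElem?_eq_some_iff.1 (getElem?_indexOf hv)).1
  simpa using this

theorem indexOf_inj {W : List ℕ} {u v : ℕ} (hu : u ∈ W) (hv : v ∈ W)
    (h : indexOf W u = indexOf W v) : u = v := by
  have h1 := getElem?_indexOf hu
  rw [h, getElem?_indexOf hv] at h1
  simpa using h1.symm

/-- A term from which a parity constraint on the variables in `W` can be formed. -/
def GoodTerm (r : ℕ) (W : List ℕ) (t : Term) : Prop :=
  t.1.Nodup ∧ t.1.length ≤ r ∧ (∀ v ∈ t.1, v ∈ W) ∧ 0 < t.2.2

/-- The parity constraint for a term. -/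
def parityConstraint {r : ℕ} {W : List ℕ} {t : Term} (h : GoodTerm r W t) :
    Constraint r W.length where
  arity := t.1.length
  arity_le := h.2.1
  scope := ⟨fun i => ⟨indexOf W t.1[i], indexOf_lt (h.2.2.1 _ (List.getElem_mem _))⟩, fun i j hij => by
    have h1 := indexOf_inj (h.2.2.1 _ (List.getElem_mem _)) (h.2.2.1 _ (List.getElem_mem _))
      (Fin.mk.inj hij)
    exact Fin.ext ((h.1.getElem_inj_iff).1 h1)⟩
  func y := Bool.xor (decide (Even (∑ j, (y j).toNat))) t.2.1
  -- A satisfied parity is `(1 ± χ) / 2`, so with the weight `2 c` the constraint contributes `c ± c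
  -- χ`: the term plus a constant.
  weight := t.2.2 + t.2.2
  weight_pos := by have := h.2.2.2; omega

theorem mem_parityKeys {r a : ℕ} (ha : a ≤ r) (s : Bool) :
    (List.replicate a (), s) ∈ parityKeys r := by
  simp only [parityKeys, List.mem_flatMap, List.mem_range]
  exact ⟨a, by omega, by cases s <;> simp⟩

theorem map_inl_encodeNum (n : ℕ) :
    (encodeNum n).map (Sum.inl : Sym → Ch) = numWord n := by
  rw [encodeNum, encodeBits, encodeNat_eq_bits, numWord, List.map_append, List.map_map]
  rfl

theorem parityOf_eq {r : ℕ} {S : List ℕ} (hS : S.length ≤ r) (s : Bool) :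
    parityOf r (S.map fun _ => (), s) = parityTable S.length s := by
  have e : S.map (fun _ => ()) = List.replicate S.length () := by
    rw [List.map_const']
  rw [e, parityOf, if_pos (mem_parityKeys hS s), List.length_replicate]

theorem map_inl_encode_parityConstraint {r : ℕ} {W : List ℕ} {t : Term} (h : GoodTerm r W t) :
    (parityConstraint h).encode.map (Sum.inl : Sym → Ch) = conWord r W t := by
  have h1 : (parityConstraint h).vars = t.1.map (indexOf W) := by
    refine List.ext_getElem ?_ fun i h1 h2 => ?_
    · simp [Constraint.vars, parityConstraint]
    · simp [Constraint.vars, parityConstraint]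
      rfl
  have h2 : (parityConstraint h).truthTable = parityTable t.1.length t.2.1 := rfl
  have h3 : (parityConstraint h).weight = t.2.2 + t.2.2 := rfl
  rw [Constraint.encode, h1, h2, h3, conWord, parityOf_eq h.2.1, List.map_append, List.map_cons,
    List.map_append, map_inl_encodeNum, encodeBits]
  congr 1
  · rw [List.map_flatMap, List.flatMap_map]
    congr 1
    funext v
    rw [List.map_cons, map_inl_encodeNum]
  · simp [Function.comp_def]

theorem prod_sg (l : List Bool) :
    (l.map sg).prod = if Even (l.map Bool.toNat).sum then 1 else -1 := by
  induction l with
  | nil => simp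
  | cons b l ih =>
    rw [List.map_cons, List.map_cons, List.prod_cons, List.sum_cons, ih]
    cases b
    · simp [sg]
    · simp only [sg, cond_true, Bool.toNat_true, Nat.even_add, Nat.not_even_one, false_iff]
      by_cases h : Even (l.map Bool.toNat).sum <;> simp [h]

theorem parityConstraint_sat {r : ℕ} {W : List ℕ} {t : Term} (h : GoodTerm r W t)
    (x : Fin W.length → Bool) :
    ((parityConstraint h).weight * ((parityConstraint h).sat x).toNat : ℤ) =
      t.2.2 + termVal (fun v => extend x (indexOf W v)) t := by
  have h1 : (parityConstraint h).sat x = Bool.xor (decide (Even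
      ((t.1.map fun v => extend x (indexOf W v)).map Bool.toNat).sum)) t.2.1 := by
    have e : ((t.1.map fun v => extend x (indexOf W v)).map Bool.toNat).sum =
        ∑ j : Fin t.1.length, (x ⟨indexOf W t.1[j],
          indexOf_lt (h.2.2.1 _ (List.getElem_mem _))⟩).toNat := by
      rw [List.map_map, ← Fin.sum_univ_fun_getElem]
      refine Finset.sum_congr rfl fun j _ => ?_
      have := indexOf_lt (h.2.2.1 _ (List.getElem_mem (l := t.1) j.2))
      simp [extend, this]
    rw [e]
    rfl
  have h2 : (parityConstraint h).weight = t.2.2 + t.2.2 := rfl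
  have h3 : chiSet t.1 (fun v => extend x (indexOf W v)) =
      ((t.1.map fun v => extend x (indexOf W v)).map sg).prod := by
    rw [chiSet, List.map_map]
    rfl
  rw [h1, h2, termVal, h3, prod_sg]
  generalize ((t.1.map fun v => extend x (indexOf W v)).map Bool.toNat).sum = N
  by_cases he : Even N <;> cases t.2.1 <;> simp [he, sg]

theorem exists_constraints {r : ℕ} (W : List ℕ) (L : List Term) (hL : ∀ t ∈ L, GoodTerm r W t) :
    ∃ cs : List (Constraint r W.length),
      (cs.flatMap Constraint.encode).map (Sum.inl : Sym → Ch) = L.flatMap (conWord r W) ∧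
      ∃ C : ℤ, ∀ x, (cs.map fun c => (c.weight * (c.sat x).toNat : ℤ)).sum =
        C + total (fun v => extend x (indexOf W v)) L := by
  induction L with
  | nil => exact ⟨[], rfl, 0, fun x => by simp [total]⟩
  | cons t L ih =>
    obtain ⟨cs, h1, C, h2⟩ := ih fun t ht => hL t (List.mem_cons_of_mem _ ht)
    refine ⟨parityConstraint (hL t List.mem_cons_self) :: cs, ?_, t.2.2 + C, fun x => ?_⟩
    · rw [List.flatMap_cons, List.map_append, h1, map_inl_encode_parityConstraint,
        List.flatMap_cons]
    · rw [List.map_cons, List.sum_cons, h2, parityConstraint_sat, total, total, List.map_cons,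
        List.sum_cons]
      ring

theorem total_congr {z z' : ℕ → Bool} {ts : List Term} (h : ∀ t ∈ ts, ∀ v ∈ t.1, z v = z' v) :
    total z ts = total z' ts := by
  rw [total, total]
  congr 1
  refine List.map_congr_left fun t ht => ?_
  rw [termVal, termVal, chiSet, chiSet]
  congr 2
  exact List.map_congr_left fun v hv => by rw [h t ht v hv]

theorem total_rename (z : ℕ → Bool) (f : ℕ → ℕ) (L : List Term) :
    total z (L.map fun t => (t.1.map f, t.2)) = total (fun v => z (f v)) L := by
  rw [total, total, List.map_map]
  congr 1
  refine List.map_congr_left fun t _ => ?_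
  simp only [Function.comp_def, termVal, chiSet, List.map_map]

/-- The instance whose constraints are the parity constraints for some terms. -/
theorem exists_instance {r n : ℕ} {L : List Term} (hL : ∀ t ∈ L, ProperTerm r n t)
    (hpos : ∀ t ∈ L, 0 < t.2.2) (k : ℕ) :
    ∃ I : Instance r, I.encode.map Sum.inl ++ (Computability.encodeNat (2 ^ r * k)).map Sum.inr =
        instWord r L k ∧ I.n = (variablesOf L).length ∧
      ((I, 2 ^ r * k) ∈ (MaxCSPAA r).yes ↔ ∃ z, ((2 ^ r * k : ℕ) : ℤ) ≤ total z L) := by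
  set W := variablesOf L with hW
  have hgood : ∀ t ∈ L, GoodTerm r W t := fun t ht =>
    ⟨(hL t ht).1, (hL t ht).2.2.1, fun v hv => mem_variablesOf.2 ⟨t, ht, hv⟩, hpos t ht⟩
  obtain ⟨cs, hcs, C, hC⟩ := exists_constraints W L hgood
  refine ⟨⟨W.length, cs⟩, ?_, rfl, ?_⟩
  · rw [Instance.encode, List.map_append, hcs, instWord, ← hW, encodeNat_eq_bits, List.append_assoc,
      List.map_replicate, List.map_const']
  · have hproper : ∀ t ∈ L.map (fun t : Term => ((t.1.map (indexOf W), t.2) : Term)),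
        ProperTerm r W.length t := by
      intro t ht
      obtain ⟨t', ht', rfl⟩ := List.mem_map.1 ht
      obtain ⟨h1, h2, h3, -⟩ := hL t' ht'
      have hmem := (hgood t' ht').2.2.1
      refine ⟨?_, by simpa using h2, by simpa using h3, ?_⟩
      · exact List.Nodup.map_on (fun u hu v hv h => indexOf_inj (hmem u hu) (hmem v hv) h) h1
      · intro v hv
        obtain ⟨u, hu, rfl⟩ := List.mem_map.1 hv
        exact indexOf_lt (hmem u hu)
    have hav := mul_satWeight_sub_average (I := ⟨W.length, cs⟩) hproper (q := 1) (C := C)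
      (fun x => by rw [one_mul, satWeight_eq, total_rename]; exact hC x)
    have hyes : ∀ x : Fin W.length → Bool,
        (Instance.average ⟨W.length, cs⟩ + ((2 ^ r * k : ℕ) : ℚ) ≤
          (Instance.satWeight ⟨W.length, cs⟩ x : ℚ) ↔
        ((2 ^ r * k : ℕ) : ℤ) ≤ total (fun v => extend x (indexOf W v)) L) := by
      intro x
      have h1 := hav x
      rw [total_rename, Int.cast_one, one_mul] at h1
      rw [← Int.cast_le (R := ℚ), ← h1, Int.cast_natCast, le_sub_iff_add_le']
    constructor
    · rintro ⟨x, hx⟩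
      exact ⟨_, (hyes x).1 hx⟩
    · rintro ⟨z, hz⟩
      -- The assignment is transported back along the renaming.
      refine ⟨fun i => z (W.reverse[i]'(by simp)), (hyes _).2 ?_⟩
      refine hz.trans_eq (total_congr fun t ht v hv => ?_)
      have hv' := (hgood t ht).2.2.1 v hv
      obtain ⟨h1, h2⟩ := List.getElem?_eq_some_iff.1 (getElem?_indexOf hv')
      rw [extend, dif_pos (indexOf_lt hv')]
      exact congrArg z h2.symm

/-! ### Size bounds and the kernel -/

theorem length_budget (r : ℕ) (K : List ℕ) : (budget r K).length = bigC r * K.length ^ 2 := by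
  simp only [budget, List.length_flatMap, List.length_replicate, List.map_const',
    List.sum_replicate, smul_eq_mul]
  ring

/-- A linear bound is enough, since all numbers in the output instance are polynomial in `k`. -/
theorem length_numWord_le (n : ℕ) : (numWord n).length ≤ n + 1 := by
  have : n.bits.length ≤ n := by
    rw [Nat.size_eq_bits_len]
    exact Nat.size_le.2 Nat.lt_two_pow_self
  simpa [numWord] using this

theorem length_conWord_le {r : ℕ} {W : List ℕ} {t : Term} (h : GoodTerm r W t) {M : ℕ}
    (hM : t.2.2 ≤ M) : (conWord r W t).length ≤ r * (W.length + 2) + 2 ^ r + 2 * M + 3 := by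
  have h1 : ∀ S : List ℕ, (∀ v ∈ S, v ∈ W) →
      (S.flatMap fun v => (.inl .arg : Ch) :: numWord (indexOf W v)).length ≤
        S.length * (W.length + 2) := by
    intro S
    induction S with
    | nil => simp
    | cons v S ih =>
      intro hS
      have h1 := ih fun u hu => hS u (List.mem_cons_of_mem _ hu)
      have h2 := length_numWord_le (indexOf W v)
      have h3 := indexOf_lt (hS v List.mem_cons_self)
      rw [List.flatMap_cons, List.length_append, List.length_cons, List.length_cons, Nat.add_mul]
      omega
  have h2 := h1 t.1 h.2.2.1
  have h3 : t.1.length * (W.length + 2) ≤ r * (W.length + 2) := Nat.mul_le_mul_right _ h.2.1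
  have h4 : 2 ^ t.1.length ≤ 2 ^ r := Nat.pow_le_pow_right (by norm_num) h.2.1
  have h5 := length_numWord_le (t.2.2 + t.2.2)
  have h6 : (parityTable t.1.length t.2.1).length = 2 ^ t.1.length := by simp [parityTable]
  rw [conWord, parityOf_eq h.2.1]
  simp only [List.length_append, List.length_cons, List.length_map, h6]
  omega

/-- The bound for the size of the kernel. -/
noncomputable def sizeBound (r : ℕ) : Polynomial ℕ :=
  let M : Polynomial ℕ := Polynomial.C (bigC r) * Polynomial.X ^ 2
  -- The summand `X` covers inputs that are shorter than `k`; the rest allows for `r * M` variables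
  -- and `M` constraints.
  Polynomial.X + (Polynomial.C r * M + M *
    (Polynomial.C r * (Polynomial.C r * M + 2) + Polynomial.C (2 ^ r) + 2 * M + 3))

theorem eval_sizeBound (r k : ℕ) : (sizeBound r).eval k = k + (r * (bigC r * k ^ 2) +
    bigC r * k ^ 2 * (r * (r * (bigC r * k ^ 2) + 2) + 2 ^ r + 2 * (bigC r * k ^ 2) + 3)) := by
  simp only [sizeBound, Polynomial.eval_add, Polynomial.eval_mul, Polynomial.eval_X,
    Polynomial.eval_C, Polynomial.eval_pow, Polynomial.eval_ofNat]

/-- The words computed by the kernelization encode equivalent small instances. -/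
theorem exists_kernel (r : ℕ) (I : Instance r) (k : ℕ) :
    ∃ J : Instance r × ℕ, kernelWord r ((MaxCSPAA r).encodePair (I, k)) =
        (MaxCSPAA r).encodePair J ∧
      ((I, k) ∈ (MaxCSPAA r).yes ↔ J ∈ (MaxCSPAA r).yes) ∧ J.2 ≤ 2 ^ r * k ∧
      J.1.encode.length ≤ (sizeBound r).eval k := by
  set w : List Ch := I.encode.map Sum.inl ++ (Computability.encodeNat k).map Sum.inr with hw
  have hwe : (MaxCSPAA r).encodePair (I, k) = w := rfl
  have hparam : parseParam w = k := parseParam_encode I k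
  have hcons : parseCons w = I.constraints.map conOf := parseCons_encode I k
  have h2r : 1 ≤ 2 ^ r := Nat.one_le_two_pow
  obtain ⟨hu1, hu2⟩ := unary_downFrom w.length k
  rw [hwe, kernelWord, hparam, hcons]
  by_cases hk : k ≤ w.length
  swap
  -- The word is shorter than `k`, so the input is its own kernel.
  · have hf : (unary (PT.downFrom w.length) k).1 = false := by
      rw [← Bool.not_eq_true]
      exact fun h => hk (hu1.1 h)
    rw [hf, cond_false]
    refine ⟨(I, k), rfl, Iff.rfl, Nat.le_mul_of_pos_left k (by omega), ?_⟩
    have h1 : I.encode.length ≤ w.length := by simp [hw]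
    rw [eval_sizeBound]
    dsimp only
    omega
  rw [if_pos hk] at hu2
  rw [hu1.2 hk, cond_true, length_budget, hu2]
  set M := bigC r * k ^ 2 with hM
  set ts := terms r (I.constraints.map conOf) with hts
  have hproper : ∀ t ∈ ts, ProperTerm r I.n t := fun t ht => properTerm_of_mem_terms ht
  have hnodup : ∀ t ∈ ts, t.1.Nodup := fun t ht => (hproper t ht).1
  obtain ⟨C, hC⟩ := exists_total_terms I
  have hav := mul_satWeight_sub_average hproper hC
  have hyes : ∀ x : Fin I.n → Bool, (I.average + (k : ℚ) ≤ (I.satWeight x : ℚ) ↔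
      ((2 ^ r * k : ℕ) : ℤ) ≤ total (extend x) ts) := by
    intro x
    have h1 := hav x
    push_cast at h1
    have h3 : (0 : ℚ) < 2 ^ r := by positivity
    rw [← Int.cast_le (R := ℚ), ← h1]
    push_cast
    rw [mul_le_mul_iff_right₀ h3, le_sub_iff_add_le']
  -- Only variables below `I.n` occur in the terms, so assignments of all natural numbers may be
  -- used. This form does not mention the instance and can be compared with that of the new one.
  have hyes' : (I, k) ∈ (MaxCSPAA r).yes ↔ ∃ z, ((2 ^ r * k : ℕ) : ℤ) ≤ total z ts := by
    constructor
    · rintro ⟨x, hx⟩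
      exact ⟨_, (hyes x).1 hx⟩
    · rintro ⟨z, hz⟩
      refine ⟨fun i => z i, (hyes _).2 (hz.trans_eq (total_congr fun t ht v hv => ?_))⟩
      rw [extend, dif_pos ((hproper t ht).2.2.2 v hv)]
  rw [reduceWith]
  cases htest : ((supports ts).all fun S => isSmall (PT.downFrom M) ts S) &&
      (PT.downFrom M).any fun c => decide (c = (collected (PT.downFrom M) ts).length) with
  | false =>
    rw [cond_false]
    -- The empty word encodes the empty instance with parameter 0, a yes-instance because 0 is at
    -- least 0.
    refine ⟨(⟨0, []⟩, 0), rfl, iff_of_true ?_ ⟨fun _ => false, ?_⟩, Nat.zero_le _, Nat.zero_le _⟩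
    · by_contra hno
      have hlt : ∀ x : Fin I.n → Bool, total (extend x) ts < ((2 ^ r * k : ℕ) : ℤ) := by
        intro x
        by_contra h
        exact hno ⟨x, (hyes x).2 (not_lt.1 h)⟩
      have hsum := sum_coef_sq_lt hproper hlt
      -- The variance bound for `K = 2 ^ r * k` is exactly `M`; this is the origin of `36 ^ r` in
      -- `bigC`.
      have hMZ : 4 * 9 ^ r * (((2 ^ r * k : ℕ) : ℤ)) ^ 2 = (M : ℤ) := by
        have : (36 : ℤ) ^ r = 9 ^ r * (2 ^ r) ^ 2 := by
          rw [← pow_mul, mul_comm r 2, pow_mul, ← mul_pow]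
          norm_num
        rw [hM, bigC]
        push_cast
        rw [this]
        ring
      rw [hMZ] at hsum
      have hsmall : ∀ S ∈ supports ts, isSmall (PT.downFrom M) ts S = true := by
        intro S hS
        rw [isSmall_downFrom_iff]
        have h1 : coef ts S ^ 2 ≤ ((supports ts).map fun S => coef ts S ^ 2).sum :=
          List.single_le_sum (fun y hy => by
            obtain ⟨T, _, rfl⟩ := List.mem_map.1 hy
            positivity) _ (List.mem_map_of_mem hS)
        -- An integer is at most its square, so the bound for the sum of squares also bounds each
        -- coefficient.
        have h2 : ((coef ts S).natAbs : ℤ) ≤ coef ts S ^ 2 := by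
          rw [← Int.natAbs_sq]
          exact_mod_cast Nat.le_self_pow (by norm_num) _
        omega
      have hlen := length_collected_le hsmall
      have h1 : ((supports ts).all fun S => isSmall (PT.downFrom M) ts S) = true :=
        List.all_eq_true.2 hsmall
      have h2 : ((PT.downFrom M).any fun c =>
          decide (c = (collected (PT.downFrom M) ts).length)) = true :=
        List.any_eq_true.2 ⟨_, PT.mem_downFrom.2 (Int.ofNat_le.1 (hlen.trans hsum.le)),
          decide_eq_true rfl⟩
      rw [h1, h2] at htest
      cases htest
    · simp [Instance.average, Instance.satWeight]
  | true =>
    rw [cond_true]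
    rw [Bool.and_eq_true, List.all_eq_true, List.any_eq_true] at htest
    obtain ⟨hsmall, c, hc, hlen⟩ := htest
    rw [PT.mem_downFrom] at hc
    rw [decide_eq_true_eq] at hlen
    set L := collected (PT.downFrom M) ts with hL
    have hLproper : ∀ t ∈ L, ProperTerm r I.n t := by
      intro t ht
      obtain ⟨⟨u, hu, e⟩, -⟩ := of_mem_collected ht
      have := hproper u hu
      rw [ProperTerm, e] at this
      exact this
    have hLpos : ∀ t ∈ L, 0 < t.2.2 := fun t ht => (of_mem_collected ht).2.1
    obtain ⟨J, hJ, hJn, hJyes⟩ := exists_instance hLproper hLpos k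
    refine ⟨(J, 2 ^ r * k), hJ.symm, ?_, le_rfl, ?_⟩
    · rw [hyes', hJyes]
      simp only [hL, total_collected hnodup hsmall]
    · have hlenL : L.length ≤ M := by omega
      have hW : (variablesOf L).length ≤ r * M :=
        (length_variablesOf_le fun t ht => (hLproper t ht).2.2.1).trans
          (Nat.mul_le_mul_left _ hlenL)
      have hcw : ∀ t ∈ L, (conWord r (variablesOf L) t).length ≤
          r * (r * M + 2) + 2 ^ r + 2 * M + 3 := by
        intro t ht
        refine (length_conWord_le ⟨(hLproper t ht).1, (hLproper t ht).2.2.1,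
          fun v hv => mem_variablesOf.2 ⟨t, ht, hv⟩, hLpos t ht⟩
          (of_mem_collected ht).2.2).trans ?_
        gcongr
      have hflat : (L.flatMap fun t => conWord r (variablesOf L) t).length ≤
          M * (r * (r * M + 2) + 2 ^ r + 2 * M + 3) := by
        rw [List.length_flatMap]
        refine (List.sum_le_card_nsmul _ (r * (r * M + 2) + 2 ^ r + 2 * M + 3) ?_).trans ?_
        · intro y hy
          obtain ⟨t, ht, rfl⟩ := List.mem_map.1 hy
          exact hcw t ht
        · rw [List.length_map, smul_eq_mul]
          gcongr
      have hlenJ := congrArg List.length hJ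
      rw [instWord, encodeNat_eq_bits] at hlenJ
      simp only [List.length_append, List.length_map] at hlenJ
      rw [eval_sizeBound, ← hM]
      dsimp only
      omega

end MaxCSPKernel

/-- The map `F` is obtained by choice, but on encodings it acts as `kernelWord r`, and that is all
the machine has to compute. The two reversals compensate for those made when a word is read onto the
stack and written from it. -/
theorem mainTheorem3 (r : ℕ) (hr : 0 < r) : (MaxCSPAA r).HasPolynomialSizeKernel := by
  choose F hF using fun p : (MaxCSPAA r).Inst × ℕ => MaxCSPKernel.exists_kernel r p.1 p.2
  refine ⟨F, fun k => 2 ^ r * k, MaxCSPKernel.sizeBound r, ?_, fun I k => (hF (I, k)).2.1,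
    fun I k => (hF (I, k)).2.2.1, fun I k => (hF (I, k)).2.2.2⟩
  have hPT : TreeMachine.PT fun w : List TreeMachine.Ch =>
      (MaxCSPKernel.kernelWord r w.reverse).reverse :=
    ((MaxCSPKernel.PT_kernelWord r).comp TreeMachine.PT.id.reverse).reverse
  refine TreeMachine.computableInPolyTime_of_PT _ _ F hPT fun p => ?_
  exact congrArg List.reverse
    ((congrArg (MaxCSPKernel.kernelWord r) (List.reverse_reverse _)).trans (hF p).1)
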